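/- **Theorem 2.3.** Let $N\ge 1$, $c>0$, let $S^-\subset\mathbb R^N$ be a bounded open set whose boundary $S$ is a Lyapunov surface (a $C^1$ surface, with $S^-$ locally on one side, whose unit normal is Hölder continuous), and let $n$ be its outer unit normal. Let $G$ be integrable on $S^-\times(0,T)$ for every $T$. Let $u$ be a classical solution, possibly with shock waves, of $$\Delta u-c^{-2}\,\ddot u=G\ \text{ in } S^-\times(0,\infty),\qquad u|_{t=0}=u_0,\quad \dot u|_{t=0}=\dot u_0,\qquad u=u_S,\quad \frac{\partial u}{\partial n}=p\ \text{ on } S ,$$ in the following sense. There are finitely or countably many wave fronts $F_k$, i.e. $C^1$ hypersurfaces in space-time whose normal $(\nu,\nu_t)$ satisfies $\nu_t<0$ and $c=-\nu_t/\|\nu\|$, and a closed exceptional set $Z\subset\mathbb R^{N+1}$ of zero $N$-dimensional Hausdorff measure (where fronts may end, focus, intersect or reach the boundary), such that, with $R=(S^-\times(0,\infty))\setminus(Z\cup\bigcup_kF_k)$: * $u$ is continuous on $\overline{S^-}\times[0,\infty)$, is $C^2$ near every point of $R$, and satisfies the equation on $R$; for every $T$ its first derivatives are bounded on $R\cap\{t\le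 T\}$; * at every point of $F_k\setminus Z$ in $S^-\times(0,\infty)$ the first derivatives of $u$ have one-sided limits from the two sides of $F_k$ (through $R$), and $[\dot u+c\,m_i\,u_{,i}]_{F_k}=0$ with $m=\nu/\|\nu\|$ (while $[u]_{F_k}=0$ by continuity); * $u(x,0)=u_0(x)$ for $x\in\overline{S^-}$, and the one-sided derivative $\dot u(x,0)$ exists and equals $\dot u_0(x)$ for almost every $x\in S^-$; * $u=u_S$ on $S\times[0,\infty)$, and $\nabla u(y,s)\cdot n(x)\to p(x,t)$ as $R\ni(y,s)\to(x,t)$, for all $x\in S$, $t>0$ with $(x,t)\notin Z$. Let $L=\tfrac12\big(c^{-2}\dot u^2-|\nabla u|^2\big)$. Then the jump terms on the shock fronts vanish: at every point of $F_k\setminus Z$ in $S^-\times(0,\infty)$, $$\big[\,u\,(c^{-2}\dot u\,\nu_t-u_{,j}\nu_j)\,\big]_{F_k}=0 ,$$ the one-sided limits existing; and for every $t>0$ all integrands below are absolutely integrable ($u_Sp$ with respect to the product of surface measure and time) and $$2\int_0^t\!\!\int_{S^-}L\,dV\,ds=\int_0^t\!\!\int_{S^-}u\,G\,dV\,ds-\int_0^t\!\!\int_S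 u_S\,p\,dS\,ds+c^{-2}\int_{S^-}\big(u(x,t)\,\dot u(x,t)-u_0(x)\,\dot u_0(x)\big)\,dV(x).$$ -/

import Mathlib

open MeasureTheory Filter Topology Set InnerProductSpace
open scoped MeasureTheory RealInnerProductSpace

/-- The space `ℝ^N` with its Euclidean norm. -/
abbrev Space (N : ℕ) : Type := EuclideanSpace ℝ (Fin N)

/-- Space-time points `(x, t)`. -/
abbrev SpaceTime (N : ℕ) : Type := Space N × ℝ

noncomputable section

variable {N : ℕ}

/-- The time derivative `∂f/∂t` at `z = (x, t)`. -/
def timeDeriv (f : SpaceTime N → ℝ) (z : SpaceTime N) : ℝ :=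
  deriv (fun s : ℝ => f (z.1, s)) z.2

/-- The spatial gradient `(∂f/∂x₁, …, ∂f/∂x_N)` at `z = (x, t)`. -/
def gradX (f : SpaceTime N → ℝ) (z : SpaceTime N) : Space N :=
  gradient (fun y : Space N => f (y, z.2)) z.1

/-- The wave operator `Δ f - c⁻² ∂²f/∂t²` at `z = (x, t)`. -/
def waveOp (c : ℝ) (f : SpaceTime N → ℝ) (z : SpaceTime N) : ℝ :=
  Laplacian.laplacian (fun y : Space N => f (y, z.2)) z.1
    - (c ^ 2)⁻¹ * iteratedDeriv 2 (fun s : ℝ => f (z.1, s)) z.2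

/-- The Lagrangian `L = ½ ((∂u/∂τ)² - |∇u|²)`, where `τ = c t`, so that `∂u/∂τ = c⁻¹ ∂u/∂t`. -/
def lagrangian (c : ℝ) (u : SpaceTime N → ℝ) (z : SpaceTime N) : ℝ :=
  (1 / 2) * ((c⁻¹ * timeDeriv u z) ^ 2 - ‖gradX u z‖ ^ 2)

/-- `Ω` is a bounded open set whose boundary is a Lyapunov surface with outer unit normal `n`:
near each boundary point `Ω` is the set `{ρ < 0}` for a `C¹` function `ρ` with nonzero gradient
there, and `n` is Hölder continuous on the boundary. -/
structure IsLyapunovDomain (Ω : Set (Space N)) (n : Space N → Space N) : Prop where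
  isOpen : IsOpen Ω
  isBounded : Bornology.IsBounded Ω
  exists_defining : ∀ x ∈ frontier Ω, ∃ ρ : Space N → ℝ,
    ContDiffAt ℝ 1 ρ x ∧ gradient ρ x ≠ 0 ∧ n x = ‖gradient ρ x‖⁻¹ • gradient ρ x ∧
      ∀ᶠ y in 𝓝 x, (y ∈ Ω ↔ ρ y < 0)
  holder : ∃ A α : ℝ, 0 < α ∧ α ≤ 1 ∧
    ∀ x ∈ frontier Ω, ∀ y ∈ frontier Ω, ‖n x - n y‖ ≤ A * ‖x - y‖ ^ α

/-- A wave front moving with speed `c` (or a piece of one): the surface `{eqn = 0}` in an open part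
`dom` of space-time, `eqn` being `C¹`. It is a characteristic surface: its space-time normal
`(ν, ν_t) = (∇ eqn, ∂ eqn/∂t)` satisfies `ν_t < 0` and `c = - ν_t / ‖ν‖`. -/
structure WaveFront (N : ℕ) (c : ℝ) where
  dom : Set (SpaceTime N)
  isOpen_dom : IsOpen dom
  eqn : SpaceTime N → ℝ
  contDiffOn_eqn : ContDiffOn ℝ 1 eqn dom
  timeDeriv_neg : ∀ z ∈ dom, eqn z = 0 → timeDeriv eqn z < 0
  characteristic : ∀ z ∈ dom, eqn z = 0 → timeDeriv eqn z = - c * ‖gradX eqn z‖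

namespace WaveFront

variable {c : ℝ}

/-- The points of the front. -/
def carrier (F : WaveFront N c) : Set (SpaceTime N) := {z | z ∈ F.dom ∧ F.eqn z = 0}

/-- The side of the front towards which it spreads. -/
def ahead (F : WaveFront N c) : Set (SpaceTime N) := {z | z ∈ F.dom ∧ 0 < F.eqn z}

/-- The side of the front from which it comes. -/
def behind (F : WaveFront N c) : Set (SpaceTime N) := {z | z ∈ F.dom ∧ F.eqn z < 0}

/-- The unit normal in `ℝ^N` to the moving front, directed towards its spreading. -/
def normal (F : WaveFront N c) (z : SpaceTime N) : Space N :=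
  ‖gradX F.eqn z‖⁻¹ • gradX F.eqn z

end WaveFront

/-- The points of the open half-cylinder `Ω × (0, ∞)` that lie neither on one of the fronts nor in
the exceptional set `Z`. -/
def regularPoints {ι : Type*} {c : ℝ} (Ω : Set (Space N)) (F : ι → WaveFront N c)
    (Z : Set (SpaceTime N)) : Set (SpaceTime N) :=
  {z | z.1 ∈ Ω ∧ 0 < z.2 ∧ z ∉ Z ∧ ∀ k, z ∉ (F k).carrier}

/-- The jump condition `[∂u/∂t + c nᵢ ∂u/∂xᵢ] = 0` at a point `z` of the front `F`. The first
derivatives of `u` have one-sided limits at `z`, taken through the set `R` where they exist. -/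
def HadamardCondition {c : ℝ} (u : SpaceTime N → ℝ) (R : Set (SpaceTime N))
    (F : WaveFront N c) (z : SpaceTime N) : Prop :=
  ∃ (aPlus aMinus : ℝ) (gPlus gMinus : Space N),
    Tendsto (timeDeriv u) (𝓝[F.ahead ∩ R] z) (𝓝 aPlus) ∧
    Tendsto (timeDeriv u) (𝓝[F.behind ∩ R] z) (𝓝 aMinus) ∧
    Tendsto (gradX u) (𝓝[F.ahead ∩ R] z) (𝓝 gPlus) ∧
    Tendsto (gradX u) (𝓝[F.behind ∩ R] z) (𝓝 gMinus) ∧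
    (aPlus + c * ⟪F.normal z, gPlus⟫) - (aMinus + c * ⟪F.normal z, gMinus⟫) = 0

/-- `u` is a classical solution of the initial boundary value problem for
`Δ u - c⁻² ∂²u/∂t² = G` in `Ω × (0, ∞)`, with initial data `u₀`, `v₀` (value and velocity) and
boundary data `uS` (value) and `p` (normal derivative), possibly with shock waves.

`F` is the family of wave fronts; the fronts may end, focus, intersect and reach the boundary in
points of the exceptional set `Z`, which is closed and negligible for the `N`-dimensional measure
(surfaces in space-time are `N`-dimensional). Off the fronts and off `Z` the solution is `C²`; its
first derivatives are bounded on bounded time intervals; `u` itself is continuous everywhere, so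
that `[u] = 0` on the fronts. -/
structure IsClassicalSolution {ι : Type*} (c : ℝ) (Ω : Set (Space N)) (n : Space N → Space N)
    (F : ι → WaveFront N c) (Z : Set (SpaceTime N)) (G : SpaceTime N → ℝ)
    (u₀ v₀ : Space N → ℝ) (uS p : SpaceTime N → ℝ) (u : SpaceTime N → ℝ) : Prop where
  isClosed_exceptional : IsClosed Z
  exceptional_null : μH[(N : ℝ)] Z = 0
  continuousOn : ContinuousOn u (closure Ω ×ˢ Ici 0)
  contDiffAt : ∀ z ∈ regularPoints Ω F Z, ContDiffAt ℝ 2 u z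
  bounded_deriv : ∀ T : ℝ, ∃ M : ℝ, ∀ z ∈ regularPoints Ω F Z, z.2 ≤ T →
    |timeDeriv u z| ≤ M ∧ ‖gradX u z‖ ≤ M
  wave_eq : ∀ z ∈ regularPoints Ω F Z, waveOp c u z = G z
  hadamard : ∀ k, ∀ z ∈ (F k).carrier, z.1 ∈ Ω → 0 < z.2 → z ∉ Z →
    HadamardCondition u (regularPoints Ω F Z) (F k) z
  initial_value : ∀ x ∈ closure Ω, u (x, 0) = u₀ x
  initial_velocity : ∀ᵐ x ∂(volume.restrict Ω),
    HasDerivWithinAt (fun s : ℝ => u (x, s)) (v₀ x) (Ici 0) 0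
  boundary_value : ∀ x ∈ frontier Ω, ∀ t : ℝ, 0 ≤ t → u (x, t) = uS (x, t)
  boundary_normal : ∀ x ∈ frontier Ω, ∀ t : ℝ, 0 < t → (x, t) ∉ Z →
    Tendsto (fun w => ⟪gradX u w, n x⟫) (𝓝[regularPoints Ω F Z] (x, t)) (𝓝 (p (x, t)))

/-- The surface area measure on the boundary of `Ω`. -/
def surfaceMeasure (Ω : Set (Space N)) : Measure (Space N) :=
  (μHE[N - 1] : Measure (Space N)).restrict (frontier Ω)

end

/-! The identity is the divergence theorem in space-time for the field `V = (u ∇u, -c⁻² u ∂u/∂t)`,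
whose divergence at regular points is `f = u G - 2 L`. The difficulty is that `V` is discontinuous
on countably many fronts, which may accumulate, that nothing is known on `Z` beyond boundedness of
the derivatives, and that boundary and initial data are attained only as limits. Everything is
therefore phrased through `weakFlux`, the functional `φ ↦ ∫ (Dφ(V) + f φ)` over `Ω × (0, T)`,
evaluated on `C¹` test functions; at first sight it should vanish for `φ` supported inside.

One mechanism handles every hypersurface `ρ = 0`. Replace `φ` by `cutoff (m ρ) φ`, which vanishes
near the surface. If its flux is zero, letting `m → ∞` turns the flux of `φ` into minus the limit of
`∫ φ D(cutoff (m ρ))(V)` (`tendsto_integral_mul_fderiv_cutoff`). Along lines transversal to the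
surface the derivatives of the cutoffs are approximate identities (`integral_mul_deriv_cutoff`), of
mass `-1` when the surface is approached from before and `+1` when it is left. Only one-sided limits
of `V` along almost every line are needed, and dominated convergence is applied to the integrals
over lines.

On a front the Hadamard condition together with `ν_t = -c ‖ν‖` says exactly that the normal
component of `V` has equal limits on both sides (`exists_tendsto_flux`), so the two masses cancel
(`weakFlux_eq_zero_near_front`). Accumulation of fronts is excluded by Baire: among the points near
which the flux does not vanish, one front would be dense in a relatively open piece, and the
one-front argument would apply there (`weakFlux_eq_zero_off_exceptional`). The set `Z` is then
removable, because cutoffs around it have gradients of arbitrarily small `L¹` norm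
(`weakFlux_eq_zero_of_removable`).

At the boundary only the inner side contributes, and the flux becomes an integral over the tangent
plane (`weakFlux_eq_integral_graph`). No area formula is used: in a chart of slope at most `ε`, the
surface measure and the tangent-plane measure differ by a factor at most `(1 + ε) ^ (N - 1)`, and
the resulting error is a small multiple of `∫ |φ|`. Since `∫ |φ|` splits exactly along cutoffs,
local errors add up to a global one of the same size, which tends to zero (`weakFlux_eq_boundary`).

Test functions depending on time alone near `Ω` give the balance between two positive instants
(`balance`). As the earlier instant tends to zero, the balance itself shows that `∫ u ∂u/∂t`
converges. Its limit is identified through time averages, which are integrals of difference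
quotients of `u² / 2` and so see the one-sided initial velocity (`integrableOn_initial`). -/

/-! ### An even cutoff function and the approximate identities it generates -/

/-- A smooth even function on the line with values in `[0, 1]` that vanishes for `|r| ≤ 1` and
equals one for `2 ≤ |r|`. -/
noncomputable def cutoff (r : ℝ) : ℝ := Real.smoothTransition (r ^ 2 - 1)

theorem cutoff_contDiff : ContDiff ℝ 2 cutoff := by
  unfold cutoff
  exact (Real.smoothTransition.contDiff (n := 2)).comp (by fun_prop)

theorem cutoff_differentiable : Differentiable ℝ cutoff :=
  cutoff_contDiff.differentiable (by norm_num)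

theorem continuous_deriv_cutoff : Continuous (deriv cutoff) :=
  cutoff_contDiff.continuous_deriv (by norm_num)

theorem cutoff_nonneg (r : ℝ) : 0 ≤ cutoff r := Real.smoothTransition.nonneg _

theorem cutoff_le_one (r : ℝ) : cutoff r ≤ 1 := Real.smoothTransition.le_one _

theorem cutoff_eq_zero {r : ℝ} (h : |r| ≤ 1) : cutoff r = 0 := by
  apply Real.smoothTransition.zero_of_nonpos
  have := sq_le_one_iff_abs_le_one r |>.2 h
  linarith

theorem cutoff_zero : cutoff 0 = 0 := cutoff_eq_zero (by simp)

theorem cutoff_eq_one {r : ℝ} (h : 2 ≤ |r|) : cutoff r = 1 := by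
  apply Real.smoothTransition.one_of_one_le
  have : 2 ^ 2 ≤ |r| ^ 2 := by gcongr
  rw [sq_abs] at this
  linarith

theorem deriv_cutoff (r : ℝ) :
    deriv cutoff r = deriv Real.smoothTransition (r ^ 2 - 1) * (2 * r) := by
  have h1 : HasDerivAt (fun r : ℝ => r ^ 2 - 1) (2 * r) r := by
    simpa using (hasDerivAt_pow 2 r).sub_const 1
  have h2 : HasDerivAt Real.smoothTransition (deriv Real.smoothTransition (r ^ 2 - 1))
      (r ^ 2 - 1) :=
    ((Real.smoothTransition.contDiff (n := 1)).differentiable (by norm_num) _).hasDerivAt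
  exact (h2.comp r h1).deriv

/-- The cutoff is an increasing function of `r ^ 2`. This sign makes the kernels one-signed, so that
their `L¹` norm is a difference of end values, hence at most one. -/
theorem mul_deriv_cutoff_nonneg (r : ℝ) : 0 ≤ r * deriv cutoff r := by
  rw [deriv_cutoff]
  have := Real.smoothTransition.monotone.deriv_nonneg (x := r ^ 2 - 1)
  have h2 := sq_nonneg r
  nlinarith [mul_nonneg this h2]

theorem deriv_cutoff_eq_zero {r : ℝ} (h : 2 < |r|) : deriv cutoff r = 0 := by
  have : cutoff =ᶠ[𝓝 r] fun _ => 1 := by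
    filter_upwards [(isOpen_lt continuous_const continuous_abs).mem_nhds h] with s hs
    exact cutoff_eq_one (le_of_lt hs)
  rw [this.deriv_eq]
  simp

theorem tendsto_cutoff_nat_mul {r : ℝ} (h : r ≠ 0) :
    Tendsto (fun n : ℕ => cutoff (n * r)) atTop (𝓝 1) := by
  apply tendsto_const_nhds.congr'
  have h1 : Tendsto (fun n : ℕ => (n : ℝ) * |r|) atTop atTop :=
    tendsto_natCast_atTop_atTop.atTop_mul_const (abs_pos.2 h)
  filter_upwards [h1.eventually_ge_atTop 2] with n hn
  rw [cutoff_eq_one]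
  rwa [abs_mul, Nat.abs_cast]

/-- An approximate identity concentrating at `θ` picks out the almost-everywhere limit at `θ`. -/
theorem tendsto_setIntegral_mul_of_concentrating {s : Set ℝ} (hs : MeasurableSet s) {θ L F₀ M : ℝ}
    {F : ℝ → ℝ} {k : ℕ → ℝ → ℝ} (hFm : AEStronglyMeasurable F (volume.restrict s))
    (hFM : ∀ᵐ τ ∂volume.restrict s, |F τ| ≤ M)
    (hF : Tendsto F (𝓝[s] θ ⊓ ae volume) (𝓝 F₀))
    (hk : ∀ n, IntegrableOn (k n) s) (hk1 : ∀ n, ∫ τ in s, |k n τ| ≤ 1)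
    (hkL : Tendsto (fun n => ∫ τ in s, k n τ) atTop (𝓝 L))
    (hk0 : ∀ U ∈ 𝓝 θ, ∀ᶠ n in atTop, ∀ τ ∈ s, τ ∉ U → k n τ = 0) :
    Tendsto (fun n => ∫ τ in s, F τ * k n τ) atTop (𝓝 (F₀ * L)) := by
  have hint : ∀ n, IntegrableOn (fun τ => F τ * k n τ) s := fun n =>
    (hk n).bdd_mul hFm (by simpa using hFM)
  -- With the limit value subtracted, only the bound on the masses `∫ |k n|` is needed.
  have key : Tendsto (fun n => ∫ τ in s, (F τ - F₀) * k n τ) atTop (𝓝 0) := by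
    rw [Metric.tendsto_atTop]
    intro ε hε
    have h1 : ∀ᶠ τ in 𝓝[s] θ ⊓ ae volume, |F τ - F₀| < ε / 2 := by
      have := hF.eventually (Metric.ball_mem_nhds F₀ (half_pos hε))
      simpa [Real.dist_eq] using this
    rw [eventually_inf] at h1
    obtain ⟨A, hA, B, hB, hAB⟩ := h1
    obtain ⟨U, hU, hUA⟩ := mem_nhdsWithin_iff_exists_mem_nhds_inter.1 hA
    obtain ⟨n₀, hn₀⟩ := eventually_atTop.1 (hk0 U hU)
    refine ⟨n₀, fun n hn => ?_⟩
    -- On `U` the factor is small almost everywhere; off `U` the kernel is zero.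
    have hb : ∀ᵐ τ ∂volume.restrict s, ‖(F τ - F₀) * k n τ‖ ≤ ε / 2 * |k n τ| := by
      filter_upwards [ae_restrict_mem hs, ae_restrict_of_ae (s := s) hB] with τ hτ hτB
      by_cases hτU : τ ∈ U
      · have := hAB τ ⟨hUA ⟨hτU, hτ⟩, hτB⟩
        rw [norm_mul, Real.norm_eq_abs, Real.norm_eq_abs]
        gcongr
      · simp [hn₀ n hn τ hτ hτU]
    rw [dist_zero_right]
    calc ‖∫ τ in s, (F τ - F₀) * k n τ‖ ≤ ∫ τ in s, ε / 2 * |k n τ| :=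
          norm_integral_le_of_norm_le ((hk n).abs.const_mul _) hb
      _ = ε / 2 * ∫ τ in s, |k n τ| := integral_const_mul _ _
      _ ≤ ε / 2 * 1 := by gcongr; exact hk1 n
      _ < ε := by linarith
  have := key.add (hkL.const_mul F₀)
  rw [zero_add] at this
  refine this.congr fun n => ?_
  rw [← integral_const_mul, ← integral_add]
  · congr 1; ext τ; ring
  · simp_rw [sub_mul]
    exact (hint n).sub ((hk n).const_mul F₀)
  · exact (hk n).const_mul F₀

/-- The derivatives of the cutoffs `cutoff (n r)` on an interval having the only zero of `r` as an
end point form an approximate identity, of mass `L = ± 1`. -/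
theorem integral_deriv_cutoff_comp {α β θ L : ℝ} (hαβ : α < β) {r r' : ℝ → ℝ}
    (hr : ∀ τ ∈ Icc α β, HasDerivAt r (r' τ) τ) (hr' : ContinuousOn r' (Icc α β))
    (hθ : θ = α ∧ L = 1 ∨ θ = β ∧ L = -1) (h0 : r θ = 0)
    (hne : ∀ τ ∈ Icc α β, τ ≠ θ → r τ ≠ 0)
    (hsign : (∀ τ ∈ Icc α β, 0 ≤ r τ * r' τ) ∨ (∀ τ ∈ Icc α β, r τ * r' τ ≤ 0)) :
    (∀ n : ℕ, IntegrableOn (fun τ => deriv cutoff (n * r τ) * (n * r' τ)) (Ioo α β)) ∧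
    (∀ n : ℕ, ∫ τ in Ioo α β, |deriv cutoff (n * r τ) * (n * r' τ)| ≤ 1) ∧
    Tendsto (fun n : ℕ => ∫ τ in Ioo α β, deriv cutoff (n * r τ) * (n * r' τ)) atTop (𝓝 L) ∧
    (∀ U ∈ 𝓝 θ, ∀ᶠ n : ℕ in atTop, ∀ τ ∈ Ioo α β, τ ∉ U →
      deriv cutoff (n * r τ) * (n * r' τ) = 0) := by
  have hrc : ContinuousOn r (Icc α β) := fun τ hτ => (hr τ hτ).continuousAt.continuousWithinAt
  have hkc : ∀ n : ℕ, ContinuousOn (fun τ => deriv cutoff (n * r τ) * (n * r' τ)) (Icc α β) :=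
    fun n => (continuous_deriv_cutoff.comp_continuousOn (continuousOn_const.mul hrc)).mul
      (continuousOn_const.mul hr')
  have hI : ∀ n : ℕ, IntegrableOn (fun τ => deriv cutoff (n * r τ) * (n * r' τ)) (Ioo α β) :=
    fun n => (hkc n).integrableOn_Icc.mono_set Ioo_subset_Icc_self
  -- The kernel is the derivative of `cutoff (n * r τ)`.
  have hFTC : ∀ n : ℕ, ∫ τ in Ioo α β, deriv cutoff (n * r τ) * (n * r' τ)
      = cutoff (n * r β) - cutoff (n * r α) := by
    intro n
    rw [← integral_Ioc_eq_integral_Ioo, ← intervalIntegral.integral_of_le hαβ.le]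
    refine intervalIntegral.integral_eq_sub_of_hasDerivAt (f := fun τ => cutoff (n * r τ)) ?_ ?_
    · intro τ hτ
      rw [uIcc_of_le hαβ.le] at hτ
      exact (cutoff_differentiable _).hasDerivAt.comp τ ((hr τ hτ).const_mul (n : ℝ))
    · apply ContinuousOn.intervalIntegrable
      rw [uIcc_of_le hαβ.le]
      exact hkc n
  -- The kernel has the sign of `r r'`: multiply by `(n x) ^ 2` and use `mul_deriv_cutoff_nonneg`;
  -- the derivative vanishes when `n x = 0`.
  have hsq : ∀ (n : ℕ) (x y : ℝ), 0 ≤ x * y → 0 ≤ deriv cutoff (n * x) * (n * y) := by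
    intro n x y hxy
    rcases eq_or_ne ((n : ℝ) * x) 0 with h | h
    · rw [h, deriv_cutoff]; simp
    · have h1 := mul_deriv_cutoff_nonneg (n * x)
      have h2 : 0 ≤ (n * x) * (n * y) := by
        have : (n * x) * (n * y) = (n : ℝ) ^ 2 * (x * y) := by ring
        rw [this]; positivity
      have h3 : 0 < (n * x) ^ 2 := by positivity
      by_contra! hcon
      nlinarith [mul_nonneg h1 h2]
  refine ⟨hI, fun n => ?_, ?_, ?_⟩
  · rcases hsign with hs | hs
    · rw [setIntegral_congr_fun (g := fun τ => deriv cutoff (n * r τ) * (n * r' τ))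
        measurableSet_Ioo, hFTC]
      · linarith [cutoff_nonneg (n * r α), cutoff_le_one (n * r β)]
      · intro τ hτ
        exact abs_of_nonneg (hsq n _ _ (hs τ (Ioo_subset_Icc_self hτ)))
    · rw [setIntegral_congr_fun (g := fun τ => -(deriv cutoff (n * r τ) * (n * r' τ)))
        measurableSet_Ioo, integral_neg, hFTC]
      · linarith [cutoff_nonneg (n * r β), cutoff_le_one (n * r α)]
      · intro τ hτ
        have := hsq n (r τ) (-r' τ) (by linarith [hs τ (Ioo_subset_Icc_self hτ)])
        refine abs_of_nonpos ?_
        linarith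
  · simp_rw [hFTC]
    rcases hθ with ⟨rfl, rfl⟩ | ⟨rfl, rfl⟩
    · simpa [h0, cutoff_zero] using tendsto_cutoff_nat_mul (hne β (by simp [hαβ.le]) hαβ.ne')
    · simpa [h0, cutoff_zero] using
        (tendsto_cutoff_nat_mul (hne α (by simp [hαβ.le]) hαβ.ne)).neg
  · intro U hU
    have hK : IsCompact (Icc α β \ interior U) := isCompact_Icc.diff isOpen_interior
    -- Away from its zero `|r|` is bounded below by compactness, so eventually `|n r| > 2`, where
    -- the cutoff is constant.
    obtain ⟨δ, hδ, hδr⟩ : ∃ δ > 0, ∀ τ ∈ Icc α β \ interior U, δ ≤ |r τ| := by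
      rcases (Icc α β \ interior U).eq_empty_or_nonempty with he | he
      · exact ⟨1, one_pos, by simp [he]⟩
      · obtain ⟨τ₀, hτ₀, hmin⟩ := hK.exists_isMinOn he (hrc.abs.mono sdiff_subset)
        refine ⟨|r τ₀|, abs_pos.2 (hne τ₀ hτ₀.1 ?_), fun τ hτ => hmin hτ⟩
        rintro rfl
        exact hτ₀.2 (mem_interior_iff_mem_nhds.2 hU)
    have h1 : Tendsto (fun n : ℕ => (n : ℝ) * δ) atTop atTop :=
      tendsto_natCast_atTop_atTop.atTop_mul_const hδ
    filter_upwards [h1.eventually_gt_atTop 2] with n hn τ hτ hτU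
    rw [deriv_cutoff_eq_zero, zero_mul]
    rw [abs_mul, Nat.abs_cast]
    refine hn.trans_le ?_
    gcongr
    exact hδr τ ⟨Ioo_subset_Icc_self hτ, fun h => hτU (interior_subset h)⟩

/-- Integration against the derivatives of the cutoffs `cutoff (n r)` over an interval having the
only zero of `r` as an end point: uniform bound and limit. -/
theorem integral_mul_deriv_cutoff {α β θ L : ℝ} (hαβ : α < β) {r r' : ℝ → ℝ}
    (hr : ∀ τ ∈ Icc α β, HasDerivAt r (r' τ) τ) (hr' : ContinuousOn r' (Icc α β))
    (hθ : θ = α ∧ L = 1 ∨ θ = β ∧ L = -1) (h0 : r θ = 0)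
    (hne : ∀ τ ∈ Icc α β, τ ≠ θ → r τ ≠ 0)
    (hsign : (∀ τ ∈ Icc α β, 0 ≤ r τ * r' τ) ∨ (∀ τ ∈ Icc α β, r τ * r' τ ≤ 0))
    {F : ℝ → ℝ} {F₀ M : ℝ} (hM : 0 ≤ M)
    (hFm : AEStronglyMeasurable F (volume.restrict (Ioo α β)))
    (hFM : ∀ᵐ τ ∂volume.restrict (Ioo α β), |F τ| ≤ M)
    (hF : Tendsto F (𝓝[Ioo α β] θ ⊓ ae volume) (𝓝 F₀)) :
    (∀ n : ℕ, IntegrableOn (fun τ => F τ * (deriv cutoff (n * r τ) * (n * r' τ))) (Ioo α β)) ∧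
    (∀ n : ℕ, |∫ τ in Ioo α β, F τ * (deriv cutoff (n * r τ) * (n * r' τ))| ≤ M) ∧
    Tendsto (fun n : ℕ => ∫ τ in Ioo α β, F τ * (deriv cutoff (n * r τ) * (n * r' τ))) atTop
      (𝓝 (F₀ * L)) := by
  obtain ⟨h1, h2, h3, h4⟩ := integral_deriv_cutoff_comp hαβ hr hr' hθ h0 hne hsign
  refine ⟨fun n => (h1 n).bdd_mul hFm (by simpa using hFM), fun n => ?_,
    tendsto_setIntegral_mul_of_concentrating measurableSet_Ioo hFm hFM hF h1 h2 h3 h4⟩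
  calc |∫ τ in Ioo α β, F τ * (deriv cutoff (n * r τ) * (n * r' τ))|
      ≤ ∫ τ in Ioo α β, M * |deriv cutoff (n * r τ) * (n * r' τ)| := by
        rw [← Real.norm_eq_abs]
        refine norm_integral_le_of_norm_le ((h1 n).abs.const_mul _) ?_
        filter_upwards [hFM] with τ hτ
        rw [norm_mul, Real.norm_eq_abs, Real.norm_eq_abs]
        gcongr
    _ = M * ∫ τ in Ioo α β, |deriv cutoff (n * r τ) * (n * r' τ)| := integral_const_mul _ _
    _ ≤ M * 1 := by gcongr; exact h2 n
    _ = M := mul_one M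

/-- Dominated convergence for iterated integrals, with control of the inner integrals only. -/
theorem tendsto_integral_prod_of_fiberwise {Y Z : Type*} [MeasurableSpace Y] [MeasurableSpace Z]
    {ν : Measure Y} {μ : Measure Z} [SFinite ν] [SFinite μ] {h : ℕ → Y × Z → ℝ} {g bound : Y → ℝ}
    (hi : ∀ n, Integrable (h n) (ν.prod μ)) (hb : Integrable bound ν)
    (hle : ∀ n, ∀ᵐ y ∂ν, |∫ τ, h n (y, τ) ∂μ| ≤ bound y)
    (hlim : ∀ᵐ y ∂ν, Tendsto (fun n => ∫ τ, h n (y, τ) ∂μ) atTop (𝓝 (g y))) :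
    Tendsto (fun n => ∫ z, h n z ∂(ν.prod μ)) atTop (𝓝 (∫ y, g y ∂ν)) := by
  simp_rw [fun n => integral_prod (h n) (hi n)]
  exact tendsto_integral_of_dominated_convergence bound
    (fun n => (hi n).integral_prod_left.aestronglyMeasurable) hb hle hlim

/-! ### Test functions and localisation -/

section TestFunctions

variable {E : Type*} [NormedAddCommGroup E] [NormedSpace ℝ E]

/-- `C¹` functions with compact support in `U`. -/
structure IsTest (U : Set E) (φ : E → ℝ) : Prop where
  contDiff : ContDiff ℝ 1 φ
  hasCompactSupport : HasCompactSupport φ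
  tsupport_subset : tsupport φ ⊆ U

namespace IsTest

variable {U W : Set E} {φ ψ : E → ℝ}

theorem mono (h : IsTest U φ) (hUW : U ⊆ W) : IsTest W φ :=
  ⟨h.1, h.2, h.3.trans hUW⟩

theorem add (h : IsTest U φ) (h' : IsTest U ψ) : IsTest U (φ + ψ) :=
  ⟨h.1.add h'.1, h.2.add h'.2,
    (closure_mono (Function.support_add φ ψ)).trans <| by
      rw [closure_union]; exact union_subset h.3 h'.3⟩

theorem mul_left (h : IsTest U φ) (hψ : ContDiff ℝ 1 ψ) : IsTest U (ψ * φ) :=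
  ⟨hψ.mul h.1, h.2.mul_left, (tsupport_mul_subset_right).trans h.3⟩

theorem zero : IsTest U (0 : E → ℝ) :=
  ⟨contDiff_const, .zero, by simp [tsupport]⟩

theorem differentiable (h : IsTest U φ) : Differentiable ℝ φ := h.1.differentiable (by norm_num)

theorem continuous_fderiv (h : IsTest U φ) : Continuous (fderiv ℝ φ) :=
  h.1.continuous_fderiv (by norm_num)

theorem exists_bound (h : IsTest U φ) : ∃ C : ℝ, 0 ≤ C ∧ ∀ z, |φ z| ≤ C ∧ ‖fderiv ℝ φ z‖ ≤ C := by
  obtain ⟨C₁, h₁⟩ := h.1.continuous.bounded_above_of_compact_support h.2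
  obtain ⟨C₂, h₂⟩ := h.continuous_fderiv.bounded_above_of_compact_support (h.2.fderiv ℝ)
  exact ⟨max C₁ C₂, (norm_nonneg _).trans ((h₁ 0).trans (le_max_left _ _)), fun z =>
    ⟨(h₁ z).trans (le_max_left _ _), (h₂ z).trans (le_max_right _ _)⟩⟩

/-- The product of a test function with a function that is `C¹` near its support. -/
theorem mul_of_contDiffAt (h : IsTest U φ) (hψ : ∀ z ∈ tsupport φ, ContDiffAt ℝ 1 ψ z) :
    IsTest U (ψ * φ) := by
  refine ⟨contDiff_iff_contDiffAt.2 fun z => ?_, h.2.mul_left, (tsupport_mul_subset_right).trans h.3⟩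
  by_cases hz : z ∈ tsupport φ
  · exact (hψ z hz).mul h.1.contDiffAt
  · have : ψ * φ =ᶠ[𝓝 z] fun _ => 0 := by
      filter_upwards [(isClosed_tsupport φ).isOpen_compl.mem_nhds hz] with w hw
      simp [image_eq_zero_of_notMem_tsupport hw]
    exact contDiffAt_const.congr_of_eventuallyEq this

end IsTest

theorem exists_bump [FiniteDimensional ℝ E] {W : Set E} {z : E} (hW : W ∈ 𝓝 z) :
    ∃ ψ : E → ℝ, ContDiff ℝ 1 ψ ∧ tsupport ψ ⊆ W ∧ (∀ w, ψ w ∈ Icc (0 : ℝ) 1) ∧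
      ∀ᶠ w in 𝓝 z, ψ w = 1 := by
  obtain ⟨r, hr, hrW⟩ := Metric.nhds_basis_closedBall.mem_iff.1 hW
  let b : ContDiffBump z := ⟨r / 2, r, half_pos hr, half_lt_self hr⟩
  exact ⟨b, b.contDiff, by rw [b.tsupport_eq]; exact hrW, fun w => ⟨b.nonneg, b.le_one⟩,
    b.eventuallyEq_one⟩

/-- A functional on test functions that is locally dominated by a functional splitting along
cutoffs is globally dominated by it. -/
theorem abs_le_of_locally [FiniteDimensional ℝ E] {U : Set E} {Λ B : (E → ℝ) → ℝ}
    (hΛ : ∀ φ ψ, IsTest U φ → IsTest U ψ → Λ (φ + ψ) = Λ φ + Λ ψ)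
    (hB : ∀ φ ψ, IsTest U φ → ContDiff ℝ 1 ψ → (∀ z, ψ z ∈ Icc (0 : ℝ) 1) →
      B φ = B (ψ * φ) + B ((1 - ψ) * φ))
    (hloc : ∀ z ∈ U, ∃ W ∈ 𝓝 z, ∀ φ, IsTest U φ → tsupport φ ⊆ W → |Λ φ| ≤ B φ)
    {φ : E → ℝ} (hφ : IsTest U φ) : |Λ φ| ≤ B φ := by
  have hΛ0 : Λ 0 = 0 := by
    have := hΛ 0 0 IsTest.zero IsTest.zero
    simpa using this
  have hB0 : B 0 = 0 := by
    have := hB 0 0 IsTest.zero contDiff_const (by simp)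
    simpa using this
  choose! W hW hWloc using hloc
  choose! ψ hψd hψs hψ01 hψ1 using fun z (hz : z ∈ U) => exists_bump (hW z hz)
  -- Induction on the number of bumps whose unit level sets cover the points where `φ ≠ 0`. The
  -- piece `ψ z * φ` lies in one good neighbourhood, and `(1 - ψ z) * φ` is covered by the remaining
  -- bumps.
  have hind : ∀ s : Finset E, (∀ z ∈ s, z ∈ U) → ∀ φ, IsTest U φ →
      (∀ w, φ w ≠ 0 → ∃ z ∈ s, ψ z w = 1) → |Λ φ| ≤ B φ := by
    classical
    intro s
    induction s using Finset.induction_on with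
    | empty =>
      intro _ φ hφ h
      have : φ = 0 := by
        ext w
        by_contra hw
        simpa using h w hw
      simp [this, hΛ0, hB0]
    | insert z s hzs ih =>
      intro hs φ hφ h
      have hz : z ∈ U := hs z (by simp)
      have h1 : IsTest U (ψ z * φ) := hφ.mul_left (hψd z hz)
      have h2 : IsTest U ((1 - ψ z) * φ) := hφ.mul_left (contDiff_const.sub (hψd z hz))
      have e : φ = ψ z * φ + (1 - ψ z) * φ := by ring
      have hle2 := ih (fun w hw => hs w (by simp [hw])) _ h2 (fun w hw => by
        have hw' : (1 - ψ z w) * φ w ≠ 0 := hw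
        obtain ⟨z', hz', hz'1⟩ := h w (right_ne_zero_of_mul hw')
        rcases Finset.mem_insert.1 hz' with rfl | h'
        · exact absurd (by rw [hz'1]; simp) hw'
        · exact ⟨z', h', hz'1⟩)
      have hle1 := hWloc z hz _ h1 ((tsupport_mul_subset_left).trans (hψs z hz))
      rw [hB φ (ψ z) hφ (hψd z hz) (hψ01 z hz)]
      calc |Λ φ| = |Λ (ψ z * φ) + Λ ((1 - ψ z) * φ)| := by rw [← hΛ _ _ h1 h2, ← e]
        _ ≤ _ := (abs_add_le _ _).trans (add_le_add hle1 hle2)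
  obtain ⟨s, hsK, hs⟩ := hφ.2.isCompact.elim_nhds_subcover (fun z => {w | ψ z w = 1})
    (fun z hz => hψ1 z (hφ.3 hz))
  refine hind s (fun z hz => hφ.3 (hsK z hz)) φ hφ fun w hw => ?_
  simpa using hs (subset_tsupport φ hw)

/-- A functional on test functions that vanishes locally vanishes. -/
theorem eq_zero_of_locally [FiniteDimensional ℝ E] {U : Set E} {Λ : (E → ℝ) → ℝ}
    (hΛ : ∀ φ ψ, IsTest U φ → IsTest U ψ → Λ (φ + ψ) = Λ φ + Λ ψ)
    (hloc : ∀ z ∈ U, ∃ W ∈ 𝓝 z, ∀ φ, IsTest U φ → tsupport φ ⊆ W → Λ φ = 0)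
    {φ : E → ℝ} (hφ : IsTest U φ) : Λ φ = 0 := by
  refine abs_nonpos_iff.1 (abs_le_of_locally (B := fun _ => 0) hΛ (by simp) ?_ hφ)
  intro z hz
  obtain ⟨W, hW, h⟩ := hloc z hz
  exact ⟨W, hW, fun φ hφ hφW => by simp [h φ hφ hφW]⟩

end TestFunctions

/-! ### Bounded vector fields with integrable divergence -/

section WeakFlux

variable {E : Type*} [NormedAddCommGroup E] [NormedSpace ℝ E] [MeasurableSpace E]

/-- The flux functional `φ ↦ ∫ (Dφ(V) + f φ) dμ` of a vector field `V` with divergence `f`. -/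
noncomputable def weakFlux (μ : Measure E) (V : E → E) (f : E → ℝ) (φ : E → ℝ) : ℝ :=
  ∫ z, (fderiv ℝ φ z (V z) + f z * φ z) ∂μ

/-- The standing assumptions on a vector field `V` bounded by `M` with divergence `f`. -/
structure IsBoundedField (μ : Measure E) (V : E → E) (f : E → ℝ) (M : ℝ) : Prop where
  finite : IsFiniteMeasure μ
  measurable : AEStronglyMeasurable V μ
  bound : ∀ᵐ z ∂μ, ‖V z‖ ≤ M
  nonneg : 0 ≤ M
  integrable : Integrable f μ

variable {μ : Measure E} {V : E → E} {f : E → ℝ} {M : ℝ} {U : Set E} {φ ψ : E → ℝ}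

theorem IsBoundedField.integrable_clm [FiniteDimensional ℝ E] (h : IsBoundedField μ V f M)
    {A : E → E →L[ℝ] ℝ} (hA : AEStronglyMeasurable A μ) {C : ℝ} (hC : ∀ᵐ z ∂μ, ‖A z‖ ≤ C) :
    Integrable (fun z => A z (V z)) μ := by
  have := h.finite
  refine Integrable.of_bound (C := C * M) ?_ ?_
  · exact (continuous_fst.clm_apply continuous_snd).comp_aestronglyMeasurable
      (hA.prodMk h.measurable)
  · filter_upwards [hC, h.bound] with z h1 h2
    exact ((A z).le_opNorm _).trans (by gcongr; exact (norm_nonneg _).trans h1)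

variable [BorelSpace E]

theorem IsBoundedField.integrable_fderiv [FiniteDimensional ℝ E] (h : IsBoundedField μ V f M)
    (hφ : IsTest U φ) : Integrable (fun z => fderiv ℝ φ z (V z)) μ := by
  obtain ⟨C, -, hC⟩ := hφ.exists_bound
  exact h.integrable_clm hφ.continuous_fderiv.aestronglyMeasurable
    (ae_of_all _ fun z => (hC z).2)

theorem IsBoundedField.integrable_mul [FiniteDimensional ℝ E] (h : IsBoundedField μ V f M)
    (hφ : IsTest U φ) : Integrable (fun z => f z * φ z) μ := by
  obtain ⟨C, -, hC⟩ := hφ.exists_bound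
  exact h.integrable.mul_bdd hφ.1.continuous.aestronglyMeasurable
    (ae_of_all _ fun z => (hC z).1)

theorem weakFlux_add [FiniteDimensional ℝ E] (h : IsBoundedField μ V f M) (hφ : IsTest U φ)
    (hψ : IsTest U ψ) : weakFlux μ V f (φ + ψ) = weakFlux μ V f φ + weakFlux μ V f ψ := by
  unfold weakFlux
  refine Eq.trans ?_ (integral_add ((h.integrable_fderiv hφ).add (h.integrable_mul hφ))
    ((h.integrable_fderiv hψ).add (h.integrable_mul hψ)))
  congr 1
  ext z
  simp only [Pi.add_apply]
  rw [fderiv_add (hφ.differentiable z) (hψ.differentiable z)]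
  simp only [add_apply]
  ring

/-- Splitting of the flux of a product. -/
theorem weakFlux_mul [FiniteDimensional ℝ E] (h : IsBoundedField μ V f M) (hφ : IsTest U φ)
    {χ : E → ℝ} (hχ : ∀ z ∈ tsupport φ, ContDiffAt ℝ 1 χ z) :
    Integrable (fun z => φ z * fderiv ℝ χ z (V z)) μ ∧
    Integrable (fun z => χ z * (fderiv ℝ φ z (V z) + f z * φ z)) μ ∧
    weakFlux μ V f (χ * φ) = (∫ z, φ z * fderiv ℝ χ z (V z) ∂μ) +
      ∫ z, χ z * (fderiv ℝ φ z (V z) + f z * φ z) ∂μ := by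
  have hφ' := hφ.mul_of_contDiffAt hχ
  have hd : ∀ z, fderiv ℝ (χ * φ) z (V z)
      = φ z * fderiv ℝ χ z (V z) + χ z * fderiv ℝ φ z (V z) := by
    intro z
    by_cases hz : z ∈ tsupport φ
    · rw [fderiv_mul ((hχ z hz).differentiableAt (by norm_num)) (hφ.differentiable z)]
      simp only [add_apply, smul_apply, smul_eq_mul]
      ring
    · have h0 : fderiv ℝ φ z = 0 :=
        image_eq_zero_of_notMem_tsupport fun h => hz (tsupport_fderiv_subset ℝ h)
      have h1 : fderiv ℝ (χ * φ) z = 0 := image_eq_zero_of_notMem_tsupport fun h =>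
        hz (tsupport_mul_subset_right (tsupport_fderiv_subset ℝ h))
      simp [h0, h1, image_eq_zero_of_notMem_tsupport hz]
  -- Nothing is known about `χ` away from `tsupport φ`, so multiplication by it is controlled on
  -- that compact set only.
  have hcut : ∀ {G : E → ℝ}, (∀ z, z ∉ tsupport φ → G z = 0) → Integrable G μ →
      Integrable (fun z => χ z * G z) μ := by
    intro G hG hGi
    have hc : ContinuousOn χ (tsupport φ) :=
      fun z hz => (hχ z hz).continuousAt.continuousWithinAt
    refine (integrableOn_iff_integrable_of_support_subset (s := tsupport φ) fun z hz => ?_).1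
      (hGi.integrableOn.continuousOn_mul hc hφ.2.isCompact)
    by_contra hz'
    exact hz (by simp [hG z hz'])
  have hz0 : ∀ z, z ∉ tsupport φ → fderiv ℝ φ z (V z) = 0 := fun z hz => by
    rw [image_eq_zero_of_notMem_tsupport (f := fderiv ℝ φ)
      fun h => hz (tsupport_fderiv_subset ℝ h)]
    rfl
  have hi2 : Integrable (fun z => χ z * (fderiv ℝ φ z (V z) + f z * φ z)) μ :=
    hcut (fun z hz => by simp [hz0 z hz, image_eq_zero_of_notMem_tsupport hz])
      ((h.integrable_fderiv hφ).add (h.integrable_mul hφ))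
  -- By the product rule this integrand is a difference of two functions already known to be
  -- integrable.
  have hi1 : Integrable (fun z => φ z * fderiv ℝ χ z (V z)) μ := by
    refine ((h.integrable_fderiv hφ').sub (hcut hz0 (h.integrable_fderiv hφ))).congr
      (ae_of_all _ fun z => ?_)
    simp only [Pi.sub_apply]
    rw [hd z]
    ring
  refine ⟨hi1, hi2, ?_⟩
  rw [← integral_add hi1 hi2]
  unfold weakFlux
  congr 1
  ext z
  rw [hd z]
  simp only [Pi.mul_apply]
  ring

/-- If the flux functional vanishes on the functions `χ n * φ`, where the cutoffs `χ n` tend to one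
almost everywhere, then its value at `φ` is the limit of the fluxes through the cutoffs. -/
theorem tendsto_integral_mul_fderiv_cutoff [FiniteDimensional ℝ E] (h : IsBoundedField μ V f M)
    (hφ : IsTest U φ) {χ : ℕ → E → ℝ} (hχ : ∀ n, ∀ z ∈ tsupport φ, ContDiffAt ℝ 1 (χ n) z)
    (h01 : ∀ n z, |χ n z| ≤ 1)
    (hlim : ∀ᵐ z ∂μ, z ∈ tsupport φ → Tendsto (fun n => χ n z) atTop (𝓝 1))
    (h0 : ∀ n, weakFlux μ V f (χ n * φ) = 0) :
    Tendsto (fun n => ∫ z, φ z * fderiv ℝ (χ n) z (V z) ∂μ) atTop (𝓝 (-weakFlux μ V f φ)) := by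
  have hI := (h.integrable_fderiv hφ).add (h.integrable_mul hφ)
  -- The zero flux of `χ n * φ` splits into the term with the gradient of the cutoff and this one,
  -- which tends to the flux of `φ`.
  have key : Tendsto (fun n => ∫ z, χ n z * (fderiv ℝ φ z (V z) + f z * φ z) ∂μ) atTop
      (𝓝 (weakFlux μ V f φ)) := by
    refine tendsto_integral_of_dominated_convergence
      (fun z => |fderiv ℝ φ z (V z) + f z * φ z|)
      (fun n => (weakFlux_mul h hφ (hχ n)).2.1.aestronglyMeasurable) hI.abs
      (fun n => ae_of_all _ fun z => ?_) ?_
    · rw [norm_mul, Real.norm_eq_abs, Real.norm_eq_abs]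
      exact mul_le_of_le_one_left (abs_nonneg _) (h01 n z)
    · filter_upwards [hlim] with z hz
      by_cases hzs : z ∈ tsupport φ
      · simpa using (hz hzs).mul_const (fderiv ℝ φ z (V z) + f z * φ z)
      · have h1 : fderiv ℝ φ z = 0 :=
          image_eq_zero_of_notMem_tsupport fun h => hzs (tsupport_fderiv_subset ℝ h)
        simp [h1, image_eq_zero_of_notMem_tsupport hzs]
  refine key.neg.congr fun n => ?_
  have := (weakFlux_mul h hφ (hχ n)).2.2
  rw [h0 n] at this
  linarith

end WeakFlux

/-! ### Removable sets of codimension one measure zero -/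

section Removable

/-- A compact set of Hausdorff measure zero has finite covers by small balls, centred at its points,
with a small sum of the powers of the radii. -/
theorem exists_finset_ball_cover {X : Type*} [MetricSpace X] [MeasurableSpace X] [BorelSpace X]
    {d : ℕ} {K : Set X} (hK : IsCompact K) (hne : K.Nonempty) (h0 : μH[(d : ℝ)] K = 0) {ε : ℝ} (hε : 0 < ε) :
    ∃ s : Finset (X × ℝ), (∀ b ∈ s, b.1 ∈ K ∧ 0 < b.2 ∧ b.2 ≤ ε) ∧
      (K ⊆ ⋃ b ∈ s, Metric.ball b.1 b.2) ∧ ∑ b ∈ s, b.2 ^ d ≤ ε := by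
  classical
  rw [Measure.hausdorffMeasure_apply] at h0
  -- The Hausdorff measure is a supremum over scales, so the infimum over covers is already zero at
  -- the scale `ε / 2`.
  have h1 := iSup₂_eq_bot.1 (h0.trans bot_eq_zero'.symm) (ENNReal.ofReal (ε / 2)) (by simpa using hε)
  have h2 : (⨅ (t : ℕ → Set X) (_ : K ⊆ ⋃ n, t n)
      (_ : ∀ n, Metric.ediam (t n) ≤ ENNReal.ofReal (ε / 2)),
      ∑' n, ⨆ _ : (t n).Nonempty, Metric.ediam (t n) ^ (d : ℝ)) < ENNReal.ofReal (ε / 2) := by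
    rw [h1]; simpa using hε
  simp only [iInf_lt_iff] at h2
  obtain ⟨t, htK, htd, hts⟩ := h2
  -- Radii must exceed the diameters strictly, as open balls are wanted and diameters may be zero.
  -- The summable `δ` pays for the enlargement.
  obtain ⟨δ, hδ, hδs⟩ : ∃ δ : ℕ → ℝ, (∀ n, 0 < δ n) ∧ ∃ c, HasSum δ c ∧ c ≤ ε / 2 :=
    ⟨fun n => ε / 2 / 2 / 2 ^ n, fun n => by positivity, ε / 2, hasSum_geometric_two' (ε / 2), le_rfl⟩
  have hr : ∀ n, ∃ r : ℝ, (Metric.ediam (t n)).toReal < r ∧ r ≤ ε ∧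
      r ^ d < (Metric.ediam (t n)).toReal ^ d + δ n := by
    intro n
    set D := (Metric.ediam (t n)).toReal
    have hD : D ≤ ε / 2 := ENNReal.toReal_le_of_le_ofReal (by positivity) (htd n)
    have hc : ∀ᶠ r in 𝓝 D, r ^ d < D ^ d + δ n :=
      (continuous_pow d).continuousAt.eventually_lt continuousAt_const (by linarith [hδ n])
    have hc2 : ∀ᶠ r in 𝓝[>] D, D < r ∧ r ≤ ε ∧ r ^ d < D ^ d + δ n := by
      filter_upwards [self_mem_nhdsWithin, nhdsWithin_le_nhds hc,
        nhdsWithin_le_nhds (Iic_mem_nhds (show D < ε by linarith))] with r h1 h2 h3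
      exact ⟨h1, h3, h2⟩
    exact hc2.exists
  choose r hr1 hr2 hr3 using hr
  have hr0 : ∀ n, 0 < r n := fun n => ENNReal.toReal_nonneg.trans_lt (hr1 n)
  have hx : ∀ n, ∃ x : X, (K ∩ t n).Nonempty → x ∈ K ∩ t n := fun n => by
    by_cases h : (K ∩ t n).Nonempty
    · exact ⟨h.some, fun _ => h.some_mem⟩
    · exact ⟨hne.some, fun h' => absurd h' h⟩
  choose x hx using hx
  -- Only pieces meeting `K` are kept, which allows the centres to be chosen in `K`.
  let I : Set ℕ := {n | (K ∩ t n).Nonempty}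
  have hcov : K ⊆ ⋃ n : I, Metric.ball (x n) (r n) := by
    intro y hy
    obtain ⟨n, hn⟩ := mem_iUnion.1 (htK hy)
    have hnI : n ∈ I := ⟨y, hy, hn⟩
    refine mem_iUnion.2 ⟨⟨n, hnI⟩, ?_⟩
    rw [Metric.mem_ball, dist_edist]
    refine lt_of_le_of_lt ?_ (hr1 n)
    exact ENNReal.toReal_mono ((htd n).trans_lt ENNReal.ofReal_lt_top).ne
      (Metric.edist_le_ediam_of_mem hn (hx n hnI).2)
  obtain ⟨s, hs⟩ := hK.elim_finite_subcover (fun n : I => Metric.ball (x n) (r n))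
    (fun _ => Metric.isOpen_ball) hcov
  refine ⟨s.image fun n : I => (x n, r n), ?_, ?_, ?_⟩
  · simp only [Finset.mem_image]
    rintro _ ⟨n, -, rfl⟩
    exact ⟨(hx n n.2).1, hr0 n, hr2 n⟩
  · intro y hy
    obtain ⟨n, hn, hyn⟩ := mem_iUnion₂.1 (hs hy)
    exact mem_iUnion₂.2 ⟨(x n, r n), Finset.mem_image_of_mem _ hn, hyn⟩
  · have hle : ∑ b ∈ s.image (fun n : I => (x n, r n)), b.2 ^ d ≤ ∑ n ∈ s, r n ^ d := by
      exact Finset.sum_image_le_of_nonneg fun b hb => by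
        obtain ⟨n, -, rfl⟩ := Finset.mem_image.1 hb
        exact pow_nonneg (hr0 n).le d
    refine hle.trans ?_
    have hsum : ∑ n ∈ s, (Metric.ediam (t n)).toReal ^ d ≤ ε / 2 := by
      refine (ENNReal.ofReal_le_ofReal_iff (by positivity)).1 ?_
      rw [ENNReal.ofReal_sum_of_nonneg (fun _ _ => by positivity)]
      calc ∑ n ∈ s, ENNReal.ofReal ((Metric.ediam (t n)).toReal ^ d)
          = ∑ n ∈ s, ⨆ _ : (t n).Nonempty, Metric.ediam (t n) ^ (d : ℝ) := by
            refine Finset.sum_congr rfl fun n _ => ?_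
            have hne : (t n).Nonempty := n.2.mono inter_subset_right
            rw [iSup_pos hne, ENNReal.rpow_natCast, ENNReal.ofReal_pow ENNReal.toReal_nonneg,
              ENNReal.ofReal_toReal ((htd n).trans_lt ENNReal.ofReal_lt_top).ne]
        _ = ∑ n ∈ s.map (Function.Embedding.subtype _),
              ⨆ _ : (t n).Nonempty, Metric.ediam (t n) ^ (d : ℝ) := by
            rw [Finset.sum_map]; rfl
        _ ≤ _ := ENNReal.sum_le_tsum _
        _ ≤ _ := hts.le
    have hsum2 : ∑ n ∈ s, δ n ≤ ε / 2 := by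
      obtain ⟨c, hc, hcε⟩ := hδs
      calc ∑ n ∈ s, δ n = ∑ n ∈ s.map (Function.Embedding.subtype _), δ n := by
            rw [Finset.sum_map]; rfl
        _ ≤ c := sum_le_hasSum _ (fun n _ => (hδ n).le) hc
        _ ≤ _ := hcε
    calc ∑ n ∈ s, r n ^ d ≤ ∑ n ∈ s, ((Metric.ediam (t n)).toReal ^ d + δ n) :=
          Finset.sum_le_sum fun n _ => (hr3 n).le
      _ ≤ ε := by rw [Finset.sum_add_distrib]; linarith

variable {E : Type*} [NormedAddCommGroup E] [NormedSpace ℝ E]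

/-- In the Leibniz rule each gradient is multiplied by factors `1 - ψ j` lying in `[0, 1]`. -/
theorem norm_fderiv_prod_one_sub_le {ι : Type*} (s : Finset ι) {ψ : ι → E → ℝ}
    (hψ : ∀ i ∈ s, Differentiable ℝ (ψ i)) (h01 : ∀ i ∈ s, ∀ z, ψ i z ∈ Icc (0 : ℝ) 1) (z : E) :
    ‖fderiv ℝ (fun w => ∏ i ∈ s, (1 - ψ i w)) z‖ ≤ ∑ i ∈ s, ‖fderiv ℝ (ψ i) z‖ := by
  classical
  have := HasFDerivAt.finsetProd (u := s) (g := fun i w => 1 - ψ i w) (x := z)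
    (g' := fun i => -fderiv ℝ (ψ i) z)
    (fun i hi => by simpa using ((hψ i hi z).hasFDerivAt.const_sub 1))
  rw [this.fderiv]
  refine (norm_sum_le _ _).trans (Finset.sum_le_sum fun i hi => ?_)
  rw [norm_smul, norm_neg]
  refine mul_le_of_le_one_left (norm_nonneg _) ?_
  rw [Real.norm_eq_abs, Finset.abs_prod]
  refine Finset.prod_le_one (fun _ _ => abs_nonneg _) fun j hj => ?_
  have := h01 j (Finset.mem_of_mem_erase hj) z
  rw [abs_le]
  constructor <;> linarith [this.1, this.2]

variable [FiniteDimensional ℝ E] [MeasurableSpace E] [BorelSpace E]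

/-- Cutoffs removing a compact set of codimension one Hausdorff measure zero. -/
theorem exists_cutoff_removing (ν : Measure E) [ν.IsAddHaarMeasure] {d : ℕ}
    (hd : Module.finrank ℝ E = d + 1) {K : Set E} (hK : IsCompact K)
    (hne : K.Nonempty) (h0 : μH[(d : ℝ)] K = 0) :
    ∃ C : ℝ, ∀ ε > 0, ∃ χ : E → ℝ, ContDiff ℝ 1 χ ∧ (∀ z, |χ z| ≤ 1) ∧
      (∀ z ∈ K, ∀ᶠ w in 𝓝 z, χ w = 0) ∧ (∀ z, 4 * ε ≤ Metric.infDist z K → χ z = 1) ∧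
      ∫⁻ z, ENNReal.ofReal ‖fderiv ℝ χ z‖ ∂ν ≤ ENNReal.ofReal (C * ε) := by
  have : Nontrivial E := Module.nontrivial_of_finrank_pos (R := ℝ) (by omega)
  -- Rescaled to a covering ball of radius `r`, the bump is one on the ball of radius `2 r`, a
  -- neighbourhood of the covering ball, and zero at distance `3 r` or more. The radius `4 r` used
  -- below leaves room for the gradient to vanish outside.
  let b : ContDiffBump (0 : E) := ⟨2, 3, by norm_num, by norm_num⟩
  have hbd : ContDiff ℝ 1 b := b.contDiff
  obtain ⟨A, hA⟩ := (hbd.continuous_fderiv (by norm_num)).bounded_above_of_compact_support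
    (b.hasCompactSupport.fderiv ℝ)
  have hA0 : 0 ≤ A := (norm_nonneg _).trans (hA 0)
  set m := (ν (Metric.ball 0 1)).toReal
  -- A gradient bound `A / r` times the volume `m (4 r) ^ (d + 1)` leaves `r ^ d`, the quantity
  -- summed by the cover.
  refine ⟨A * 4 ^ (d + 1) * m, fun ε hε => ?_⟩
  obtain ⟨s, hs, hsK, hsum⟩ := exists_finset_ball_cover hK hne h0 hε
  let ψ : E × ℝ → E → ℝ := fun p w => b (p.2⁻¹ • (w - p.1))
  have hψd : ∀ p, ContDiff ℝ 1 (ψ p) := fun p => hbd.comp (by fun_prop)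
  have hψ01 : ∀ p z, ψ p z ∈ Icc (0 : ℝ) 1 := fun p z => ⟨b.nonneg, b.le_one⟩
  have hψ1 : ∀ p ∈ s, ∀ z, dist z p.1 < 2 * p.2 → ψ p z = 1 := by
    intro p hp z hz
    apply b.one_of_mem_closedBall
    have := (hs p hp).2.1
    rw [mem_closedBall_zero_iff, norm_smul, norm_inv, Real.norm_of_nonneg this.le, ← dist_eq_norm,
      inv_mul_le_iff₀ this]
    change dist z p.1 ≤ p.2 * 2
    linarith
  have hψ0 : ∀ p ∈ s, ∀ z, 3 * p.2 ≤ dist z p.1 → ψ p z = 0 := by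
    intro p hp z hz
    apply b.zero_of_le_dist
    have := (hs p hp).2.1
    rw [dist_zero_right, norm_smul, norm_inv, Real.norm_of_nonneg this.le, ← dist_eq_norm,
      le_inv_mul_iff₀ this]
    change p.2 * 3 ≤ dist z p.1
    linarith
  have hψf : ∀ p ∈ s, ∀ z, ‖fderiv ℝ (ψ p) z‖
      ≤ (Metric.ball p.1 (4 * p.2)).indicator (fun _ => p.2⁻¹ * A) z := by
    intro p hp z
    have hp0 := (hs p hp).2.1
    by_cases hz : z ∈ Metric.ball p.1 (4 * p.2)
    · rw [indicator_of_mem hz]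
      have h1 : HasFDerivAt (fun w => p.2⁻¹ • (w - p.1))
          (p.2⁻¹ • ContinuousLinearMap.id ℝ E) z :=
        ((hasFDerivAt_id z).sub_const p.1).const_smul p.2⁻¹
      have h2 : HasFDerivAt (ψ p) _ z :=
        ((hbd.differentiable (by norm_num) _).hasFDerivAt).comp z h1
      rw [h2.fderiv, ContinuousLinearMap.comp_smul, ContinuousLinearMap.comp_id, norm_smul,
        norm_inv, Real.norm_of_nonneg hp0.le]
      gcongr
      exact hA _
    · rw [indicator_of_notMem hz]
      have : ψ p =ᶠ[𝓝 z] fun _ => 0 := by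
        have hz' : 3 * p.2 < dist z p.1 := by
          rw [Metric.mem_ball, not_lt] at hz
          linarith
        filter_upwards [(isOpen_lt continuous_const
          (continuous_id.dist continuous_const)).mem_nhds hz'] with w hw
        exact hψ0 p hp w (le_of_lt hw)
      rw [this.fderiv_eq]
      simp
  refine ⟨fun w => ∏ p ∈ s, (1 - ψ p w), ?_, fun z => ?_, fun z hz => ?_, fun z hz => ?_, ?_⟩
  · exact contDiff_prod fun p _ => contDiff_const.sub (hψd p)
  · rw [Finset.abs_prod]
    refine Finset.prod_le_one (fun _ _ => abs_nonneg _) fun p _ => ?_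
    have := hψ01 p z
    rw [abs_le]
    constructor <;> linarith [this.1, this.2]
  · obtain ⟨p, hp, hzp⟩ := mem_iUnion₂.1 (hsK hz)
    filter_upwards [Metric.isOpen_ball.mem_nhds hzp] with w hw
    refine Finset.prod_eq_zero hp ?_
    rw [hψ1 p hp w (by rw [Metric.mem_ball] at hw; linarith [(hs p hp).2.1]), sub_self]
  · refine Finset.prod_eq_one fun p hp => ?_
    rw [hψ0 p hp z, sub_zero]
    have h1 := Metric.infDist_le_dist_of_mem (x := z) (hs p hp).1
    have := (hs p hp).2
    linarith
  · calc ∫⁻ z, ENNReal.ofReal ‖fderiv ℝ (fun w => ∏ p ∈ s, (1 - ψ p w)) z‖ ∂ν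
        ≤ ∫⁻ z, ∑ p ∈ s, (Metric.ball p.1 (4 * p.2)).indicator
            (fun _ => ENNReal.ofReal (p.2⁻¹ * A)) z ∂ν := by
          refine lintegral_mono fun z => ?_
          refine (ENNReal.ofReal_le_ofReal (norm_fderiv_prod_one_sub_le s
            (fun p _ => (hψd p).differentiable (by norm_num)) (fun p _ => hψ01 p) z)).trans ?_
          rw [ENNReal.ofReal_sum_of_nonneg fun _ _ => norm_nonneg _]
          refine Finset.sum_le_sum fun p hp => ?_
          refine (ENNReal.ofReal_le_ofReal (hψf p hp z)).trans ?_
          by_cases hz : z ∈ Metric.ball p.1 (4 * p.2) <;> simp [hz]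
      _ = ∑ p ∈ s, ENNReal.ofReal (p.2⁻¹ * A) * ν (Metric.ball p.1 (4 * p.2)) := by
          rw [lintegral_finsetSum _ fun p _ => measurable_const.indicator Metric.isOpen_ball.measurableSet]
          refine Finset.sum_congr rfl fun p _ => ?_
          rw [lintegral_indicator_const Metric.isOpen_ball.measurableSet]
      _ = ∑ p ∈ s, ENNReal.ofReal (A * 4 ^ (d + 1) * m * p.2 ^ d) := by
          refine Finset.sum_congr rfl fun p hp => ?_
          have hp0 := (hs p hp).2.1
          have hm : ν (Metric.ball (0 : E) 1) = ENNReal.ofReal m :=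
            (ENNReal.ofReal_toReal Metric.isBounded_ball.measure_lt_top.ne).symm
          rw [Measure.addHaar_ball ν _ (by positivity), hd, hm,
            ← ENNReal.ofReal_mul (by positivity), ← ENNReal.ofReal_mul (by positivity)]
          congr 1
          field_simp
          ring
      _ = ENNReal.ofReal (A * 4 ^ (d + 1) * m * ∑ p ∈ s, p.2 ^ d) := by
          rw [Finset.mul_sum, ENNReal.ofReal_sum_of_nonneg]
          intro p hp
          have hp0 := (hs p hp).2.1
          have : 0 ≤ m := ENNReal.toReal_nonneg
          positivity
      _ ≤ _ := by
          have : 0 ≤ m := ENNReal.toReal_nonneg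
          gcongr

/-- Closed sets of codimension one Hausdorff measure zero are removable for bounded vector fields
with integrable divergence. -/
theorem weakFlux_eq_zero_of_removable {ν μ : Measure E} [ν.IsAddHaarMeasure] (hμν : μ ≤ ν)
    {V : E → E} {f : E → ℝ} {M : ℝ} (h : IsBoundedField μ V f M) {d : ℕ}
    (hd : Module.finrank ℝ E = d + 1) {Z U : Set E} (hZc : IsClosed Z) (hZ : μH[(d : ℝ)] Z = 0)
    (hZμ : μ Z = 0) (h0 : ∀ φ, IsTest (U \ Z) φ → weakFlux μ V f φ = 0)
    {φ : E → ℝ} (hφ : IsTest U φ) : weakFlux μ V f φ = 0 := by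
  -- Only the part of `Z` in the support of `φ` matters, and it is compact.
  have hK : IsCompact (tsupport φ ∩ Z) := hφ.2.isCompact.inter_right hZc
  rcases (tsupport φ ∩ Z).eq_empty_or_nonempty with he | hne
  · exact h0 φ ⟨hφ.1, hφ.2, fun z hz => ⟨hφ.3 hz, fun hzZ => he.subset ⟨hz, hzZ⟩⟩⟩
  obtain ⟨C, hC⟩ := exists_cutoff_removing ν hd hK hne (measure_mono_null inter_subset_right hZ)
  choose! χ hχd hχ1 hχ0 hχe hχi using hC
  let ε : ℕ → ℝ := fun n => 1 / ((n : ℝ) + 1)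
  have hε : ∀ n, 0 < ε n := fun n => by positivity
  have hεl : Tendsto ε atTop (𝓝 0) := tendsto_one_div_add_atTop_nhds_zero_nat
  have ht := tendsto_integral_mul_fderiv_cutoff h hφ (χ := fun n => χ (ε n))
    (fun n z _ => (hχd _ (hε n)).contDiffAt) (fun n => hχ1 _ (hε n)) ?_ ?_
  · obtain ⟨B, hB0, hB⟩ := hφ.exists_bound
    have hz : Tendsto (fun n => ∫ z, φ z * fderiv ℝ (χ (ε n)) z (V z) ∂μ) atTop (𝓝 0) := by
      -- The maximum with zero is there because the sign of `C` is not recorded.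
      have hl : Tendsto (fun n => B * M * max (C * ε n) 0) atTop (𝓝 0) := by
        have := ((hεl.const_mul C).max (tendsto_const_nhds (x := (0 : ℝ)))).const_mul (B * M)
        simpa using this
      refine squeeze_zero_norm (fun n => ?_) hl
      have hfi : ∫⁻ z, ENNReal.ofReal ‖fderiv ℝ (χ (ε n)) z‖ ∂μ ≤ ENNReal.ofReal (C * ε n) :=
        (lintegral_mono' hμν le_rfl).trans (hχi _ (hε n))
      have hm : AEStronglyMeasurable (fun z => ‖fderiv ℝ (χ (ε n)) z‖) μ :=
        ((hχd _ (hε n)).continuous_fderiv (by norm_num)).norm.aestronglyMeasurable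
      have hI : Integrable (fun z => ‖fderiv ℝ (χ (ε n)) z‖) μ := by
        refine ⟨hm, ?_⟩
        rw [hasFiniteIntegral_iff_ofReal (ae_of_all _ fun _ => norm_nonneg _)]
        exact hfi.trans_lt ENNReal.ofReal_lt_top
      calc ‖∫ z, φ z * fderiv ℝ (χ (ε n)) z (V z) ∂μ‖
          ≤ ∫ z, B * M * ‖fderiv ℝ (χ (ε n)) z‖ ∂μ := by
            refine norm_integral_le_of_norm_le (hI.const_mul _) ?_
            filter_upwards [h.bound] with z hz
            rw [norm_mul]
            calc ‖φ z‖ * ‖fderiv ℝ (χ (ε n)) z (V z)‖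
                ≤ B * (‖fderiv ℝ (χ (ε n)) z‖ * M) := by
                  gcongr
                  · exact (hB z).1
                  · exact ((fderiv ℝ (χ (ε n)) z).le_opNorm _).trans (by gcongr)
              _ = _ := by ring
        _ = B * M * ∫ z, ‖fderiv ℝ (χ (ε n)) z‖ ∂μ := integral_const_mul _ _
        _ ≤ _ := by
          have := h.nonneg
          gcongr
          rw [integral_eq_lintegral_of_nonneg_ae (ae_of_all _ fun _ => norm_nonneg _) hm]
          refine ENNReal.toReal_le_of_le_ofReal (le_max_right _ _) (hfi.trans ?_)
          exact ENNReal.ofReal_le_ofReal (le_max_left _ _)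
    have := tendsto_nhds_unique ht hz
    linarith
  · filter_upwards [measure_eq_zero_iff_ae_notMem.1 hZμ] with z hz hzs
    apply tendsto_const_nhds.congr'
    -- A point off `Z` has positive distance to the removed compact set, so the cutoffs eventually
    -- equal one there.
    have hpos : 0 < Metric.infDist z (tsupport φ ∩ Z) :=
      (hK.isClosed.notMem_iff_infDist_pos hne).1 fun h => hz h.2
    have : ∀ᶠ n in atTop, 4 * ε n < Metric.infDist z (tsupport φ ∩ Z) := by
      refine (hεl.const_mul 4).eventually_lt_const ?_
      simpa using hpos
    filter_upwards [this] with n hn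
    exact (hχe _ (hε n) z hn.le).symm
  · intro n
    refine h0 _ ⟨(hφ.mul_left (hχd _ (hε n))).1, (hφ.mul_left (hχd _ (hε n))).2, fun z hz => ?_⟩
    have hzφ : z ∈ tsupport φ := tsupport_mul_subset_right hz
    refine ⟨hφ.3 hzφ, fun hzZ => ?_⟩
    refine notMem_tsupport_iff_eventuallyEq.2 ?_ hz
    filter_upwards [hχ0 _ (hε n) z ⟨hzφ, hzZ⟩] with w hw
    simp [hw]

end Removable

/-! ### Derivatives in space-time -/

section SpaceTimeDerivatives

variable {N : ℕ} {f u : SpaceTime N → ℝ} {z : SpaceTime N}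

theorem hasDerivAt_time (h : DifferentiableAt ℝ f z) :
    HasDerivAt (fun s : ℝ => f (z.1, s)) (fderiv ℝ f z (0, 1)) z.2 := by
  have h1 : HasDerivAt (fun s : ℝ => (z.1, s)) ((0 : Space N), (1 : ℝ)) z.2 :=
    (hasDerivAt_const _ _).prodMk (hasDerivAt_id _)
  exact HasFDerivAt.comp_hasDerivAt z.2 (f := fun s : ℝ => (z.1, s)) h.hasFDerivAt h1

theorem timeDeriv_eq (h : DifferentiableAt ℝ f z) : timeDeriv f z = fderiv ℝ f z (0, 1) :=
  (hasDerivAt_time h).deriv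

theorem hasFDerivAt_slice (h : DifferentiableAt ℝ f z) :
    HasFDerivAt (fun y : Space N => f (y, z.2))
      ((fderiv ℝ f z).comp (ContinuousLinearMap.inl ℝ (Space N) ℝ)) z.1 := by
  have h1 : HasFDerivAt (fun y : Space N => (y, z.2)) (ContinuousLinearMap.inl ℝ (Space N) ℝ) z.1 :=
    hasFDerivAt_prodMk_left z.1 z.2
  exact HasFDerivAt.comp z.1 (f := fun y : Space N => (y, z.2)) h.hasFDerivAt h1

theorem gradX_eq (h : DifferentiableAt ℝ f z) :
    gradX f z = (toDual ℝ (Space N)).symm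
      ((fderiv ℝ f z).comp (ContinuousLinearMap.inl ℝ (Space N) ℝ)) := by
  rw [gradX, gradient, (hasFDerivAt_slice h).fderiv]

theorem inner_gradX (h : DifferentiableAt ℝ f z) (v : Space N) :
    ⟪gradX f z, v⟫ = fderiv ℝ f z (v, 0) := by
  rw [gradX_eq h, toDual_symm_apply]
  simp

theorem fderiv_apply_eq (h : DifferentiableAt ℝ f z) (w : SpaceTime N) :
    fderiv ℝ f z w = ⟪gradX f z, w.1⟫ + timeDeriv f z * w.2 := by
  rw [inner_gradX h, timeDeriv_eq h, mul_comm, ← smul_eq_mul, ← map_smul, ← map_add]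
  simp

theorem contDiffAt_fderiv (h : ContDiffAt ℝ 2 u z) : ContDiffAt ℝ 1 (fderiv ℝ u) z :=
  h.fderiv_right (by norm_num)

theorem eventually_differentiableAt {n : WithTop ℕ∞} (h : ContDiffAt ℝ n u z) (hn : 1 ≤ n) :
    ∀ᶠ w in 𝓝 z, DifferentiableAt ℝ u w := by
  filter_upwards [(h.of_le hn).eventually (by simp)] with w hw
  exact hw.differentiableAt (by norm_num)

theorem contDiffAt_timeDeriv (h : ContDiffAt ℝ 2 u z) : ContDiffAt ℝ 1 (timeDeriv u) z := by
  have : timeDeriv u =ᶠ[𝓝 z] fun w => fderiv ℝ u w (0, 1) := by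
    filter_upwards [eventually_differentiableAt h (by norm_num)] with w hw
    exact timeDeriv_eq hw
  exact ((contDiffAt_fderiv h).clm_apply contDiffAt_const).congr_of_eventuallyEq this

theorem gradX_eventuallyEq {n : WithTop ℕ∞} (h : ContDiffAt ℝ n u z) (hn : 1 ≤ n) :
    gradX u =ᶠ[𝓝 z] fun w => (toDual ℝ (Space N)).symm
      ((fderiv ℝ u w).comp (ContinuousLinearMap.inl ℝ (Space N) ℝ)) := by
  filter_upwards [eventually_differentiableAt h hn] with w hw
  exact gradX_eq hw

theorem contDiffAt_gradX (h : ContDiffAt ℝ 2 u z) : ContDiffAt ℝ 1 (gradX u) z := by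
  refine ContDiffAt.congr_of_eventuallyEq ?_ (gradX_eventuallyEq h (by norm_num))
  exact (toDual ℝ (Space N)).symm.toContinuousLinearEquiv.contDiff.contDiffAt.comp z
    ((contDiffAt_fderiv h).clm_comp contDiffAt_const)

theorem continuousAt_fderiv_of_contDiffAt {E : Type*} [NormedAddCommGroup E] [NormedSpace ℝ E]
    {f : E → ℝ} {z : E} (h : ContDiffAt ℝ 1 f z) : ContinuousAt (fderiv ℝ f) z :=
  (h.fderiv_right (m := 0) (by norm_num)).continuousAt

theorem continuousAt_timeDeriv (h : ContDiffAt ℝ 1 f z) : ContinuousAt (timeDeriv f) z := by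
  have : timeDeriv f =ᶠ[𝓝 z] fun w => fderiv ℝ f w (0, 1) := by
    filter_upwards [eventually_differentiableAt h le_rfl] with w hw
    exact timeDeriv_eq hw
  exact ((continuousAt_fderiv_of_contDiffAt h).clm_apply continuousAt_const).congr this.symm

/-- The second derivatives occurring in the wave operator. -/
theorem waveOp_eq (c : ℝ) (h : ContDiffAt ℝ 2 u z) (b : OrthonormalBasis (Fin N) ℝ (Space N)) :
    waveOp c u z = ∑ i, fderiv ℝ (fderiv ℝ u) z (b i, 0) (b i, 0)
      - (c ^ 2)⁻¹ * fderiv ℝ (fderiv ℝ u) z (0, 1) (0, 1) := by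
  have hd : DifferentiableAt ℝ (fderiv ℝ u) z := (contDiffAt_fderiv h).differentiableAt (by norm_num)
  have hev := eventually_differentiableAt h (by norm_num)
  unfold waveOp
  congr 1
  · rw [laplacian_eq_iteratedFDeriv_orthonormalBasis _ b]
    refine Finset.sum_congr rfl fun i _ => ?_
    rw [iteratedFDeriv_two_apply]
    have h1 : fderiv ℝ (fun y : Space N => u (y, z.2)) =ᶠ[𝓝 z.1]
        fun y => (fderiv ℝ u (y, z.2)).comp (ContinuousLinearMap.inl ℝ (Space N) ℝ) := by
      have ht : Tendsto (fun y : Space N => (y, z.2)) (𝓝 z.1) (𝓝 z) :=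
        (Continuous.prodMk_left z.2).tendsto' _ _ rfl
      filter_upwards [ht.eventually hev] with y hy
      exact (hasFDerivAt_slice hy).fderiv
    rw [h1.fderiv_eq]
    have h2 : HasFDerivAt (fun y : Space N => fderiv ℝ u (y, z.2))
        ((fderiv ℝ (fderiv ℝ u) z).comp (ContinuousLinearMap.inl ℝ (Space N) ℝ)) z.1 :=
      HasFDerivAt.comp z.1 (f := fun y : Space N => (y, z.2)) hd.hasFDerivAt
        (hasFDerivAt_prodMk_left z.1 z.2)
    have h3 := (h2.clm_comp (hasFDerivAt_const (ContinuousLinearMap.inl ℝ (Space N) ℝ) z.1)).fderiv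
    rw [h3]
    simp
  · congr 1
    rw [iteratedDeriv_succ, iteratedDeriv_one]
    have h1 : deriv (fun s : ℝ => u (z.1, s)) =ᶠ[𝓝 z.2] fun s => fderiv ℝ u (z.1, s) (0, 1) := by
      have ht : Tendsto (fun s : ℝ => (z.1, s)) (𝓝 z.2) (𝓝 z) :=
        (Continuous.prodMk_right z.1).tendsto' _ _ rfl
      filter_upwards [ht.eventually hev] with s hs
      exact (hasDerivAt_time hs).deriv
    rw [h1.deriv_eq]
    have h2 : HasDerivAt (fun s : ℝ => fderiv ℝ u (z.1, s)) (fderiv ℝ (fderiv ℝ u) z (0, 1)) z.2 :=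
      HasFDerivAt.comp_hasDerivAt z.2 (f := fun s : ℝ => (z.1, s)) hd.hasFDerivAt
        ((hasDerivAt_const _ _).prodMk (hasDerivAt_id _))
    simpa using (h2.clm_apply (hasDerivAt_const z.2 ((0 : Space N), (1 : ℝ)))).deriv

end SpaceTimeDerivatives

/-! ### The energy flux field -/

section FluxField

instance SpaceTime.isAddHaarMeasure_volume (N : ℕ) :
    (volume : Measure (SpaceTime N)).IsAddHaarMeasure :=
  inferInstanceAs ((volume : Measure (Space N)).prod (volume : Measure ℝ)).IsAddHaarMeasure

variable {N : ℕ}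

/-- The space-time vector field `(u ∇u, -c⁻² u ∂u/∂t)`. -/
noncomputable def fluxField (c : ℝ) (u : SpaceTime N → ℝ) (z : SpaceTime N) : SpaceTime N :=
  (u z • gradX u z, -((c ^ 2)⁻¹ * u z * timeDeriv u z))

/-- The divergence `u G - 2 L` of the flux field of a solution. -/
noncomputable def fluxDiv (c : ℝ) (u G : SpaceTime N → ℝ) (z : SpaceTime N) : ℝ :=
  u z * G z - 2 * lagrangian c u z

theorem contDiffAt_fluxField {c : ℝ} {u : SpaceTime N → ℝ} {z : SpaceTime N}
    (h : ContDiffAt ℝ 2 u z) : ContDiffAt ℝ 1 (fluxField c u) z := by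
  have h1 : ContDiffAt ℝ 1 u z := h.of_le (by norm_num)
  exact (h1.smul (contDiffAt_gradX h)).prodMk
    ((contDiffAt_const.mul h1).mul (contDiffAt_timeDeriv h)).neg

/-- Integration by parts against the constant function one. -/
theorem integral_fderiv_eq_zero {E : Type*} [NormedAddCommGroup E] [NormedSpace ℝ E]
    [FiniteDimensional ℝ E] [MeasurableSpace E] [BorelSpace E] (ν : Measure E) [ν.IsAddHaarMeasure]
    {U : Set E} {φ : E → ℝ} (hφ : IsTest U φ) (v : E) : ∫ z, fderiv ℝ φ z v ∂ν = 0 := by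
  have hi : Integrable (fun z => fderiv ℝ φ z v) ν :=
    (hφ.continuous_fderiv.clm_apply continuous_const).integrable_of_hasCompactSupport
      (hφ.2.fderiv_apply ℝ v)
  have := integral_mul_fderiv_eq_neg_fderiv_mul_of_integrable (μ := ν) (f := fun _ => (1 : ℝ))
    (g := φ) (v := v) (by simp) (by simpa using hi)
    (by simpa using hφ.1.continuous.integrable_of_hasCompactSupport hφ.2)
    (fun _ _ => differentiableAt_const _) (fun _ _ => hφ.differentiable _)
  simpa using this

/-- The flux functional of the flux field vanishes on test functions supported where `u` is `C²`. -/
theorem weakFlux_eq_zero_of_contDiffAt {c : ℝ} {u G : SpaceTime N → ℝ} {Q W : Set (SpaceTime N)}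
    (hQ : MeasurableSet Q) (hWQ : W ⊆ Q) (hW : ∀ z ∈ W, ContDiffAt ℝ 2 u z)
    (hG : ∀ᵐ z ∂volume, z ∈ W → waveOp c u z = G z)
    {φ : SpaceTime N → ℝ} (hφ : IsTest W φ) :
    weakFlux (volume.restrict Q) (fluxField c u) (fluxDiv c u G) φ = 0 := by
  let b := EuclideanSpace.basisFun (Fin N) ℝ
  -- These are the components of `φ V`, up to the factor `-c⁻²` in time. They are `C¹` with compact
  -- support, and the integrand of the flux is a combination of their directional derivatives, each
  -- of integral zero.
  let P : SpaceTime N → SpaceTime N → ℝ := fun v z => (u z * fderiv ℝ u z v) * φ z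
  have hu1 : ∀ z ∈ W, ContDiffAt ℝ 1 u z := fun z hz => (hW z hz).of_le (by norm_num)
  have hP : ∀ v, IsTest W (P v) := fun v => hφ.mul_of_contDiffAt fun z hz =>
    (hu1 z (hφ.3 hz)).mul ((contDiffAt_fderiv (hW z (hφ.3 hz))).clm_apply contDiffAt_const)
  have hPd : ∀ v, ∀ z ∈ W, fderiv ℝ (P v) z v = u z * fderiv ℝ u z v * fderiv ℝ φ z v
      + φ z * ((fderiv ℝ u z v) ^ 2 + u z * fderiv ℝ (fderiv ℝ u) z v v) := by
    intro v z hz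
    have h1 : HasFDerivAt (fun w => fderiv ℝ u w v) _ z :=
      ((contDiffAt_fderiv (hW z hz)).differentiableAt (by norm_num)).hasFDerivAt.clm_apply
        (hasFDerivAt_const v z)
    have h2 := (((hu1 z hz).differentiableAt (by norm_num)).hasFDerivAt.mul h1).mul
      (hφ.differentiable z).hasFDerivAt
    have h3 : fderiv ℝ (P v) z = _ := h2.fderiv
    rw [h3]
    simp
    ring
  have hzero : ∀ z, z ∉ tsupport φ → φ z = 0 ∧ fderiv ℝ φ z = 0 ∧ ∀ v, fderiv ℝ (P v) z = 0 :=
    fun z hz => ⟨image_eq_zero_of_notMem_tsupport hz,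
      image_eq_zero_of_notMem_tsupport fun h => hz (tsupport_fderiv_subset ℝ h), fun v =>
      image_eq_zero_of_notMem_tsupport fun h =>
        hz (tsupport_mul_subset_right (tsupport_fderiv_subset ℝ h))⟩
  have key : ∀ᵐ z ∂volume,
      Q.indicator (fun z => fderiv ℝ φ z (fluxField c u z) + fluxDiv c u G z * φ z) z =
      ∑ i, fderiv ℝ (P (b i, 0)) z (b i, 0) - (c ^ 2)⁻¹ * fderiv ℝ (P (0, 1)) z (0, 1) := by
    filter_upwards [hG] with z hzG
    by_cases hz : z ∈ tsupport φ
    · have hzW := hφ.3 hz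
      have hud : DifferentiableAt ℝ u z := (hu1 z hzW).differentiableAt (by norm_num)
      rw [indicator_of_mem (hWQ hzW), hPd _ z hzW]
      simp_rw [hPd _ z hzW]
      have e1 : fderiv ℝ φ z (fluxField c u z)
          = ∑ i, u z * fderiv ℝ u z (b i, 0) * fderiv ℝ φ z (b i, 0)
            - (c ^ 2)⁻¹ * (u z * fderiv ℝ u z (0, 1) * fderiv ℝ φ z (0, 1)) := by
        rw [fderiv_apply_eq (hφ.differentiable z)]
        simp only [fluxField]
        rw [real_inner_smul_right, ← b.sum_inner_mul_inner, Finset.mul_sum, timeDeriv_eq hud,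
          timeDeriv_eq (hφ.differentiable z)]
        have : ∀ i, ⟪gradX φ z, b i⟫ * ⟪b i, gradX u z⟫
            = fderiv ℝ u z (b i, 0) * fderiv ℝ φ z (b i, 0) := fun i => by
          rw [inner_gradX (hφ.differentiable z), real_inner_comm, inner_gradX hud, mul_comm]
        simp_rw [this]
        rw [sub_eq_add_neg]
        congr 1
        · exact Finset.sum_congr rfl fun i _ => by ring
        · ring
      have e2 : ‖gradX u z‖ ^ 2 = ∑ i, fderiv ℝ u z (b i, 0) ^ 2 := by
        rw [← b.sum_sq_norm_inner_right]
        refine Finset.sum_congr rfl fun i _ => ?_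
        rw [real_inner_comm, inner_gradX hud, Real.norm_eq_abs, sq_abs]
      -- The wave equation is used here, to recognise `u G - 2 L` as the divergence.
      rw [e1, fluxDiv, ← hzG hzW, waveOp_eq c (hW z hzW) b, lagrangian, e2, timeDeriv_eq hud,
        Finset.sum_add_distrib, ← Finset.mul_sum, Finset.sum_add_distrib, ← Finset.mul_sum, mul_pow,
        inv_pow]
      ring
    · obtain ⟨h1, h2, h3⟩ := hzero z hz
      simp [h1, h2, h3, indicator]
  have hi : ∀ v w, Integrable (fun z => fderiv ℝ (P v) z w) volume := fun v w =>
    ((hP v).continuous_fderiv.clm_apply continuous_const).integrable_of_hasCompactSupport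
      ((hP v).2.fderiv_apply ℝ w)
  unfold weakFlux
  rw [← integral_indicator hQ, integral_congr_ae key, integral_sub (integrable_finsetSum _
    fun i _ => hi _ _) ((hi _ _).const_mul _), integral_finsetSum _ fun i _ => hi _ _,
    integral_const_mul, integral_fderiv_eq_zero volume (hP _)]
  simp [integral_fderiv_eq_zero volume (hP _)]

end FluxField

/-! ### Negligible sets -/

/-- A zero with nonzero derivative is isolated, and a discrete subspace of the line is countable. -/
theorem countable_setOf_simple_zero {g : ℝ → ℝ} :
    {t : ℝ | g t = 0 ∧ DifferentiableAt ℝ g t ∧ deriv g t ≠ 0}.Countable := by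
  set S := {t : ℝ | g t = 0 ∧ DifferentiableAt ℝ g t ∧ deriv g t ≠ 0}
  have : DiscreteTopology S := by
    rw [discreteTopology_subtype_iff]
    rintro t ⟨-, hd, hne⟩
    have := hd.hasDerivAt.eventually_ne (c := 0) hne
    rw [← disjoint_iff, disjoint_principal_right]
    filter_upwards [this] with s hs hsS
    exact hs hsS.1
  have : Countable S := countable_of_Lindelof_of_discrete
  exact to_countable S

theorem hasDerivAt_comp_add_smul {E : Type*} [NormedAddCommGroup E] [NormedSpace ℝ E] {g : E → ℝ}
    {g' : E →L[ℝ] ℝ} {y v : E} {s : ℝ} (h : HasFDerivAt g g' (y + s • v)) :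
    HasDerivAt (fun s : ℝ => g (y + s • v)) (g' v) s := by
  have h2 : HasDerivAt (fun s : ℝ => y + s • v) v s := by
    simpa using ((hasDerivAt_id s).smul_const v).const_add y
  exact h.comp_hasDerivAt s h2

namespace WaveFront

variable {N : ℕ} {c : ℝ} (F : WaveFront N c)

theorem contDiffAt {z : SpaceTime N} (hz : z ∈ F.dom) : ContDiffAt ℝ 1 F.eqn z :=
  F.contDiffOn_eqn.contDiffAt (F.isOpen_dom.mem_nhds hz)

theorem differentiableAt {z : SpaceTime N} (hz : z ∈ F.dom) : DifferentiableAt ℝ F.eqn z :=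
  (F.contDiffAt hz).differentiableAt (by norm_num)

theorem measurableSet_carrier : MeasurableSet F.carrier := by
  have h : F.carrier = F.dom \ (F.dom ∩ F.eqn ⁻¹' {0}ᶜ) := by
    ext z
    simp [carrier]
  rw [h]
  exact F.isOpen_dom.measurableSet.diff (F.contDiffOn_eqn.continuousOn.isOpen_inter_preimage
    F.isOpen_dom isClosed_singleton.isOpen_compl).measurableSet

/-- Since `ν_t < 0`, the front equation has only simple zeros in time. -/
theorem countable_line (x : Space N) : {t : ℝ | (x, t) ∈ F.carrier}.Countable := by
  refine (countable_setOf_simple_zero (g := fun t => F.eqn (x, t))).mono ?_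
  rintro t ⟨hd, h0⟩
  exact ⟨h0, (hasDerivAt_time (F.differentiableAt hd)).differentiableAt,
    (F.timeDeriv_neg _ hd h0).ne⟩

/-- A zero spatial normal would force `ν_t = -c ‖ν‖ = 0`. -/
theorem gradX_ne_zero {z : SpaceTime N} (hz : z ∈ F.carrier) : gradX F.eqn z ≠ 0 := by
  intro h
  have := F.timeDeriv_neg z hz.1 hz.2
  rw [F.characteristic z hz.1 hz.2, h] at this
  simp at this

/-- At a fixed time some spatial partial derivative of the front equation is nonzero. The points
where the `i`-th one is nonzero meet each line parallel to the `i`-th axis in simple zeros, so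
Fubini applies. -/
theorem volume_slice (t : ℝ) : volume {x : Space N | (x, t) ∈ F.carrier} = 0 := by
  let b := EuclideanSpace.basisFun (Fin N) ℝ
  let g : Space N → ℝ := fun x => F.eqn (x, t)
  have hm : MeasurableSet {x : Space N | (x, t) ∈ F.carrier} :=
    F.measurableSet_carrier.preimage measurable_prodMk_right
  let S : Fin N → Set (Space N) := fun i =>
    {x | (x, t) ∈ F.carrier} ∩ {x | fderiv ℝ g x (b i) ≠ 0}
  have hS : ∀ i, volume (S i) = 0 := by
    intro i
    have hSm : MeasurableSet (S i) := hm.inter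
      ((measurable_fderiv_apply_const ℝ g (b i)) (measurableSet_singleton 0).compl)
    rw [measure_eq_zero_iff_ae_notMem]
    refine ae_mem_of_ae_add_linearMap_mem (𝕜 := ℝ) (LinearMap.toSpanSingleton ℝ (Space N) (b i))
      volume volume hSm.compl fun y => ?_
    refine (Countable.ae_notMem (s := {s : ℝ | y + s • b i ∈ S i}) ?_ _).mono fun s hs => hs
    refine (countable_setOf_simple_zero (g := fun s => g (y + s • b i))).mono ?_
    rintro s ⟨⟨hd, h0⟩, hne⟩
    have h1 : HasFDerivAt g (fderiv ℝ g (y + s • b i)) (y + s • b i) :=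
      (hasFDerivAt_slice (F.differentiableAt hd)).differentiableAt.hasFDerivAt
    have h3 := hasDerivAt_comp_add_smul h1
    exact ⟨h0, h3.differentiableAt, fun h => hne (h3.deriv.symm.trans h)⟩
  refine measure_mono_null (fun x hx => ?_) (measure_iUnion_null hS)
  by_contra hcon
  simp only [S, mem_iUnion, mem_inter_iff, mem_ofPred_eq, not_exists, not_and, not_not] at hcon
  apply F.gradX_ne_zero hx
  refine ext_inner_right_basis b.toBasis fun i => ?_
  rw [OrthonormalBasis.coe_toBasis, inner_gradX (F.differentiableAt hx.1), inner_zero_left]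
  have := hcon i hx
  rwa [(hasFDerivAt_slice (F.differentiableAt hx.1)).fderiv] at this

end WaveFront

/-- The projection to space of a set that is negligible for the `N`-dimensional measure. -/
theorem volume_fst_image_eq_zero {N : ℕ} {Z : Set (SpaceTime N)} (hZ : μH[(N : ℝ)] Z = 0) :
    volume (Prod.fst '' Z) = 0 := by
  have h1 : μH[(N : ℝ)] (Prod.fst '' Z) = 0 := by
    have := (LipschitzWith.prod_fst (α := Space N) (β := ℝ)).hausdorffMeasure_image_le
      (d := N) (by positivity) Z
    simpa [hZ] using this
  rw [← EuclideanSpace.euclideanHausdorffMeasure_eq_volume,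
    Measure.euclideanHausdorffMeasure_def, Measure.smul_apply, h1, smul_zero]

section Regular

variable {ι : Type*} [Countable ι] {N : ℕ} {c : ℝ} {Ω : Set (Space N)} {F : ι → WaveFront N c}
  {Z : Set (SpaceTime N)}

theorem countable_line_fronts (x : Space N) : {t : ℝ | ∃ k, (x, t) ∈ (F k).carrier}.Countable := by
  simp_rw [ofPred_exists]
  exact countable_iUnion fun k => (F k).countable_line x

/-- For almost every `x` the whole vertical line avoids `Z`. This is stronger than nullity of `Z`
and is what the fundamental theorem of calculus in time requires. -/
theorem ae_forall_notMem_exceptional (hZ : μH[(N : ℝ)] Z = 0) :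
    ∀ᵐ x : Space N, ∀ t : ℝ, (x, t) ∉ Z := by
  filter_upwards [measure_eq_zero_iff_ae_notMem.1 (volume_fst_image_eq_zero hZ)] with x hx t ht
  exact hx ⟨_, ht, rfl⟩

/-- Holds at every positive instant, not just almost every one, so that `∫ u ∂u/∂t` can be evaluated
at each time. -/
theorem ae_slice_mem_regularPoints (hZ : μH[(N : ℝ)] Z = 0) {t : ℝ} (ht : 0 < t) :
    ∀ᵐ x : Space N, x ∈ Ω → (x, t) ∈ regularPoints Ω F Z := by
  filter_upwards [ae_forall_notMem_exceptional hZ,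
    ae_all_iff.2 fun k => measure_eq_zero_iff_ae_notMem.1 ((F k).volume_slice t)] with x h1 h2 hx
  exact ⟨hx, ht, h1 t, h2⟩

theorem ae_mem_regularPoints (hZc : IsClosed Z) (hZ : μH[(N : ℝ)] Z = 0) :
    ∀ᵐ z : SpaceTime N, z.1 ∈ Ω → 0 < z.2 → z ∈ regularPoints Ω F Z := by
  have hm : MeasurableSet {z : SpaceTime N | z ∉ Z ∧ ∀ k, z ∉ (F k).carrier} := by
    have : {z : SpaceTime N | z ∉ Z ∧ ∀ k, z ∉ (F k).carrier}
        = Zᶜ ∩ ⋂ k, ((F k).carrier)ᶜ := by ext z; simp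
    rw [this]
    exact hZc.measurableSet.compl.inter
      (MeasurableSet.iInter fun k => (F k).measurableSet_carrier.compl)
  have : ∀ᵐ z : SpaceTime N, z ∉ Z ∧ ∀ k, z ∉ (F k).carrier := by
    refine (Measure.ae_prod_mem_iff_ae_ae_mem hm).2 ?_
    filter_upwards [ae_forall_notMem_exceptional hZ] with x hx
    filter_upwards [(countable_line_fronts (F := F) x).ae_notMem volume] with t ht
    exact ⟨hx t, fun k hk => ht ⟨k, hk⟩⟩
  filter_upwards [this] with z hz h1 h2
  exact ⟨h1, h2, hz⟩

theorem volume_exceptional (hZc : IsClosed Z) (hZ : μH[(N : ℝ)] Z = 0) : volume Z = 0 := by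
  rw [measure_eq_zero_iff_ae_notMem]
  refine (Measure.ae_prod_mem_iff_ae_ae_mem hZc.measurableSet.compl).2 ?_
  filter_upwards [ae_forall_notMem_exceptional hZ] with x hx
  exact ae_of_all _ hx

end Regular

/-! ### Regularity of a classical solution -/

namespace IsClassicalSolution

variable {ι : Type*} {N : ℕ} {c : ℝ} {Ω : Set (Space N)} {n : Space N → Space N}
  {F : ι → WaveFront N c} {Z : Set (SpaceTime N)} {G : SpaceTime N → ℝ} {u₀ v₀ : Space N → ℝ}
  {uS p : SpaceTime N → ℝ} {u : SpaceTime N → ℝ}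

theorem isOpen_setOf_contDiffAt (u : SpaceTime N → ℝ) : IsOpen {z | ContDiffAt ℝ 2 u z} :=
  isOpen_iff_mem_nhds.2 fun _ hz => ContDiffAt.eventually hz (by simp)

theorem exists_bound_u (hu : IsClassicalSolution c Ω n F Z G u₀ v₀ uS p u)
    (hΩ : Bornology.IsBounded Ω) (T : ℝ) :
    ∃ M, 0 ≤ M ∧ ∀ x ∈ closure Ω, ∀ t ∈ Icc 0 T, |u (x, t)| ≤ M := by
  have hK : IsCompact (closure Ω ×ˢ Icc (0 : ℝ) T) := hΩ.isCompact_closure.prod isCompact_Icc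
  obtain ⟨M, hM⟩ := hK.exists_bound_of_continuousOn
    (hu.continuousOn.mono (prod_mono le_rfl Icc_subset_Ici_self))
  exact ⟨max M 0, le_max_right _ _, fun x hx t ht => (hM (x, t) ⟨hx, ht⟩).trans (le_max_left _ _)⟩

theorem exists_bound_deriv (hu : IsClassicalSolution c Ω n F Z G u₀ v₀ uS p u) (T : ℝ) :
    ∃ M, 0 ≤ M ∧ ∀ z ∈ regularPoints Ω F Z, z.2 ≤ T → |timeDeriv u z| ≤ M ∧ ‖gradX u z‖ ≤ M := by
  obtain ⟨M, hM⟩ := hu.bounded_deriv T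
  exact ⟨max M 0, le_max_right _ _, fun z hz ht =>
    ⟨(hM z hz ht).1.trans (le_max_left _ _), (hM z hz ht).2.trans (le_max_left _ _)⟩⟩

theorem continuousOn_u (hu : IsClassicalSolution c Ω n F Z G u₀ v₀ uS p u) (T : ℝ) :
    ContinuousOn u (Ω ×ˢ Ioo 0 T) :=
  hu.continuousOn.mono (prod_mono subset_closure fun _ h => h.1.le)

theorem isFiniteMeasure (hΩ : Bornology.IsBounded Ω) (T : ℝ) :
    IsFiniteMeasure ((volume : Measure (SpaceTime N)).restrict (Ω ×ˢ Ioo 0 T)) :=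
  ⟨by
    rw [Measure.restrict_apply_univ]
    exact (hΩ.prod (Metric.isBounded_Ioo 0 T)).measure_lt_top⟩

theorem exists_bound_fluxField (hu : IsClassicalSolution c Ω n F Z G u₀ v₀ uS p u)
    (hΩ : Bornology.IsBounded Ω) (T : ℝ) :
    ∃ M, 0 ≤ M ∧ ∀ z ∈ regularPoints Ω F Z, z.2 ≤ T → ‖fluxField c u z‖ ≤ M := by
  obtain ⟨A, hA0, hA⟩ := hu.exists_bound_u hΩ T
  obtain ⟨B, hB0, hB⟩ := hu.exists_bound_deriv T
  refine ⟨max (A * B) ((c ^ 2)⁻¹ * A * B), le_max_of_le_left (by positivity), fun z hz ht => ?_⟩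
  have h1 := hA z.1 (subset_closure hz.1) z.2 ⟨hz.2.1.le, ht⟩
  obtain ⟨h2, h3⟩ := hB z hz ht
  rw [fluxField, Prod.norm_def]
  refine max_le_max ?_ ?_
  · rw [norm_smul, Real.norm_eq_abs]
    gcongr
  · rw [norm_neg, norm_mul, norm_mul, Real.norm_eq_abs, Real.norm_eq_abs, Real.norm_eq_abs,
      abs_of_nonneg (by positivity : (0 : ℝ) ≤ (c ^ 2)⁻¹)]
    gcongr

theorem integrableOn_mul_source (hu : IsClassicalSolution c Ω n F Z G u₀ v₀ uS p u)
    (hΩm : MeasurableSet Ω) (hΩ : Bornology.IsBounded Ω) {T : ℝ}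
    (hG : IntegrableOn G (Ω ×ˢ Ioo 0 T) volume) :
    IntegrableOn (fun z => u z * G z) (Ω ×ˢ Ioo 0 T) volume := by
  obtain ⟨A, hA0, hA⟩ := hu.exists_bound_u hΩ T
  refine hG.bdd_mul (c := A) ((hu.continuousOn_u T).aestronglyMeasurable (hΩm.prod measurableSet_Ioo)) ?_
  filter_upwards [ae_restrict_mem (hΩm.prod measurableSet_Ioo)] with z hz
  exact hA z.1 (subset_closure hz.1) z.2 ⟨hz.2.1.le, hz.2.2.le⟩

variable [Countable ι]

theorem ae_regular (hu : IsClassicalSolution c Ω n F Z G u₀ v₀ uS p u) (T : ℝ)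
    (hΩ : MeasurableSet Ω) :
    ∀ᵐ z ∂volume.restrict (Ω ×ˢ Ioo 0 T), z ∈ regularPoints Ω F Z := by
  filter_upwards [ae_restrict_of_ae (ae_mem_regularPoints (Ω := Ω) (F := F)
    hu.isClosed_exceptional hu.exceptional_null),
    ae_restrict_mem (hΩ.prod measurableSet_Ioo)] with z h1 h2
  exact h1 h2.1 h2.2.1

/-- A function continuous wherever `u` is `C²` is measurable. -/
theorem aestronglyMeasurable (hu : IsClassicalSolution c Ω n F Z G u₀ v₀ uS p u) (T : ℝ)
    (hΩ : MeasurableSet Ω) {X : Type*} [TopologicalSpace X] [TopologicalSpace.PseudoMetrizableSpace X]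
    [SecondCountableTopologyEither (SpaceTime N) X] {H : SpaceTime N → X}
    (hH : ∀ z, ContDiffAt ℝ 2 u z → ContinuousAt H z) :
    AEStronglyMeasurable H (volume.restrict (Ω ×ˢ Ioo 0 T)) := by
  have h1 : AEStronglyMeasurable H (volume.restrict {z | ContDiffAt ℝ 2 u z}) :=
    ContinuousOn.aestronglyMeasurable (fun z hz => (hH z hz).continuousWithinAt)
      (isOpen_setOf_contDiffAt u).measurableSet
  -- Up to a null set, the cylinder lies in the open set where `u` is `C²`.
  have h2 : volume.restrict (Ω ×ˢ Ioo 0 T)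
      = (volume.restrict {z | ContDiffAt ℝ 2 u z}).restrict (Ω ×ˢ Ioo 0 T) := by
    rw [Measure.restrict_restrict (hΩ.prod measurableSet_Ioo)]
    refine Measure.restrict_congr_set ?_
    have := (ae_restrict_iff' (hΩ.prod measurableSet_Ioo)).1 (hu.ae_regular T hΩ)
    filter_upwards [this] with z hz
    exact propext ⟨fun h => ⟨h, hu.contDiffAt z (hz h)⟩, fun h => h.1⟩
  rw [h2]
  exact h1.restrict

theorem integrableOn_lagrangian (hu : IsClassicalSolution c Ω n F Z G u₀ v₀ uS p u)
    (hΩm : MeasurableSet Ω) (hΩ : Bornology.IsBounded Ω) (T : ℝ) :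
    IntegrableOn (lagrangian c u) (Ω ×ˢ Ioo 0 T) volume := by
  have := isFiniteMeasure hΩ T
  obtain ⟨B, hB0, hB⟩ := hu.exists_bound_deriv T
  refine Integrable.of_bound (C := 1 / 2 * ((|c⁻¹| * B) ^ 2 + B ^ 2))
    (hu.aestronglyMeasurable T hΩm fun z hz => ?_) ?_
  · unfold lagrangian
    have h1 := (contDiffAt_timeDeriv hz).continuousAt
    have h2 := (contDiffAt_gradX hz).continuousAt
    fun_prop
  · filter_upwards [hu.ae_regular T hΩm, ae_restrict_mem (hΩm.prod measurableSet_Ioo)] with z h1 h2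
    obtain ⟨h3, h4⟩ := hB z h1 h2.2.2.le
    rw [lagrangian, norm_mul, Real.norm_eq_abs, Real.norm_eq_abs, abs_of_pos (by norm_num : (0:ℝ) < 1 / 2)]
    gcongr
    refine (abs_sub _ _).trans ?_
    rw [abs_of_nonneg (sq_nonneg _), abs_of_nonneg (sq_nonneg _), ← sq_abs (c⁻¹ * _), abs_mul]
    gcongr

/-- The flux field of a solution is a bounded field with integrable divergence. -/
theorem exists_isBoundedField (hu : IsClassicalSolution c Ω n F Z G u₀ v₀ uS p u)
    (hΩm : MeasurableSet Ω) (hΩ : Bornology.IsBounded Ω) {T : ℝ}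
    (hG : IntegrableOn G (Ω ×ˢ Ioo 0 T) volume) :
    ∃ M, IsBoundedField (volume.restrict (Ω ×ˢ Ioo 0 T)) (fluxField c u) (fluxDiv c u G) M := by
  obtain ⟨M, hM0, hM⟩ := hu.exists_bound_fluxField hΩ T
  refine ⟨M, isFiniteMeasure hΩ T,
    hu.aestronglyMeasurable T hΩm fun z hz => (contDiffAt_fluxField hz).continuousAt, ?_, hM0,
    (hu.integrableOn_mul_source hΩm hΩ hG).sub ((hu.integrableOn_lagrangian hΩm hΩ T).const_mul 2)⟩
  filter_upwards [hu.ae_regular T hΩm, ae_restrict_mem (hΩm.prod measurableSet_Ioo)] with z h1 h2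
  exact hM z h1 h2.2.2.le

end IsClassicalSolution

/-! ### The flux across the fronts -/

namespace IsClassicalSolution

variable {ι : Type*} {N : ℕ} {c : ℝ} {Ω : Set (Space N)} {n : Space N → Space N}
  {F : ι → WaveFront N c} {Z : Set (SpaceTime N)} {G : SpaceTime N → ℝ} {u₀ v₀ : Space N → ℝ}
  {uS p : SpaceTime N → ℝ} {u : SpaceTime N → ℝ}

theorem continuousAt_u (hu : IsClassicalSolution c Ω n F Z G u₀ v₀ uS p u) (hΩ : IsOpen Ω)
    {z : SpaceTime N} (h1 : z.1 ∈ Ω) (h2 : 0 < z.2) : ContinuousAt u z :=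
  hu.continuousOn.continuousAt <| mem_of_superset ((hΩ.prod isOpen_Ioi).mem_nhds ⟨h1, h2⟩)
    (prod_mono subset_closure Ioi_subset_Ici_self)

/-- The jump of the flux through every front vanishes. -/
theorem exists_tendsto_flux (hu : IsClassicalSolution c Ω n F Z G u₀ v₀ uS p u) (hc : 0 < c)
    (hΩ : IsOpen Ω) {k : ι} {z : SpaceTime N} (hz : z ∈ (F k).carrier) (hzΩ : z.1 ∈ Ω)
    (hz0 : 0 < z.2) (hzZ : z ∉ Z) :
    ∃ J : ℝ, ∀ side ∈ ({(F k).ahead, (F k).behind} : Set (Set (SpaceTime N))),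
      Tendsto (fun w => u w * (c⁻¹ * timeDeriv u w) * (c⁻¹ * timeDeriv (F k).eqn z)
          - u w * ⟪gradX u w, gradX (F k).eqn z⟫)
        (𝓝[side ∩ regularPoints Ω F Z] z) (𝓝 J) := by
  obtain ⟨aP, aM, gP, gM, haP, haM, hgP, hgM, hj⟩ := hu.hadamard k z hz hzΩ hz0 hzZ
  have hlim : ∀ {S : Set (SpaceTime N)} {a : ℝ} {g : Space N},
      Tendsto (timeDeriv u) (𝓝[S] z) (𝓝 a) → Tendsto (gradX u) (𝓝[S] z) (𝓝 g) →
      Tendsto (fun w => u w * (c⁻¹ * timeDeriv u w) * (c⁻¹ * timeDeriv (F k).eqn z)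
          - u w * ⟪gradX u w, gradX (F k).eqn z⟫) (𝓝[S] z)
        (𝓝 (u z * (c⁻¹ * a) * (c⁻¹ * timeDeriv (F k).eqn z)
          - u z * ⟪g, gradX (F k).eqn z⟫)) := by
    intro S a g ha hg
    have hut : Tendsto u (𝓝[S] z) (𝓝 (u z)) :=
      (hu.continuousAt_u hΩ hzΩ hz0).tendsto.mono_left nhdsWithin_le_nhds
    exact ((hut.mul (ha.const_mul _)).mul_const _).sub (hut.mul (hg.inner tendsto_const_nhds))
  -- Inserting `ν_t = -c ‖ν‖` makes the flux a multiple of `a + c ⟪m, g⟫`, with `m` the unit spatial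
  -- normal: exactly the combination that the Hadamard condition keeps continuous.
  have hval : ∀ (a : ℝ) (g : Space N), u z * (c⁻¹ * a) * (c⁻¹ * timeDeriv (F k).eqn z)
      - u z * ⟪g, gradX (F k).eqn z⟫
      = -(u z * ‖gradX (F k).eqn z‖ * c⁻¹ * (a + c * ⟪(F k).normal z, g⟫)) := by
    intro a g
    have hne : ‖gradX (F k).eqn z‖ ≠ 0 := norm_ne_zero_iff.2 ((F k).gradX_ne_zero hz)
    rw [(F k).characteristic z hz.1 hz.2, WaveFront.normal, real_inner_smul_left,
      real_inner_comm g]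
    field_simp
    ring
  refine ⟨u z * (c⁻¹ * aP) * (c⁻¹ * timeDeriv (F k).eqn z) - u z * ⟪gP, gradX (F k).eqn z⟫,
    fun side hside => ?_⟩
  rcases hside with rfl | rfl
  · exact hlim haP hgP
  · have := hlim haM hgM
    rwa [hval aM, ← sub_eq_zero.1 hj, ← hval] at this

/-- The normal component of the flux field has the same limit on both sides of a front. -/
theorem exists_tendsto_fderiv_fluxField (hu : IsClassicalSolution c Ω n F Z G u₀ v₀ uS p u)
    (hc : 0 < c) (hΩ : IsOpen Ω) (hΩb : Bornology.IsBounded Ω) {k : ι} {z : SpaceTime N}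
    (hz : z ∈ (F k).carrier) (hzΩ : z.1 ∈ Ω) (hz0 : 0 < z.2) (hzZ : z ∉ Z) :
    ∃ J : ℝ, ∀ side ∈ ({(F k).ahead, (F k).behind} : Set (Set (SpaceTime N))),
      Tendsto (fun w => fderiv ℝ (F k).eqn w (fluxField c u w))
        (𝓝[side ∩ regularPoints Ω F Z] z) (𝓝 J) := by
  obtain ⟨J, hJ⟩ := hu.exists_tendsto_flux hc hΩ hz hzΩ hz0 hzZ
  -- The flux of `exists_tendsto_flux` is minus the derivative of the front equation along `V`,
  -- frozen at `z`.
  refine ⟨-J, fun side hside => ?_⟩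
  obtain ⟨M, hM0, hM⟩ := hu.exists_bound_fluxField hΩb (z.2 + 1)
  have h1 := (hJ side hside).neg
  -- Freezing the coefficient at `z` costs nothing in the limit, since `V` is bounded and the
  -- derivative of the front equation is continuous.
  have h2 : Tendsto (fun w => (fderiv ℝ (F k).eqn w - fderiv ℝ (F k).eqn z) (fluxField c u w))
      (𝓝[side ∩ regularPoints Ω F Z] z) (𝓝 0) := by
    have h3 : Tendsto (fun w => ‖fderiv ℝ (F k).eqn w - fderiv ℝ (F k).eqn z‖ * M)
        (𝓝[side ∩ regularPoints Ω F Z] z) (𝓝 0) := by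
      have : Tendsto (fun w => ‖fderiv ℝ (F k).eqn w - fderiv ℝ (F k).eqn z‖ * M) (𝓝 z)
          (𝓝 (‖fderiv ℝ (F k).eqn z - fderiv ℝ (F k).eqn z‖ * M)) :=
        ((continuousAt_fderiv_of_contDiffAt ((F k).contDiffAt hz.1)).sub
          (continuousAt_const (y := fderiv ℝ (F k).eqn z))).norm.tendsto.mul_const M
      rw [sub_self, norm_zero, zero_mul] at this
      exact this.mono_left nhdsWithin_le_nhds
    refine squeeze_zero_norm' ?_ h3
    have hT : ∀ᶠ w : SpaceTime N in 𝓝 z, w.2 ≤ z.2 + 1 :=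
      continuous_snd.continuousAt.eventually (Iic_mem_nhds (by linarith))
    filter_upwards [self_mem_nhdsWithin, nhdsWithin_le_nhds hT] with w hw hwT
    exact (ContinuousLinearMap.le_opNorm _ _).trans (by gcongr; exact hM w hw.2 hwT)
  have h3 := h1.add h2
  rw [add_zero] at h3
  refine h3.congr fun w => ?_
  rw [sub_apply, fderiv_apply_eq ((F k).differentiableAt hz.1)]
  simp only [fluxField, real_inner_smul_right]
  rw [real_inner_comm (gradX u w)]
  ring

end IsClassicalSolution

/-- Approach to a point along a vertical line within a set that contains almost all points of
the line. -/
theorem tendsto_line_nhdsWithin {X : Type*} [TopologicalSpace X] {R S : Set (X × ℝ)} {x : X} {θ : ℝ}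
    {s : Set ℝ} (hR : ∀ᵐ t : ℝ, t ∈ s → (x, t) ∈ R) (hS : ∀ t ∈ s, (x, t) ∈ S) :
    Tendsto (fun t : ℝ => (x, t)) (𝓝[s] θ ⊓ ae volume) (𝓝[S ∩ R] (x, θ)) := by
  rw [tendsto_nhdsWithin_iff]
  refine ⟨?_, ?_⟩
  · exact ((Continuous.prodMk_right x).tendsto θ).mono_left (inf_le_left.trans nhdsWithin_le_nhds)
  · filter_upwards [mem_inf_of_left (self_mem_nhdsWithin (a := θ) (s := s)),
      mem_inf_of_right (f := 𝓝[s] θ) hR] with t h1 h2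
    exact ⟨hS t h1, h2 h1⟩

/-- A cylinder around a point of a front in which the front is the graph of a function on space. -/
theorem WaveFront.exists_cylinder {N : ℕ} {c : ℝ} (F : WaveFront N c) {z : SpaceTime N}
    (hz : z ∈ F.carrier) {W : Set (SpaceTime N)} (hW : W ∈ 𝓝 z) :
    ∃ δ > 0, ∃ a b : ℝ, z.2 ∈ Ioo a b ∧ Metric.ball z.1 δ ×ˢ Icc a b ⊆ W ∩ F.dom ∧
      (∀ w ∈ Metric.ball z.1 δ ×ˢ Icc a b, timeDeriv F.eqn w < 0) ∧
      ∀ x ∈ Metric.ball z.1 δ, 0 < F.eqn (x, a) ∧ F.eqn (x, b) < 0 := by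
  have h1 : ∀ᶠ w in 𝓝 z, w ∈ W ∩ F.dom ∧ timeDeriv F.eqn w < 0 :=
    (Filter.Eventually.and hW (F.isOpen_dom.mem_nhds hz.1)).and
      ((continuousAt_timeDeriv (F.contDiffAt hz.1)).eventually
        (Iio_mem_nhds (F.timeDeriv_neg z hz.1 hz.2)))
  obtain ⟨r, hr, hrW⟩ := Metric.eventually_nhds_iff_ball.1 h1
  have hbox : ∀ x ∈ Metric.ball z.1 r, ∀ t ∈ Icc (z.2 - r / 2) (z.2 + r / 2),
      (x, t) ∈ Metric.ball z r := by
    intro x hx t ht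
    rw [Metric.mem_ball, Prod.dist_eq, max_lt_iff]
    refine ⟨hx, ?_⟩
    simp only [Real.dist_eq, abs_lt]
    constructor <;> linarith [ht.1, ht.2]
  have hz1 : z.1 ∈ Metric.ball z.1 r := Metric.mem_ball_self hr
  -- On the central line the equation decreases through zero; its signs at the two ends persist for
  -- nearby `x`.
  have hanti : StrictAntiOn (fun t => F.eqn (z.1, t)) (Icc (z.2 - r / 2) (z.2 + r / 2)) := by
    refine strictAntiOn_of_deriv_neg (convex_Icc _ _) ?_ ?_
    · intro t ht
      have hd := F.differentiableAt (hrW _ (hbox z.1 hz1 t ht)).1.2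
      exact (hasDerivAt_time hd).continuousAt.continuousWithinAt
    · intro t ht
      exact (hrW _ (hbox z.1 hz1 t (interior_subset ht))).2
  have hm : z.2 ∈ Icc (z.2 - r / 2) (z.2 + r / 2) := ⟨by linarith, by linarith⟩
  have h0 : F.eqn (z.1, z.2) = 0 := hz.2
  have ha : 0 < F.eqn (z.1, z.2 - r / 2) := by
    rw [← h0]
    exact hanti ⟨le_rfl, by linarith⟩ hm (by linarith)
  have hb : F.eqn (z.1, z.2 + r / 2) < 0 := by
    rw [← h0]
    exact hanti hm ⟨by linarith, le_rfl⟩ (by linarith)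
  have hcont : ∀ t ∈ Icc (z.2 - r / 2) (z.2 + r / 2),
      ContinuousAt (fun x => F.eqn (x, t)) z.1 := fun t ht =>
    (hasFDerivAt_slice (z := (z.1, t))
      (F.differentiableAt (hrW _ (hbox z.1 hz1 t ht)).1.2)).continuousAt
  have h2 : ∀ᶠ x in 𝓝 z.1, 0 < F.eqn (x, z.2 - r / 2) ∧ F.eqn (x, z.2 + r / 2) < 0 :=
    ((hcont _ ⟨le_rfl, by linarith⟩).eventually (Ioi_mem_nhds ha)).and
      ((hcont _ ⟨by linarith, le_rfl⟩).eventually (Iio_mem_nhds hb))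
  obtain ⟨r', hr', hr'W⟩ := Metric.eventually_nhds_iff_ball.1 h2
  refine ⟨min r r', lt_min hr hr', z.2 - r / 2, z.2 + r / 2, ⟨by linarith, by linarith⟩, ?_, ?_, ?_⟩
  · rintro ⟨x, t⟩ ⟨hx, ht⟩
    exact (hrW _ (hbox x (Metric.ball_subset_ball (min_le_left _ _) hx) t ht)).1
  · rintro ⟨x, t⟩ ⟨hx, ht⟩
    exact (hrW _ (hbox x (Metric.ball_subset_ball (min_le_left _ _) hx) t ht)).2
  · intro x hx
    exact hr'W x (Metric.ball_subset_ball (min_le_right _ _) hx)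

/-- Integrals against the derivatives of cutoffs around a transversal zero with equal one-sided
limits of the integrand. -/
theorem tendsto_integral_mul_deriv_cutoff_two_sided {a b θ : ℝ} (hθ : θ ∈ Ioo a b) {r r' : ℝ → ℝ}
    (hr : ∀ τ ∈ Icc a b, HasDerivAt r (r' τ) τ) (hr' : ContinuousOn r' (Icc a b))
    (hneg : ∀ τ ∈ Icc a b, r' τ < 0) (h0 : r θ = 0) {F : ℝ → ℝ} {F₀ M : ℝ} (hM : 0 ≤ M)
    (hFm : AEStronglyMeasurable F (volume.restrict (Ioo a b)))
    (hFM : ∀ᵐ τ ∂volume.restrict (Ioo a b), |F τ| ≤ M)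
    (hFl : Tendsto F (𝓝[Ioo a θ] θ ⊓ ae volume) (𝓝 F₀))
    (hFr : Tendsto F (𝓝[Ioo θ b] θ ⊓ ae volume) (𝓝 F₀)) :
    (∀ n : ℕ, |∫ τ in Ioo a b, F τ * (deriv cutoff (n * r τ) * (n * r' τ))| ≤ 2 * M) ∧
    Tendsto (fun n : ℕ => ∫ τ in Ioo a b, F τ * (deriv cutoff (n * r τ) * (n * r' τ))) atTop
      (𝓝 0) := by
  have hanti : StrictAntiOn r (Icc a b) :=
    strictAntiOn_of_deriv_neg (convex_Icc _ _)
      (fun τ hτ => (hr τ hτ).continuousAt.continuousWithinAt)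
      fun τ hτ => by rw [(hr τ (interior_subset hτ)).deriv]; exact hneg τ (interior_subset hτ)
  have hθ' := Ioo_subset_Icc_self hθ
  have hl : Icc a θ ⊆ Icc a b := Icc_subset_Icc_right hθ.2.le
  have hrr : Icc θ b ⊆ Icc a b := Icc_subset_Icc_left hθ.1.le
  have hl' : Ioo a θ ⊆ Ioo a b := Ioo_subset_Ioo_right hθ.2.le
  have hr'' : Ioo θ b ⊆ Ioo a b := Ioo_subset_Ioo_left hθ.1.le
  -- To the left of `θ` the cutoff falls from one to zero, giving mass `-1`; to the right it rises
  -- back, giving `+1`. Equal one-sided limits of `F` cancel.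
  obtain ⟨i1, b1, l1⟩ := integral_mul_deriv_cutoff (θ := θ) (L := -1) hθ.1
    (fun τ hτ => hr τ (hl hτ)) (hr'.mono hl) (Or.inr ⟨rfl, rfl⟩) h0
    (fun τ hτ hne => by
      have := hanti (hl hτ) hθ' (lt_of_le_of_ne hτ.2 hne)
      rw [h0] at this; exact this.ne')
    (Or.inr fun τ hτ => by
      have := hanti.antitoneOn (hl hτ) hθ' hτ.2
      rw [h0] at this
      exact mul_nonpos_of_nonneg_of_nonpos this (hneg τ (hl hτ)).le) hM
    (hFm.mono_set hl') (ae_restrict_of_ae_restrict_of_subset hl' hFM) hFl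
  obtain ⟨i2, b2, l2⟩ := integral_mul_deriv_cutoff (θ := θ) (L := 1) hθ.2
    (fun τ hτ => hr τ (hrr hτ)) (hr'.mono hrr) (Or.inl ⟨rfl, rfl⟩) h0
    (fun τ hτ hne => by
      have := hanti hθ' (hrr hτ) (lt_of_le_of_ne hτ.1 hne.symm)
      rw [h0] at this; exact this.ne)
    (Or.inl fun τ hτ => by
      have := hanti.antitoneOn hθ' (hrr hτ) hτ.1
      rw [h0] at this
      exact mul_nonneg_of_nonpos_of_nonpos this (hneg τ (hrr hτ)).le) hM
    (hFm.mono_set hr'') (ae_restrict_of_ae_restrict_of_subset hr'' hFM) hFr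
  have hsplit : ∀ n : ℕ, ∫ τ in Ioo a b, F τ * (deriv cutoff (n * r τ) * (n * r' τ))
      = (∫ τ in Ioo a θ, F τ * (deriv cutoff (n * r τ) * (n * r' τ)))
        + ∫ τ in Ioo θ b, F τ * (deriv cutoff (n * r τ) * (n * r' τ)) := by
    intro n
    simp_rw [← integral_Ioc_eq_integral_Ioo]
    rw [← Ioc_union_Ioc_eq_Ioc hθ.1.le hθ.2.le]
    exact setIntegral_union (Ioc_disjoint_Ioc_of_le le_rfl) measurableSet_Ioc
      (integrableOn_Ioc_iff_integrableOn_Ioo enorm_ne_top |>.2 (i1 n))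
      (integrableOn_Ioc_iff_integrableOn_Ioo enorm_ne_top |>.2 (i2 n))
  constructor
  · intro n
    rw [hsplit n]
    refine (abs_add_le _ _).trans ?_
    linarith [b1 n, b2 n]
  · simp_rw [hsplit]
    simpa using l1.add l2

/-! ### The interior identity -/

theorem hasFDerivAt_cutoff_comp {E : Type*} [NormedAddCommGroup E] [NormedSpace ℝ E] {g : E → ℝ}
    {z : E} (m : ℝ) (h : DifferentiableAt ℝ g z) (v : E) :
    fderiv ℝ (fun w => cutoff (m * g w)) z v
      = deriv cutoff (m * g z) * (m * fderiv ℝ g z v) := by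
  have h1 : HasFDerivAt (fun w => m * g w) (m • fderiv ℝ g z) z := h.hasFDerivAt.const_mul m
  have h2 : HasFDerivAt (fun w => cutoff (m * g w)) _ z :=
    (cutoff_differentiable _).hasDerivAt.comp_hasFDerivAt z h1
  rw [h2.fderiv]
  simp

namespace IsClassicalSolution

variable {ι : Type*} [Countable ι] {N : ℕ} {c : ℝ} {Ω : Set (Space N)} {n : Space N → Space N}
  {F : ι → WaveFront N c} {Z : Set (SpaceTime N)} {G : SpaceTime N → ℝ} {u₀ v₀ : Space N → ℝ}
  {uS p : SpaceTime N → ℝ} {u : SpaceTime N → ℝ}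

/-- Near a point of a front off the exceptional set, the flux functional vanishes if it vanishes
near all points off this front. -/
theorem weakFlux_eq_zero_near_front (hu : IsClassicalSolution c Ω n F Z G u₀ v₀ uS p u)
    (hc : 0 < c) (hΩ : IsOpen Ω) (hΩb : Bornology.IsBounded Ω) {T : ℝ}
    (hG : IntegrableOn G (Ω ×ˢ Ioo 0 T) volume) {k : ι} {z : SpaceTime N}
    (hz : z ∈ (F k).carrier) {W : Set (SpaceTime N)} (hW : W ∈ 𝓝 z)
    (hWQ : W ⊆ (Ω ×ˢ Ioo 0 T) \ Z)
    (h0 : ∀ φ, IsTest ((W ∩ (F k).dom) \ (F k).carrier) φ →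
      weakFlux (volume.restrict (Ω ×ˢ Ioo 0 T)) (fluxField c u) (fluxDiv c u G) φ = 0) :
    ∃ W' ∈ 𝓝 z, ∀ φ, IsTest W' φ →
      weakFlux (volume.restrict (Ω ×ˢ Ioo 0 T)) (fluxField c u) (fluxDiv c u G) φ = 0 := by
  obtain ⟨δ, hδ, a, b, hab, hbW, hneg, hends⟩ := (F k).exists_cylinder hz hW
  obtain ⟨M, hfield⟩ := hu.exists_isBoundedField hΩ.measurableSet hΩb hG
  obtain ⟨M', hM'0, hM'⟩ := hu.exists_bound_fluxField hΩb T
  set ρ := (F k).eqn with hρ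
  set B := Metric.ball z.1 δ
  have hBm : MeasurableSet B := Metric.isOpen_ball.measurableSet
  set D := B ×ˢ Ioo a b with hD
  have hDc : D ⊆ B ×ˢ Icc a b := prod_mono le_rfl Ioo_subset_Icc_self
  have hDQ : D ⊆ Ω ×ˢ Ioo 0 T := fun w hw => (hWQ (hbW (hDc hw)).1).1
  have hρd : ∀ w ∈ B ×ˢ Icc a b, ContDiffAt ℝ 1 ρ w := fun w hw =>
    (F k).contDiffAt (hbW hw).2
  refine ⟨D, (Metric.isOpen_ball.prod isOpen_Ioo).mem_nhds ⟨Metric.mem_ball_self hδ, hab⟩,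
    fun φ hφ => ?_⟩
  have hχ : ∀ (m : ℕ), ∀ w ∈ tsupport φ, ContDiffAt ℝ 1 (fun w => cutoff (m * ρ w)) w :=
    fun m w hw => (cutoff_contDiff.of_le (by norm_num)).contDiffAt.comp w
      (contDiffAt_const.mul (hρd w (hDc (hφ.3 hw))))
  -- the limit of the fluxes through the cutoffs
  have hlim := tendsto_integral_mul_fderiv_cutoff hfield hφ (χ := fun (m : ℕ) w => cutoff (m * ρ w))
    hχ (fun m w => by rw [abs_of_nonneg (cutoff_nonneg _)]; exact cutoff_le_one _)
    (by
      filter_upwards [hu.ae_regular T hΩ.measurableSet] with w hw hws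
      refine tendsto_cutoff_nat_mul fun h => hw.2.2.2 k ⟨(hbW (hDc (hφ.3 hws))).2, h⟩)
    (by
      intro m
      have ht := hφ.mul_of_contDiffAt (hχ m)
      refine h0 _ ⟨ht.1, ht.2, fun w hw => ?_⟩
      have hwφ := tsupport_mul_subset_right hw
      refine ⟨hbW (hDc (hφ.3 hwφ)), fun hwc => ?_⟩
      refine notMem_tsupport_iff_eventuallyEq.2 ?_ hw
      -- The cutoff vanishes on a full neighbourhood of the front, which keeps the support of the
      -- product away from it.
      have h1 : ∀ᶠ y in 𝓝 w, |(m : ℝ) * ρ y| < 1 := by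
        have hcont : ContinuousAt (fun y => |(m : ℝ) * ρ y|) w :=
          (continuousAt_const.mul (hρd w (hDc (hφ.3 hwφ))).continuousAt).abs
        refine hcont.eventually_lt continuousAt_const ?_
        simp [hρ, hwc.2]
      filter_upwards [h1] with y hy
      simp [cutoff_eq_zero hy.le])
  -- the integrand along vertical lines
  let H : SpaceTime N → ℝ := fun w => φ w * (fderiv ℝ ρ w (fluxField c u w)) / timeDeriv ρ w
  -- Dividing by the time derivative of `ρ` exposes the factor that integrates exactly along
  -- vertical lines.
  have hHk : ∀ (m : ℕ), ∀ w ∈ D, φ w * fderiv ℝ (fun w => cutoff (m * ρ w)) w (fluxField c u w)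
      = H w * (deriv cutoff (m * ρ w) * (m * timeDeriv ρ w)) := by
    intro m w hw
    have h1 := (hneg w (hDc hw)).ne
    rw [hasFDerivAt_cutoff_comp _ ((hρd w (hDc hw)).differentiableAt (by norm_num))]
    simp only [H]
    field_simp
  have hint : ∀ m : ℕ, ∫ w in Ω ×ˢ Ioo 0 T, φ w * fderiv ℝ (fun w => cutoff (m * ρ w)) w
      (fluxField c u w) = ∫ w, H w * (deriv cutoff (m * ρ w) * (m * timeDeriv ρ w))
        ∂((volume.restrict B).prod (volume.restrict (Ioo a b))) := by
    intro m
    rw [Measure.prod_restrict, ← Measure.volume_eq_prod,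
      ← setIntegral_congr_fun (hBm.prod measurableSet_Ioo) (hHk m)]
    refine (setIntegral_eq_of_subset_of_forall_sdiff_eq_zero
      (hΩ.measurableSet.prod measurableSet_Ioo) hDQ fun w hw => ?_)
    rw [image_eq_zero_of_notMem_tsupport fun h => hw.2 (hφ.3 h), zero_mul]
  simp_rw [hint] at hlim
  have hcompact : IsCompact (tsupport φ) := hφ.2.isCompact
  -- The obliqueness of the front to vertical lines is bounded on the compact support of `φ`.
  obtain ⟨C, hC0, hC⟩ : ∃ C, 0 ≤ C ∧ ∀ w ∈ tsupport φ, ‖fderiv ℝ ρ w‖ / |timeDeriv ρ w| ≤ C := by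
    obtain ⟨C, hC⟩ := hcompact.exists_bound_of_continuousOn
      (f := fun w => ‖fderiv ℝ ρ w‖ / |timeDeriv ρ w|) (fun w hw => by
        have hwD := hDc (hφ.3 hw)
        exact ((continuousAt_fderiv_of_contDiffAt (hρd w hwD)).norm.div
          (continuousAt_timeDeriv (hρd w hwD)).abs
          (abs_ne_zero.2 (hneg w hwD).ne)).continuousWithinAt)
    exact ⟨max C 0, le_max_right _ _, fun w hw =>
      (le_abs_self _).trans ((hC w hw).trans (le_max_left _ _))⟩
  obtain ⟨A, hA0, hA⟩ := hφ.exists_bound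
  have hHb : ∀ w ∈ D, w ∈ regularPoints Ω F Z → |H w| ≤ A * (C * M') := by
    intro w hwD hwR
    by_cases hws : w ∈ tsupport φ
    · simp only [H]
      rw [mul_div_assoc, abs_mul, abs_div]
      have h1 : |fderiv ℝ ρ w (fluxField c u w)| ≤ ‖fderiv ℝ ρ w‖ * M' :=
        ((fderiv ℝ ρ w).le_opNorm _).trans (by gcongr; exact hM' w hwR (hDQ hwD).2.2.le)
      have h2 : |fderiv ℝ ρ w (fluxField c u w)| / |timeDeriv ρ w| ≤ C * M' :=
        calc _ ≤ ‖fderiv ℝ ρ w‖ * M' / |timeDeriv ρ w| := by gcongr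
          _ = ‖fderiv ℝ ρ w‖ / |timeDeriv ρ w| * M' := by ring
          _ ≤ _ := by gcongr; exact hC w hws
      gcongr
      exact (hA w).1
    · simp only [H]
      rw [image_eq_zero_of_notMem_tsupport hws]
      simp only [zero_mul, zero_div, abs_zero]
      positivity
  have hHm : AEStronglyMeasurable H ((volume.restrict B).prod (volume.restrict (Ioo a b))) := by
    rw [Measure.prod_restrict, ← Measure.volume_eq_prod]
    have h1 : AEStronglyMeasurable (fun w => fluxField c u w) (volume.restrict D) :=
      hfield.measurable.mono_set hDQ
    have hDm : MeasurableSet D := hBm.prod measurableSet_Ioo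
    have h2 : AEStronglyMeasurable (fderiv ℝ ρ) (volume.restrict D) :=
      ContinuousOn.aestronglyMeasurable (fun w hw =>
        (continuousAt_fderiv_of_contDiffAt (hρd w (hDc hw))).continuousWithinAt) hDm
    have h3 : AEStronglyMeasurable (timeDeriv ρ) (volume.restrict D) :=
      ContinuousOn.aestronglyMeasurable (fun w hw =>
        (continuousAt_timeDeriv (hρd w (hDc hw))).continuousWithinAt) hDm
    have h4 : AEStronglyMeasurable (fun w => fderiv ℝ ρ w (fluxField c u w)) (volume.restrict D) :=
      (continuous_fst.clm_apply continuous_snd).comp_aestronglyMeasurable (h2.prodMk h1)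
    exact ((hφ.1.continuous.aestronglyMeasurable.mul h4).aemeasurable.div
      h3.aemeasurable).aestronglyMeasurable
  have hfib : ∀ᵐ x ∂volume.restrict B,
      (∀ m : ℕ, |∫ t in Ioo a b, H (x, t) * (deriv cutoff (m * ρ (x, t)) *
        (m * timeDeriv ρ (x, t)))| ≤ 2 * (A * (C * M'))) ∧
      Tendsto (fun m : ℕ => ∫ t in Ioo a b, H (x, t) * (deriv cutoff (m * ρ (x, t)) *
        (m * timeDeriv ρ (x, t)))) atTop (𝓝 0) := by
    filter_upwards [hHm.prodMk_left, ae_restrict_mem hBm, ae_restrict_of_ae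
      (Measure.ae_ae_of_ae_prod (ae_mem_regularPoints (Ω := Ω) (F := F)
        hu.isClosed_exceptional hu.exceptional_null))] with x hx hxB hxR
    have hIcc : ∀ t ∈ Icc a b, (x, t) ∈ B ×ˢ Icc a b := fun t ht => ⟨hxB, ht⟩
    have hd : ∀ t ∈ Icc a b, HasDerivAt (fun t => ρ (x, t)) (timeDeriv ρ (x, t)) t := fun t ht => by
      have h1 := (hρd _ (hIcc t ht)).differentiableAt (by norm_num)
      rw [timeDeriv_eq h1]
      exact hasDerivAt_time h1
    have hdc : ContinuousOn (fun t => timeDeriv ρ (x, t)) (Icc a b) := fun t ht =>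
      ContinuousAt.continuousWithinAt <| ContinuousAt.comp
        (f := fun t => (x, t)) (continuousAt_timeDeriv (hρd _ (hIcc t ht)))
        (Continuous.prodMk_right x).continuousAt
    have hρc : ContinuousOn (fun t => ρ (x, t)) (Icc a b) := fun t ht =>
      (hd t ht).continuousAt.continuousWithinAt
    have hab' : a < b := hab.1.trans hab.2
    -- The vertical line over `x` crosses the front at `θ`, and only there by strict monotonicity.
    obtain ⟨θ, hθ, hθ0⟩ : (0 : ℝ) ∈ (fun t => ρ (x, t)) '' Ioo a b :=
      intermediate_value_Ioo' hab'.le hρc ⟨(hends x hxB).2, (hends x hxB).1⟩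
    have hanti : StrictAntiOn (fun t => ρ (x, t)) (Icc a b) :=
      strictAntiOn_of_deriv_neg (convex_Icc _ _) hρc fun t ht => by
        rw [(hd t (interior_subset ht)).deriv]
        exact hneg _ (hIcc t (interior_subset ht))
    have hθI := Ioo_subset_Icc_self hθ
    have hmem : (x, θ) ∈ (F k).carrier := ⟨(hbW (hIcc θ hθI)).2, hθ0⟩
    have hQθ := hWQ (hbW (hIcc θ hθI)).1
    obtain ⟨J, hJ⟩ := hu.exists_tendsto_fderiv_fluxField hc hΩ hΩb hmem hQθ.1.1 hQθ.1.2.1 hQθ.2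
    have hR : ∀ᵐ t : ℝ, t ∈ Ioo a b → (x, t) ∈ regularPoints Ω F Z := by
      filter_upwards [hxR] with t ht htI
      have := hDQ (show (x, t) ∈ D from ⟨hxB, htI⟩)
      exact ht this.1 this.2.1
    have hHlim : ∀ {s : Set ℝ} {side : Set (SpaceTime N)}, s ⊆ Ioo a b →
        side ∈ ({(F k).ahead, (F k).behind} : Set (Set (SpaceTime N))) →
        (∀ t ∈ s, (x, t) ∈ side) →
        Tendsto (fun t => H (x, t)) (𝓝[s] θ ⊓ ae volume)
          (𝓝 (φ (x, θ) * J / timeDeriv ρ (x, θ))) := by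
      intro s side hs hside hss
      have hline := tendsto_line_nhdsWithin (θ := θ) (R := regularPoints Ω F Z) (S := side)
        (hR.mono fun t ht hts => ht (hs hts)) hss
      have hnn := hline.mono_right nhdsWithin_le_nhds
      refine Tendsto.div ?_ ((continuousAt_timeDeriv (hρd _ (hIcc θ hθI))).tendsto.comp hnn)
        (hneg _ (hIcc θ hθI)).ne
      exact (hφ.1.continuous.continuousAt.tendsto.comp hnn).mul ((hJ side hside).comp hline)
    refine tendsto_integral_mul_deriv_cutoff_two_sided hθ hd hdc
      (fun t ht => hneg _ (hIcc t ht)) hθ0 (by positivity) hx ?_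
      (hHlim (Ioo_subset_Ioo_right hθ.2.le) (Or.inl rfl) fun t ht =>
        ⟨(hbW (hIcc t ⟨ht.1.le, (ht.2.trans hθ.2).le⟩)).2, ?_⟩)
      (hHlim (Ioo_subset_Ioo_left hθ.1.le) (Or.inr rfl) fun t ht =>
        ⟨(hbW (hIcc t ⟨(hθ.1.trans ht.1).le, ht.2.le⟩)).2, ?_⟩)
    · filter_upwards [ae_restrict_mem measurableSet_Ioo, ae_restrict_of_ae hR] with t htI htR
      exact hHb _ ⟨hxB, htI⟩ (htR htI)
    · have := hanti ⟨ht.1.le, (ht.2.trans hθ.2).le⟩ hθI ht.2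
      rw [hθ0] at this
      exact this
    · have := hanti hθI ⟨(hθ.1.trans ht.1).le, ht.2.le⟩ ht.1
      rw [hθ0] at this
      exact this
  have hfin : IsFiniteMeasure ((volume : Measure (Space N)).restrict B) :=
    ⟨by rw [Measure.restrict_apply_univ]; exact Metric.isBounded_ball.measure_lt_top⟩
  have hlim0 := tendsto_integral_prod_of_fiberwise
    (h := fun m w => H w * (deriv cutoff (m * ρ w) * (m * timeDeriv ρ w)))
    (ν := volume.restrict B) (μ := volume.restrict (Ioo a b)) (g := fun _ => 0)
    (bound := fun _ => 2 * (A * (C * M'))) (fun m => ?_) (integrable_const _)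
    (fun m => hfib.mono fun x hx => hx.1 m) (hfib.mono fun x hx => hx.2)
  · have := tendsto_nhds_unique hlim hlim0
    simpa using this
  · have h1 := (weakFlux_mul hfield hφ (hχ m)).1
    rw [Measure.prod_restrict, ← Measure.volume_eq_prod]
    exact IntegrableOn.congr_fun (IntegrableOn.mono_set h1 hDQ) (hHk m)
      (hBm.prod measurableSet_Ioo)

end IsClassicalSolution

/-! ### Countably many, possibly accumulating fronts -/

/-- In a nonempty locally closed set covered by countably many sets, one of them is dense in
some nonempty relatively open part (Baire). -/
theorem exists_mem_subset_closure_of_subset_iUnion {X ι : Type*} [TopologicalSpace X] [T2Space X]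
    [LocallyCompactSpace X] [Countable ι] {C : Set X} (hC : IsLocallyClosed C) (hne : C.Nonempty)
    {A : ι → Set X} (hA : C ⊆ ⋃ k, A k) :
    ∃ k, ∃ W, IsOpen W ∧ (C ∩ W ∩ A k).Nonempty ∧ C ∩ W ⊆ closure (A k) := by
  -- Local compactness makes the locally closed set a Baire space in its own right.
  have : LocallyCompactSpace C := hC.locallyCompactSpace
  have : Nonempty C := hne.to_subtype
  obtain ⟨k, y, hy⟩ := nonempty_interior_of_iUnion_of_closed
    (f := fun k => closure ((Subtype.val : C → X) ⁻¹' A k)) (fun k => isClosed_closure) (by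
      refine eq_univ_of_forall fun x => ?_
      obtain ⟨k, hk⟩ := mem_iUnion.1 (hA x.2)
      exact mem_iUnion.2 ⟨k, subset_closure hk⟩)
  obtain ⟨W, hW, hWi⟩ := isOpen_induced_iff.1
    (isOpen_interior (s := closure ((Subtype.val : C → X) ⁻¹' A k)))
  refine ⟨k, W, hW, ?_, fun x hx => ?_⟩
  · have hyW : y ∈ (Subtype.val : C → X) ⁻¹' W := by rw [hWi]; exact hy
    obtain ⟨w, hw1, hw2⟩ := mem_closure_iff.1 (interior_subset hy) _
      (hW.preimage continuous_subtype_val) hyW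
    exact ⟨w, ⟨w.2, hw1⟩, hw2⟩
  · have hxW : (⟨x, hx.1⟩ : C) ∈ (Subtype.val : C → X) ⁻¹' W := hx.2
    rw [hWi] at hxW
    have := interior_subset hxW
    rw [closure_subtype] at this
    exact closure_mono (image_preimage_subset _ _) this

/-- By continuity of its equation, a front is relatively closed in its domain. -/
theorem WaveFront.mem_carrier_of_mem_closure {N : ℕ} {c : ℝ} (F : WaveFront N c) {z : SpaceTime N}
    (hz : z ∈ F.dom) (hzc : z ∈ closure F.carrier) : z ∈ F.carrier := by
  refine ⟨hz, ?_⟩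
  by_contra hne
  have : ∀ᶠ w in 𝓝 z, F.eqn w ≠ 0 := (F.contDiffAt hz).continuousAt.eventually_ne hne
  obtain ⟨w, hw, hw'⟩ := mem_closure_iff_nhds.1 hzc _ this
  exact hw hw'.2

namespace IsClassicalSolution

variable {ι : Type*} [Countable ι] {N : ℕ} {c : ℝ} {Ω : Set (Space N)} {n : Space N → Space N}
  {F : ι → WaveFront N c} {Z : Set (SpaceTime N)} {G : SpaceTime N → ℝ} {u₀ v₀ : Space N → ℝ}
  {uS p : SpaceTime N → ℝ} {u : SpaceTime N → ℝ}

/-- The flux functional vanishes on test functions supported off the exceptional set. -/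
theorem weakFlux_eq_zero_off_exceptional (hu : IsClassicalSolution c Ω n F Z G u₀ v₀ uS p u)
    (hc : 0 < c) (hΩ : IsOpen Ω) (hΩb : Bornology.IsBounded Ω) {T : ℝ}
    (hG : IntegrableOn G (Ω ×ˢ Ioo 0 T) volume) {φ : SpaceTime N → ℝ}
    (hφ : IsTest ((Ω ×ˢ Ioo 0 T) \ Z) φ) :
    weakFlux (volume.restrict (Ω ×ˢ Ioo 0 T)) (fluxField c u) (fluxDiv c u G) φ = 0 := by
  obtain ⟨M, hfield⟩ := hu.exists_isBoundedField hΩ.measurableSet hΩb hG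
  set Q := Ω ×ˢ Ioo 0 T with hQ
  have hQo : IsOpen Q := hΩ.prod isOpen_Ioo
  have hUo : IsOpen (Q \ Z) := hQo.sdiff hu.isClosed_exceptional
  set Λ := weakFlux (volume.restrict Q) (fluxField c u) (fluxDiv c u G)
  -- The points near which the flux functional vanishes. The aim is that no point of `Q \ Z` lies
  -- outside `P`.
  let P : Set (SpaceTime N) := {z | ∃ W, IsOpen W ∧ z ∈ W ∧
    ∀ φ, IsTest (Q \ Z) φ → tsupport φ ⊆ W → Λ φ = 0}
  have hPo : IsOpen P := by
    refine isOpen_iff_mem_nhds.2 fun z hz => ?_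
    obtain ⟨W, hW, hzW, h⟩ := hz
    exact mem_of_superset (hW.mem_nhds hzW) fun w hw => ⟨W, hW, hw, h⟩
  have hlocal : ∀ {S : Set (SpaceTime N)}, S ⊆ (Q \ Z) ∩ P → ∀ φ, IsTest S φ → Λ φ = 0 := by
    intro S hS φ hφ
    refine eq_zero_of_locally (fun _ _ h1 h2 => weakFlux_add hfield h1 h2) (fun z hz => ?_) hφ
    obtain ⟨W, hW, hzW, h⟩ := (hS hz).2
    exact ⟨W, hW.mem_nhds hzW, fun ψ hψ hψW => h ψ (hψ.mono fun w hw => (hS hw).1) hψW⟩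
  refine hlocal (fun z hz => ⟨hz, ?_⟩) φ hφ
  by_contra hzP
  -- regular points are harmless
  have hreg : ∀ w ∈ Q \ Z, w ∉ P → ∃ k, w ∈ (F k).carrier := by
    intro w hw hwP
    by_contra! hk
    apply hwP
    have hwR : w ∈ regularPoints Ω F Z := ⟨hw.1.1, hw.1.2.1, hw.2, hk⟩
    refine ⟨{z | ContDiffAt ℝ 2 u z} ∩ Q, (isOpen_setOf_contDiffAt u).inter hQo,
      ⟨hu.contDiffAt w hwR, hw.1⟩, fun ψ hψ hψW => ?_⟩
    refine weakFlux_eq_zero_of_contDiffAt hQo.measurableSet inter_subset_right (fun z hz => hz.1) ?_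
      ⟨hψ.1, hψ.2, hψW⟩
    have := (ae_restrict_iff' hQo.measurableSet).1 (hu.ae_regular T hΩ.measurableSet)
    filter_upwards [this] with y hy hyW
    exact hu.wave_eq y (hy hyW.2)
  have hC : IsLocallyClosed ((Q \ Z) \ P) := hUo.isLocallyClosed.inter hPo.isClosed_compl.isLocallyClosed
  -- Bad points lie on fronts, so Baire yields one front that is dense among the bad points in some
  -- open `W`.
  obtain ⟨k, W, hW, ⟨y, ⟨hyC, hyW⟩, hyk⟩, hsub⟩ := exists_mem_subset_closure_of_subset_iUnion hC
    ⟨z, hz, hzP⟩ (A := fun k => (F k).carrier) fun w hw => mem_iUnion.2 (hreg w hw.1 hw.2)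
  -- A bad point in `W` and in the domain of this front is in its closure, hence on it. Off this
  -- front everything nearby is therefore good, and the one-front argument makes `y` good too, a
  -- contradiction.
  obtain ⟨W', hW', hWz⟩ := hu.weakFlux_eq_zero_near_front hc hΩ hΩb hG hyk
    ((hW.inter hUo).mem_nhds ⟨hyW, hyC.1⟩) inter_subset_right (hlocal fun w hw => by
      refine ⟨hw.1.1.2, ?_⟩
      by_contra hwP
      exact hw.2 ((F k).mem_carrier_of_mem_closure hw.1.2 (hsub ⟨⟨hw.1.1.2, hwP⟩, hw.1.1.1⟩)))
  obtain ⟨W'', hW'', hW''o, hyW''⟩ := mem_nhds_iff.1 hW'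
  exact hyC.2 ⟨W'', hW''o, hyW'', fun ψ hψ hψW => hWz ψ ⟨hψ.1, hψ.2, hψW.trans hW''⟩⟩

/-- The flux functional vanishes on test functions supported in the interior. -/
theorem weakFlux_eq_zero_interior (hu : IsClassicalSolution c Ω n F Z G u₀ v₀ uS p u)
    (hc : 0 < c) (hΩ : IsOpen Ω) (hΩb : Bornology.IsBounded Ω) {T : ℝ}
    (hG : IntegrableOn G (Ω ×ˢ Ioo 0 T) volume) {φ : SpaceTime N → ℝ}
    (hφ : IsTest (Ω ×ˢ Ioo 0 T) φ) :
    weakFlux (volume.restrict (Ω ×ˢ Ioo 0 T)) (fluxField c u) (fluxDiv c u G) φ = 0 := by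
  obtain ⟨M, hfield⟩ := hu.exists_isBoundedField hΩ.measurableSet hΩb hG
  refine weakFlux_eq_zero_of_removable (ν := volume) (d := N) Measure.restrict_le_self hfield ?_
    hu.isClosed_exceptional hu.exceptional_null ?_
    (fun ψ hψ => hu.weakFlux_eq_zero_off_exceptional hc hΩ hΩb hG hψ) hφ
  · simp
  · exact Measure.absolutelyContinuous_of_le Measure.restrict_le_self
      (volume_exceptional hu.isClosed_exceptional hu.exceptional_null)

end IsClassicalSolution

/-! ### Boundary charts -/

section Defining

variable {E : Type*} [NormedAddCommGroup E] [NormedSpace ℝ E] {ρ : E → ℝ} {x v : E} {Ω : Set E}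

theorem eventually_neg_of_fderiv_neg (h : DifferentiableAt ℝ ρ x) (h0 : ρ x = 0)
    (hv : fderiv ℝ ρ x v < 0) : ∀ᶠ t : ℝ in 𝓝[>] 0, ρ (x + t • v) < 0 := by
  have h1 : HasDerivAt (fun t : ℝ => ρ (x + t • v)) (fderiv ℝ ρ x v) 0 := by
    apply hasDerivAt_comp_add_smul
    simpa using h.hasFDerivAt
  have h2 := (hasDerivAt_iff_tendsto_slope_zero.1 h1).mono_left
    (nhdsWithin_mono (0 : ℝ) (fun t (ht : 0 < t) => ht.ne'))
  filter_upwards [h2.eventually (Iio_mem_nhds hv), self_mem_nhdsWithin] with t ht ht0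
  have ht0' : 0 < t := ht0
  have ht' : t⁻¹ * ρ (x + t • v) < 0 := by simpa [h0] using ht
  by_contra! hcon
  exact absurd ht' (not_lt.2 (by positivity))

/-- At a zero of `ρ` with nonzero derivative, a direction of descent leads into `Ω`, so the zero is
adherent to `Ω`. -/
theorem mem_frontier_iff_of_defining (hΩ : IsOpen Ω) (h : DifferentiableAt ℝ ρ x)
    (hne : fderiv ℝ ρ x ≠ 0) (hdef : ∀ᶠ y in 𝓝 x, (y ∈ Ω ↔ ρ y < 0)) :
    x ∈ frontier Ω ↔ ρ x = 0 := by
  rw [hΩ.frontier_eq]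
  constructor
  · rintro ⟨hc, hn⟩
    refine le_antisymm ?_ (not_lt.1 fun h => hn (hdef.self_of_nhds.2 h))
    by_contra! hpos
    obtain ⟨y, ⟨hy1, hy2⟩, hyΩ⟩ := mem_closure_iff_nhds.1 hc _
      (hdef.and (h.continuousAt.eventually (Ioi_mem_nhds hpos)))
    exact absurd (hy1.1 hyΩ) (not_lt.2 (le_of_lt hy2))
  · intro h0
    refine ⟨?_, fun hx => absurd (hdef.self_of_nhds.1 hx) (by simp [h0])⟩
    obtain ⟨v, hv⟩ : ∃ v, fderiv ℝ ρ x v < 0 := by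
      obtain ⟨v, hv⟩ : ∃ v, fderiv ℝ ρ x v ≠ 0 := by
        by_contra! hcon
        exact hne (ContinuousLinearMap.ext hcon)
      rcases lt_or_gt_of_ne hv with h | h
      · exact ⟨v, h⟩
      · exact ⟨-v, by simpa using h⟩
    have ht : Tendsto (fun t : ℝ => x + t • v) (𝓝[>] 0) (𝓝 x) := by
      have : Tendsto (fun t : ℝ => x + t • v) (𝓝 0) (𝓝 x) := by
        have : Continuous fun t : ℝ => x + t • v := by fun_prop
        simpa using this.tendsto 0
      exact this.mono_left nhdsWithin_le_nhds
    refine mem_closure_of_tendsto ht ?_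
    filter_upwards [eventually_neg_of_fderiv_neg h h0 hv, ht.eventually hdef] with t h1 h2
    exact h2.2 h1

end Defining

theorem norm_gradient {E : Type*} [NormedAddCommGroup E] [InnerProductSpace ℝ E] [CompleteSpace E]
    (ρ : E → ℝ) (x : E) : ‖gradient ρ x‖ = ‖fderiv ℝ ρ x‖ := by
  simp [gradient]

theorem inner_gradient {E : Type*} [NormedAddCommGroup E] [InnerProductSpace ℝ E] [CompleteSpace E]
    (ρ : E → ℝ) (x v : E) : ⟪gradient ρ x, v⟫ = fderiv ℝ ρ x v := by
  simp [gradient]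

/-- The unit normal does not depend on the defining function. -/
theorem normalized_gradient_eq {E : Type*} [NormedAddCommGroup E] [InnerProductSpace ℝ E]
    [CompleteSpace E] {ρ₁ ρ₂ : E → ℝ} {x : E} (h₁ : DifferentiableAt ℝ ρ₁ x)
    (h₂ : DifferentiableAt ℝ ρ₂ x) (hne₁ : gradient ρ₁ x ≠ 0) (hne₂ : gradient ρ₂ x ≠ 0)
    (h01 : ρ₁ x = 0) (h02 : ρ₂ x = 0) (hiff : ∀ᶠ y in 𝓝 x, (ρ₁ y < 0 ↔ ρ₂ y < 0)) :
    ‖gradient ρ₁ x‖⁻¹ • gradient ρ₁ x = ‖gradient ρ₂ x‖⁻¹ • gradient ρ₂ x := by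
  set a := ‖gradient ρ₁ x‖⁻¹ • gradient ρ₁ x with ha
  set b := ‖gradient ρ₂ x‖⁻¹ • gradient ρ₂ x with hb
  have ha1 : ‖a‖ = 1 := by
    rw [ha, norm_smul, norm_inv, norm_norm, inv_mul_cancel₀ (norm_ne_zero_iff.2 hne₁)]
  have hb1 : ‖b‖ = 1 := by
    rw [hb, norm_smul, norm_inv, norm_norm, inv_mul_cancel₀ (norm_ne_zero_iff.2 hne₂)]
  by_contra hab
  have hlt : ⟪a, b⟫ < 1 := inner_lt_one_iff_real_of_norm_eq_one ha1 hb1 |>.2 hab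
  have hda : ∀ v, fderiv ℝ ρ₁ x v = ‖gradient ρ₁ x‖ * ⟪a, v⟫ := fun v => by
    rw [ha, real_inner_smul_left, inner_gradient,
      mul_inv_cancel_left₀ (norm_ne_zero_iff.2 hne₁)]
  have hdb : ∀ v, fderiv ℝ ρ₂ x v = ‖gradient ρ₂ x‖ * ⟪b, v⟫ := fun v => by
    rw [hb, real_inner_smul_left, inner_gradient,
      mul_inv_cancel_left₀ (norm_ne_zero_iff.2 hne₂)]
  -- If the unit normals `a` and `b` differed, moving along `b - a` would decrease `ρ₁` and increase
  -- `ρ₂`, although both are negative at the same points near `x`.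
  have hv1 : fderiv ℝ ρ₁ x (b - a) < 0 := by
    rw [hda, inner_sub_right, real_inner_self_eq_norm_sq, ha1]
    exact mul_neg_of_pos_of_neg (norm_pos_iff.2 hne₁) (by linarith)
  have hv2 : fderiv ℝ (fun y => -ρ₂ y) x (b - a) < 0 := by
    rw [fderiv_fun_neg]
    simp only [neg_apply]
    rw [hdb, inner_sub_right, real_inner_self_eq_norm_sq, hb1, real_inner_comm]
    have := mul_pos (norm_pos_iff.2 hne₂) (show (0 : ℝ) < 1 ^ 2 - ⟪a, b⟫ by linarith)
    linarith
  have ht : Tendsto (fun t : ℝ => x + t • (b - a)) (𝓝[>] 0) (𝓝 x) := by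
    have : Continuous fun t : ℝ => x + t • (b - a) := by fun_prop
    exact (by simpa using this.tendsto 0 : Tendsto (fun t : ℝ => x + t • (b - a)) (𝓝 0) (𝓝 x)).mono_left
      nhdsWithin_le_nhds
  obtain ⟨t, h1, h2, h3⟩ := ((eventually_neg_of_fderiv_neg h₁ h01 hv1).and
    ((eventually_neg_of_fderiv_neg h₂.neg (by simp [h02]) hv2).and (ht.eventually hiff))).exists
  have := h3.1 h1
  simp only [Pi.neg_apply] at h2
  linarith

/-- The point `x₀ + y + τ e` with tangential coordinate `y` and normal coordinate `τ`. -/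
noncomputable def chartPoint {N : ℕ} (x₀ e : Space N) (q : (Submodule.span ℝ {e})ᗮ × ℝ) : Space N :=
  x₀ + q.1 + q.2 • e

theorem continuous_chartPoint {N : ℕ} (x₀ e : Space N) : Continuous (chartPoint x₀ e) := by
  unfold chartPoint
  fun_prop

/-- A chart of the boundary near `x₀` as a graph of slope at most `ε` over the hyperplane orthogonal
to the unit vector `e`. -/
structure BoundaryChart {N : ℕ} (Ω : Set (Space N)) (n : Space N → Space N) (x₀ e : Space N)
    (ε : ℝ) where
  ρ : Space N → ℝ
  δ : ℝ
  κ : ℝ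
  g : (Submodule.span ℝ {e})ᗮ → ℝ
  δ_pos : 0 < δ
  κ_pos : 0 < κ
  norm_e : ‖e‖ = 1
  contDiffAt : ∀ y ∈ Metric.ball 0 δ, ∀ τ ∈ Icc (-κ) κ, ContDiffAt ℝ 1 ρ (chartPoint x₀ e (y, τ))
  fderiv_pos : ∀ y ∈ Metric.ball 0 δ, ∀ τ ∈ Icc (-κ) κ, 0 < fderiv ℝ ρ (chartPoint x₀ e (y, τ)) e
  norm_fderiv_le : ∀ y ∈ Metric.ball 0 δ, ∀ τ ∈ Icc (-κ) κ,
    ‖fderiv ℝ ρ (chartPoint x₀ e (y, τ))‖ ≤ (1 + ε) * fderiv ℝ ρ (chartPoint x₀ e (y, τ)) e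
  mem_iff : ∀ y ∈ Metric.ball 0 δ, ∀ τ ∈ Icc (-κ) κ,
    (chartPoint x₀ e (y, τ) ∈ Ω ↔ ρ (chartPoint x₀ e (y, τ)) < 0)
  frontier_iff : ∀ y ∈ Metric.ball 0 δ, ∀ τ ∈ Icc (-κ) κ,
    (chartPoint x₀ e (y, τ) ∈ frontier Ω ↔ τ = g y)
  g_mem : ∀ y ∈ Metric.ball 0 δ, g y ∈ Ioo (-κ) κ
  eqn_g : ∀ y ∈ Metric.ball 0 δ, ρ (chartPoint x₀ e (y, g y)) = 0
  lipschitz : ∀ y y', |g y - g y'| ≤ ε * ‖y - y'‖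
  normal : ∀ y ∈ Metric.ball 0 δ, ∀ v, fderiv ℝ ρ (chartPoint x₀ e (y, g y)) v
    = ‖fderiv ℝ ρ (chartPoint x₀ e (y, g y))‖ * ⟪n (chartPoint x₀ e (y, g y)), v⟫

theorem IsLyapunovDomain.norm_normal {N : ℕ} {Ω : Set (Space N)} {n : Space N → Space N}
    (hΩ : IsLyapunovDomain Ω n) {x : Space N} (hx : x ∈ frontier Ω) : ‖n x‖ = 1 := by
  obtain ⟨ρ, -, hne, hn, -⟩ := hΩ.exists_defining x hx
  rw [hn, norm_smul, norm_inv, norm_norm, inv_mul_cancel₀ (norm_ne_zero_iff.2 hne)]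

theorem strictMonoOn_chart_line {N : ℕ} {ρ : Space N → ℝ} {x₀ e : Space N} {s : Set ℝ}
    (hs : Convex ℝ s) {y : (Submodule.span ℝ {e})ᗮ}
    (hd : ∀ τ ∈ s, DifferentiableAt ℝ ρ (chartPoint x₀ e (y, τ)))
    (hpos : ∀ τ ∈ s, 0 < fderiv ℝ ρ (chartPoint x₀ e (y, τ)) e) :
    StrictMonoOn (fun τ => ρ (chartPoint x₀ e (y, τ))) s := by
  have hderiv : ∀ τ ∈ s, HasDerivAt (fun τ => ρ (chartPoint x₀ e (y, τ)))
      (fderiv ℝ ρ (chartPoint x₀ e (y, τ)) e) τ := fun τ hτ =>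
    hasDerivAt_comp_add_smul (g := ρ) (hd τ hτ).hasFDerivAt
  exact strictMonoOn_of_deriv_pos hs (fun τ hτ => (hderiv τ hτ).continuousAt.continuousWithinAt)
    fun τ hτ => by
      rw [(hderiv τ (interior_subset hτ)).deriv]
      exact hpos τ (interior_subset hτ)

/-- Near `x₀` the defining function increases strictly along the normal, so the intermediate value
theorem gives the height of the boundary over each tangential point. Strict differentiability at
`x₀` makes the slope of this graph as small as desired. -/
theorem IsLyapunovDomain.nonempty_boundaryChart {N : ℕ} {Ω : Set (Space N)} {n : Space N → Space N}
    (hΩ : IsLyapunovDomain Ω n) {x₀ : Space N} (hx₀ : x₀ ∈ frontier Ω) {ε : ℝ} (hε : 0 < ε) :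
    Nonempty (BoundaryChart Ω n x₀ (n x₀) ε) := by
  obtain ⟨ρ, hρ, hne, hn, hdef⟩ := hΩ.exists_defining x₀ hx₀
  have he1 := hΩ.norm_normal hx₀
  set e := n x₀ with he
  set a := ‖gradient ρ x₀‖ with ha
  have ha0 : 0 < a := norm_pos_iff.2 hne
  have hgrad : gradient ρ x₀ = a • e := by rw [hn, smul_inv_smul₀ ha0.ne']
  have hD : ∀ v, fderiv ℝ ρ x₀ v = a * ⟪e, v⟫ := fun v => by
    rw [← inner_gradient, hgrad, real_inner_smul_left]
  have hDn : ‖fderiv ℝ ρ x₀‖ = a := by rw [← norm_gradient]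
  have hDe : fderiv ℝ ρ x₀ e = a := by rw [hD, real_inner_self_eq_norm_sq, he1]; ring
  have hρ0 : ρ x₀ = 0 := by
    refine (mem_frontier_iff_of_defining hΩ.isOpen (hρ.differentiableAt (by norm_num)) ?_ hdef).1 hx₀
    intro h
    rw [h] at hDe
    exact ha0.ne hDe
  -- properties holding near the point
  set κ₀ : NNReal := ⟨a * ε / (1 + ε), by positivity⟩ with hκ₀
  obtain ⟨s, hs, hsL⟩ := (hρ.hasStrictFDerivAt (by norm_num)).approximates_deriv_on_nhds
    (c := κ₀) (Or.inr (show (0 : ℝ) < a * ε / (1 + ε) by positivity))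
  have hfd := continuousAt_fderiv_of_contDiffAt hρ
  have hev : ∀ᶠ x in 𝓝 x₀, ContDiffAt ℝ 1 ρ x ∧ 0 < fderiv ℝ ρ x e ∧
      ‖fderiv ℝ ρ x‖ < (1 + ε) * fderiv ℝ ρ x e ∧ (∀ᶠ y in 𝓝 x, (y ∈ Ω ↔ ρ y < 0)) ∧ x ∈ s := by
    have h1 : ContinuousAt (fun x => fderiv ℝ ρ x e) x₀ := hfd.clm_apply continuousAt_const
    have h2 : ContinuousAt (fun x => (1 + ε) * fderiv ℝ ρ x e) x₀ := continuousAt_const.mul h1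
    filter_upwards [hρ.eventually (by simp),
      h1.eventually (Ioi_mem_nhds (show 0 < fderiv ℝ ρ x₀ e by rw [hDe]; exact ha0)),
      hfd.norm.eventually_lt h2
        (show ‖fderiv ℝ ρ x₀‖ < (1 + ε) * fderiv ℝ ρ x₀ e by rw [hDn, hDe]; nlinarith),
      hdef.eventually_nhds, hs] with x h1 h2 h3 h4 h5
    exact ⟨h1, h2, h3, h4, h5⟩
  obtain ⟨r, hr, hrW⟩ := Metric.eventually_nhds_iff_ball.1 hev
  have hball : ∀ y : (Submodule.span ℝ {e})ᗮ, ‖y‖ < r / 2 → ∀ τ ∈ Icc (-(r / 2)) (r / 2),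
      chartPoint x₀ e (y, τ) ∈ Metric.ball x₀ r := by
    intro y hy τ hτ
    rw [Metric.mem_ball, dist_eq_norm, chartPoint, add_assoc, add_sub_cancel_left]
    have h1 : ‖τ • e‖ ≤ r / 2 := by
      rw [norm_smul, he1, mul_one, Real.norm_eq_abs, abs_le]
      exact hτ
    calc ‖(y : Space N) + τ • e‖ ≤ ‖(y : Space N)‖ + ‖τ • e‖ := norm_add_le _ _
      _ < r / 2 + r / 2 := by
        have : ‖(y : Space N)‖ = ‖y‖ := rfl
        linarith
      _ = r := by ring
  have hmono : ∀ y : (Submodule.span ℝ {e})ᗮ, ‖y‖ < r / 2 →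
      StrictMonoOn (fun τ => ρ (chartPoint x₀ e (y, τ))) (Icc (-(r / 2)) (r / 2)) := fun y hy =>
    strictMonoOn_chart_line (convex_Icc _ _)
      (fun τ hτ => (hrW _ (hball y hy τ hτ)).1.differentiableAt (by norm_num))
      (fun τ hτ => (hrW _ (hball y hy τ hτ)).2.1)
  have h00 : chartPoint x₀ e (0, 0) = x₀ := by simp [chartPoint]
  have hm0 : (0 : ℝ) ∈ Icc (-(r / 2)) (r / 2) := ⟨by linarith, by linarith⟩
  have hm1 : r / 2 ∈ Icc (-(r / 2)) (r / 2) := ⟨by linarith, le_rfl⟩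
  have hm2 : -(r / 2) ∈ Icc (-(r / 2)) (r / 2) := ⟨le_rfl, by linarith⟩
  have hz : ‖(0 : (Submodule.span ℝ {e})ᗮ)‖ < r / 2 := by simp [hr]
  have hpos : 0 < ρ (chartPoint x₀ e (0, r / 2)) := by
    have := hmono 0 hz hm0 hm1 (by linarith)
    simpa [h00, hρ0] using this
  have hneg : ρ (chartPoint x₀ e (0, -(r / 2))) < 0 := by
    have := hmono 0 hz hm2 hm0 (by linarith)
    simpa [h00, hρ0] using this
  have hcont : ∀ τ ∈ Icc (-(r / 2)) (r / 2), ContinuousAt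
      (fun y : (Submodule.span ℝ {e})ᗮ => ρ (chartPoint x₀ e (y, τ))) 0 := fun τ hτ =>
    ContinuousAt.comp (f := fun y : (Submodule.span ℝ {e})ᗮ => chartPoint x₀ e (y, τ))
      (hrW _ (hball 0 hz τ hτ)).1.continuousAt
      ((continuous_chartPoint x₀ e).comp (Continuous.prodMk_left τ)).continuousAt
  obtain ⟨δ', hδ', hδ'W⟩ := Metric.eventually_nhds_iff_ball.1
    (((hcont _ hm1).eventually (Ioi_mem_nhds hpos)).and
      ((hcont _ hm2).eventually (Iio_mem_nhds hneg)))
  have hsmall : ∀ y ∈ Metric.ball (0 : (Submodule.span ℝ {e})ᗮ) (min δ' (r / 2)), ‖y‖ < r / 2 :=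
    fun y hy => by
      rw [mem_ball_zero_iff] at hy
      exact hy.trans_le (min_le_right _ _)
  have hg : ∀ y ∈ Metric.ball (0 : (Submodule.span ℝ {e})ᗮ) (min δ' (r / 2)),
      ∃ τ ∈ Ioo (-(r / 2)) (r / 2), ρ (chartPoint x₀ e (y, τ)) = 0 := by
    intro y hy
    have hy' := hδ'W y (Metric.ball_subset_ball (min_le_left _ _) hy)
    have hc : ContinuousOn (fun τ => ρ (chartPoint x₀ e (y, τ))) (Icc (-(r / 2)) (r / 2)) :=
      fun τ hτ => ContinuousAt.continuousWithinAt <|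
        ContinuousAt.comp (f := fun τ : ℝ => chartPoint x₀ e (y, τ))
          (hrW _ (hball y (hsmall y hy) τ hτ)).1.continuousAt
          ((continuous_chartPoint x₀ e).comp (Continuous.prodMk_right y)).continuousAt
    exact intermediate_value_Ioo (by linarith) hc ⟨hy'.2, hy'.1⟩
  choose! g hgm hg0 using hg
  have hfr : ∀ x ∈ Metric.ball x₀ r, (x ∈ frontier Ω ↔ ρ x = 0) := fun x hx =>
    mem_frontier_iff_of_defining hΩ.isOpen ((hrW x hx).1.differentiableAt (by norm_num))
      (fun h => by
        have := (hrW x hx).2.1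
        rw [h] at this
        exact lt_irrefl _ this) (hrW x hx).2.2.2.1
  have hlip : ∀ y ∈ Metric.ball 0 (min δ' (r / 2)), ∀ y' ∈ Metric.ball 0 (min δ' (r / 2)),
      |g y - g y'| ≤ ε * ‖y - y'‖ := by
    intro y hy y' hy'
    have h1 := hsL _ (hrW _ (hball y (hsmall y hy) _ (Ioo_subset_Icc_self (hgm y hy)))).2.2.2.2
      _ (hrW _ (hball y' (hsmall y' hy') _ (Ioo_subset_Icc_self (hgm y' hy')))).2.2.2.2
    have hdiff : chartPoint x₀ e (y, g y) - chartPoint x₀ e (y', g y')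
        = ((y - y' : (Submodule.span ℝ {e})ᗮ) : Space N) + (g y - g y') • e := by
      simp only [chartPoint, Submodule.coe_sub]
      module
    have hperp : ⟪e, ((y - y' : (Submodule.span ℝ {e})ᗮ) : Space N)⟫ = 0 :=
      (Submodule.mem_orthogonal_singleton_iff_inner_right).1 (y - y').2
    rw [hg0 y hy, hg0 y' hy', hdiff, hD, inner_add_right, hperp, real_inner_smul_right,
      real_inner_self_eq_norm_sq, he1] at h1
    have h2 : ‖((y - y' : (Submodule.span ℝ {e})ᗮ) : Space N) + (g y - g y') • e‖
        ≤ ‖y - y'‖ + |g y - g y'| := by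
      refine (norm_add_le _ _).trans ?_
      rw [norm_smul, he1, mul_one, Real.norm_eq_abs]
      rfl
    have h3 : a * |g y - g y'| ≤ a * ε / (1 + ε) * (‖y - y'‖ + |g y - g y'|) := by
      refine le_trans (le_of_eq ?_) (h1.trans (mul_le_mul_of_nonneg_left h2 κ₀.2))
      rw [show (0 : ℝ) - 0 - a * (0 + (g y - g y') * 1 ^ 2) = -(a * (g y - g y')) by ring, norm_neg,
        norm_mul, Real.norm_eq_abs, Real.norm_eq_abs, abs_of_pos ha0]
    rw [div_mul_eq_mul_div, le_div_iff₀ (by positivity)] at h3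
    have h4 : a * |g y - g y'| ≤ a * (ε * ‖y - y'‖) := by linarith
    exact le_of_mul_le_mul_left h4 ha0
  -- Extending the height to the whole hyperplane makes the graph map globally Lipschitz, hence
  -- measurable without restriction.
  obtain ⟨g', hg'L, hg'E⟩ := (LipschitzOnWith.of_dist_le_mul (K := ⟨ε, hε.le⟩) (f := g)
    fun y hy y' hy' => by
      rw [Real.dist_eq, dist_eq_norm]
      exact hlip y hy y' hy').extend_real
  have hlip' : ∀ y y', |g' y - g' y'| ≤ ε * ‖y - y'‖ := fun y y' => by
    rw [← Real.dist_eq, ← dist_eq_norm]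
    exact hg'L.dist_le_mul y y'
  have hgm' : ∀ y ∈ Metric.ball (0 : (Submodule.span ℝ {e})ᗮ) (min δ' (r / 2)),
      g' y ∈ Ioo (-(r / 2)) (r / 2) := fun y hy => by
    rw [← hg'E hy]
    exact hgm y hy
  have hg0' : ∀ y ∈ Metric.ball (0 : (Submodule.span ℝ {e})ᗮ) (min δ' (r / 2)),
      ρ (chartPoint x₀ e (y, g' y)) = 0 := fun y hy => by
    rw [← hg'E hy]
    exact hg0 y hy
  exact ⟨{
    ρ := ρ, δ := min δ' (r / 2), κ := r / 2, g := g'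
    δ_pos := lt_min hδ' (by linarith)
    κ_pos := by linarith
    norm_e := he1
    contDiffAt := fun y hy τ hτ => (hrW _ (hball y (hsmall y hy) τ hτ)).1
    fderiv_pos := fun y hy τ hτ => (hrW _ (hball y (hsmall y hy) τ hτ)).2.1
    norm_fderiv_le := fun y hy τ hτ => (hrW _ (hball y (hsmall y hy) τ hτ)).2.2.1.le
    mem_iff := fun y hy τ hτ => (hrW _ (hball y (hsmall y hy) τ hτ)).2.2.2.1.self_of_nhds
    frontier_iff := fun y hy τ hτ => by
      rw [hfr _ (hball y (hsmall y hy) τ hτ), ← hg0' y hy]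
      exact (hmono y (hsmall y hy)).injOn.eq_iff hτ (Ioo_subset_Icc_self (hgm' y hy))
    g_mem := hgm'
    eqn_g := hg0'
    lipschitz := hlip'
    normal := fun y hy v => by
      set x := chartPoint x₀ e (y, g' y) with hx
      have hxb := hball y (hsmall y hy) _ (Ioo_subset_Icc_self (hgm' y hy))
      have hxf : x ∈ frontier Ω := (hfr x hxb).2 (hg0' y hy)
      -- At another boundary point `n` is given by another defining function, but the normalised
      -- gradients agree.
      obtain ⟨ρ', hρ', hne', hn', hdef'⟩ := hΩ.exists_defining x hxf
      have hd' := hρ'.differentiableAt (by norm_num : (1 : WithTop ℕ∞) ≠ 0)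
      have h0' : ρ' x = 0 := (mem_frontier_iff_of_defining hΩ.isOpen hd' (fun h => hne' (by
        rw [← norm_eq_zero, norm_gradient, h, norm_zero])) hdef').1 hxf
      have hnex : gradient ρ x ≠ 0 := fun h => by
        have := (hrW x hxb).2.1
        rw [← inner_gradient, h, inner_zero_left] at this
        exact lt_irrefl _ this
      have := normalized_gradient_eq ((hrW x hxb).1.differentiableAt (by norm_num)) hd' hnex hne'
        (hg0' y hy) h0' (by
          filter_upwards [(hrW x hxb).2.2.2.1, hdef'] with w h1 h2
          rw [← h1, h2])
      rw [hn', ← this, real_inner_smul_left, inner_gradient, norm_gradient, mul_inv_cancel_left₀]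
      rw [← norm_gradient]
      exact norm_ne_zero_iff.2 hnex }⟩

/-! ### Tangential and normal coordinates -/

section ChartPoint

variable {N : ℕ} {x₀ e : Space N}

theorem inner_orthogonal_span_singleton (y : (Submodule.span ℝ {e})ᗮ) : ⟪e, (y : Space N)⟫ = 0 :=
  (Submodule.mem_orthogonal_singleton_iff_inner_right).1 y.2

/-- The tangential coordinate of a point. -/
noncomputable def tangentialPart (x₀ e : Space N) (x : Space N) : (Submodule.span ℝ {e})ᗮ :=
  (Submodule.span ℝ {e})ᗮ.orthogonalProjectionOnto (x - x₀)

theorem lipschitzWith_tangentialPart : LipschitzWith 1 (tangentialPart x₀ e) := by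
  refine LipschitzWith.of_dist_le_mul fun x x' => ?_
  rw [dist_eq_norm, dist_eq_norm, tangentialPart, tangentialPart, ← map_sub, sub_sub_sub_cancel_right,
    NNReal.coe_one]
  refine (ContinuousLinearMap.le_opNorm _ _).trans ?_
  gcongr
  exact Submodule.orthogonalProjectionOnto_norm_le _

theorem tangentialPart_chartPoint (q : (Submodule.span ℝ {e})ᗮ × ℝ) :
    tangentialPart x₀ e (chartPoint x₀ e q) = q.1 := by
  have h : chartPoint x₀ e q - x₀ = q.1 + q.2 • e := by
    simp only [chartPoint]; abel
  rw [tangentialPart, h, map_add, Submodule.orthogonalProjectionOnto_mem_subspace_eq_self]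
  rw [Submodule.orthogonalProjectionOnto_orthogonal_apply_eq_zero, add_zero]
  exact Submodule.smul_mem _ _ (Submodule.mem_span_singleton_self e)

/-- The tangential and normal coordinates with respect to a unit vector. -/
noncomputable def chartHomeomorph (x₀ : Space N) (he : ‖e‖ = 1) :
    (Submodule.span ℝ {e})ᗮ × ℝ ≃ₜ Space N where
  toFun := chartPoint x₀ e
  invFun x := (tangentialPart x₀ e x, ⟪e, x - x₀⟫)
  left_inv q := by
    refine Prod.ext (tangentialPart_chartPoint q) ?_
    have h : chartPoint x₀ e q - x₀ = q.1 + q.2 • e := by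
      simp only [chartPoint]; abel
    simp only [h]
    rw [inner_add_right, inner_orthogonal_span_singleton, real_inner_smul_right,
      real_inner_self_eq_norm_sq, he]
    ring
  right_inv x := by
    have := Submodule.starProjection_add_starProjection_orthogonal (K := Submodule.span ℝ {e}) (x - x₀)
    rw [Submodule.starProjection_unit_singleton ℝ he] at this
    simp only [chartPoint, tangentialPart]
    rw [add_assoc, add_comm _ (⟪e, x - x₀⟫ • e)]
    exact (congrArg (x₀ + ·) this).trans (add_sub_cancel x₀ x)
  continuous_toFun := continuous_chartPoint x₀ e
  continuous_invFun := lipschitzWith_tangentialPart.continuous.prodMk (by fun_prop)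

/-- An orthogonal decomposition of space, with the line spanned by the unit vector identified
isometrically with `ℝ`. -/
theorem measurePreserving_chartPoint (x₀ : Space N) (he : ‖e‖ = 1) :
    MeasurePreserving (chartPoint x₀ e) (volume.prod volume) volume := by
  have h1 := ((Submodule.span ℝ {e}).measurePreserving_measurableEquivProd x₀).symm
  rw [InnerProductSpace.euclideanHausdorffMeasure_eq_volume] at h1
  have h2 : MeasurePreserving (LinearIsometryEquiv.toSpanUnitSingleton (𝕜 := ℝ) e he) volume
    volume := LinearIsometryEquiv.measurePreserving _
  have h3 := h1.comp ((h2.prod (MeasurePreserving.id volume)).comp Measure.measurePreserving_swap)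
  have hf : chartPoint x₀ e = (Submodule.measurableEquivProd (Submodule.span ℝ {e}) x₀).symm ∘
      (Prod.map (LinearIsometryEquiv.toSpanUnitSingleton (𝕜 := ℝ) e he) id ∘ Prod.swap) := by
    funext q
    change x₀ + (q.1 : Space N) + q.2 • e
      = (Submodule.measurableEquivProd (Submodule.span ℝ {e}) x₀).symm
        (LinearIsometryEquiv.toSpanUnitSingleton (𝕜 := ℝ) e he q.2, q.1)
    rw [Submodule.measurableEquivProd_symm_apply]
    simp
    abel
  rw [hf]
  exact h3

/-- The space-time point with tangential coordinate `q.1.1`, time `q.1.2` and normal coordinate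
`q.2`. -/
noncomputable def spaceTimeChart (x₀ e : Space N) (q : ((Submodule.span ℝ {e})ᗮ × ℝ) × ℝ) :
    SpaceTime N :=
  (chartPoint x₀ e (q.1.1, q.2), q.1.2)

/-- The normal coordinate is placed last, so that Fubini integrates first along the lines normal to
the tangent plane. -/
theorem measurePreserving_spaceTimeChart (x₀ : Space N) (he : ‖e‖ = 1) :
    MeasurePreserving (spaceTimeChart x₀ e) ((volume.prod volume).prod volume) volume := by
  have h1 : MeasurePreserving
      (MeasurableEquiv.prodAssoc : (((Submodule.span ℝ {e})ᗮ × ℝ) × ℝ) ≃ᵐ _)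
      ((volume.prod volume).prod volume) (volume.prod (volume.prod volume)) :=
    measurePreserving_prodAssoc _ _ _
  have h2 : MeasurePreserving (Prod.map id Prod.swap : ((Submodule.span ℝ {e})ᗮ × ℝ × ℝ) → _)
      (volume.prod (volume.prod volume)) (volume.prod (volume.prod volume)) :=
    (MeasurePreserving.id _).prod Measure.measurePreserving_swap
  have h3 : MeasurePreserving
      (MeasurableEquiv.prodAssoc : (((Submodule.span ℝ {e})ᗮ × ℝ) × ℝ) ≃ᵐ _).symm
      (volume.prod (volume.prod volume)) ((volume.prod volume).prod volume) :=
    (measurePreserving_prodAssoc _ _ _).symm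
  have h4 := (measurePreserving_chartPoint x₀ he).prod (MeasurePreserving.id (volume : Measure ℝ))
  exact h4.comp (h3.comp (h2.comp h1))

theorem measurableEmbedding_spaceTimeChart (x₀ : Space N) (he : ‖e‖ = 1) :
    MeasurableEmbedding (spaceTimeChart x₀ e) := by
  refine (measurePreserving_spaceTimeChart x₀ he).measurable.measurableEmbedding ?_
  rintro ⟨⟨y, s⟩, τ⟩ ⟨⟨y', s'⟩, τ'⟩ h
  have h1 := (chartHomeomorph x₀ he).injective (congrArg Prod.fst h)
  have h2 : s = s' := congrArg Prod.snd h
  simp only [Prod.mk.injEq] at h1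
  rw [h1.1, h1.2, h2]

theorem continuous_spaceTimeChart (x₀ e : Space N) : Continuous (spaceTimeChart x₀ e) :=
  ((continuous_chartPoint x₀ e).comp (by fun_prop)).prodMk (by fun_prop)

theorem finrank_orthogonal_span_unit (hN : 1 ≤ N) (he : ‖e‖ = 1) :
    Module.finrank ℝ (Submodule.span ℝ {e})ᗮ = N - 1 := by
  have h := (Submodule.span ℝ {e}).finrank_add_finrank_orthogonal
  rw [finrank_span_singleton (by rintro rfl; simp at he), finrank_euclideanSpace_fin] at h
  omega

end ChartPoint

theorem LipschitzOnWith.euclideanHausdorffMeasure_image_le {X Y : Type*} [MetricSpace X]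
    [MeasurableSpace X] [BorelSpace X] [MetricSpace Y] [MeasurableSpace Y] [BorelSpace Y]
    {K : NNReal} {f : X → Y} {s : Set X} (h : LipschitzOnWith K f s) (d : ℕ) :
    μHE[d] (f '' s) ≤ (K : ENNReal) ^ d * μHE[d] s := by
  rw [Measure.euclideanHausdorffMeasure_def, Measure.euclideanHausdorffMeasure_def]
  have := h.hausdorffMeasure_image_le (d := d) (by positivity)
  rw [ENNReal.rpow_natCast] at this
  simp only [Measure.smul_apply, ENNReal.smul_def, smul_eq_mul]
  calc _ ≤ _ * ((K : ENNReal) ^ d * _) := by gcongr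
    _ = _ := by ring

/-- The integrals of the nonnegative functions `|h| + h` and `|h| - h` grow with the measure. Hence
the difference is at most `∫ |h| ∂ν - ∫ |h| ∂μ`. -/
theorem abs_integral_sub_integral_le {X : Type*} [MeasurableSpace X] {μ ν : Measure X} {K : NNReal}
    (h1 : μ ≤ ν) (h2 : ν ≤ K • μ) {h : X → ℝ} (hh : Integrable h ν) :
    |∫ x, h x ∂ν - ∫ x, h x ∂μ| ≤ (K - 1) * ∫ x, |h x| ∂μ := by
  have hμ := hh.mono_measure h1
  have hK : ∫ x, |h x| ∂ν ≤ K * ∫ x, |h x| ∂μ := by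
    have := integral_mono_measure (f := fun x => |h x|) h2 (ae_of_all _ fun x => abs_nonneg _)
      (hμ.abs.smul_measure_nnreal)
    rwa [integral_smul_nnreal_measure] at this
  have hp := integral_mono_measure (f := fun x => |h x| + h x) h1
    (ae_of_all _ fun x => by have := neg_abs_le (h x); simp; linarith) (hh.abs.add hh)
  have hm := integral_mono_measure (f := fun x => |h x| - h x) h1
    (ae_of_all _ fun x => by have := le_abs_self (h x); simp; linarith) (hh.abs.sub hh)
  rw [integral_add hh.abs hh, integral_add hμ.abs hμ] at hp
  rw [integral_sub hh.abs hh, integral_sub hμ.abs hμ] at hm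
  rw [abs_le]
  constructor <;> linarith

/-! ### Comparison of the surface measure with Lebesgue measure in a chart -/

theorem volume_orthogonal_span_unit {N : ℕ} {e : Space N} (hN : 1 ≤ N) (he : ‖e‖ = 1)
    (A : Set (Submodule.span ℝ {e})ᗮ) : volume A = μHE[N - 1] A := by
  rw [← finrank_orthogonal_span_unit hN he, InnerProductSpace.euclideanHausdorffMeasure_eq_volume]

namespace BoundaryChart

variable {N : ℕ} {Ω : Set (Space N)} {n : Space N → Space N} {x₀ e : Space N} {ε : NNReal}
  (b : BoundaryChart Ω n x₀ e ε)

/-- The region of space covered by the chart. -/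
def box : Set (Space N) := chartPoint x₀ e '' (Metric.ball 0 b.δ ×ˢ Ioo (-b.κ) b.κ)

/-- The boundary point over a point of the tangent plane. -/
noncomputable def graph (y : (Submodule.span ℝ {e})ᗮ) : Space N := chartPoint x₀ e (y, b.g y)

theorem isOpen_box : IsOpen b.box :=
  (chartHomeomorph x₀ b.norm_e).isOpenMap _ (Metric.isOpen_ball.prod isOpen_Ioo)

theorem chartPoint_mem_box {q : (Submodule.span ℝ {e})ᗮ × ℝ} :
    chartPoint x₀ e q ∈ b.box ↔ q.1 ∈ Metric.ball 0 b.δ ∧ q.2 ∈ Ioo (-b.κ) b.κ :=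
  (chartHomeomorph x₀ b.norm_e).injective.mem_set_image

theorem self_mem_box : x₀ ∈ b.box :=
  ⟨(0, 0), ⟨Metric.mem_ball_self b.δ_pos, neg_lt_zero.2 b.κ_pos, b.κ_pos⟩, by simp [chartPoint]⟩

theorem box_mem_nhds : b.box ∈ 𝓝 x₀ := b.isOpen_box.mem_nhds b.self_mem_box

theorem graph_mem_frontier {y : (Submodule.span ℝ {e})ᗮ} (hy : y ∈ Metric.ball 0 b.δ) :
    b.graph y ∈ frontier Ω :=
  (b.frontier_iff y hy _ (Ioo_subset_Icc_self (b.g_mem y hy))).2 rfl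

theorem inter_box_inter_frontier (S : Set (Space N)) :
    S ∩ b.box ∩ frontier Ω = b.graph '' (b.graph ⁻¹' S ∩ Metric.ball 0 b.δ) := by
  ext x
  constructor
  · rintro ⟨⟨hS, ⟨⟨y, τ⟩, ⟨hy, hτ⟩, rfl⟩⟩, hf⟩
    have := (b.frontier_iff y hy τ (Ioo_subset_Icc_self hτ)).1 hf
    subst this
    exact ⟨y, ⟨hS, hy⟩, rfl⟩
  · rintro ⟨y, ⟨hS, hy⟩, rfl⟩
    exact ⟨⟨hS, b.chartPoint_mem_box.2 ⟨hy, b.g_mem y hy⟩⟩, b.graph_mem_frontier hy⟩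

theorem lipschitzWith_graph : LipschitzWith (1 + ε) b.graph := by
  refine LipschitzWith.of_dist_le_mul fun y y' => ?_
  have h : b.graph y - b.graph y' = ((y - y' : (Submodule.span ℝ {e})ᗮ) : Space N)
      + (b.g y - b.g y') • e := by
    simp only [graph, chartPoint, Submodule.coe_sub]
    module
  rw [dist_eq_norm, dist_eq_norm, h]
  refine (norm_add_le _ _).trans ?_
  rw [norm_smul, b.norm_e, mul_one, Real.norm_eq_abs, NNReal.coe_add, NNReal.coe_one, add_mul,
    one_mul]
  exact add_le_add le_rfl (b.lipschitz y y')

theorem continuous_graph : Continuous b.graph := b.lipschitzWith_graph.continuous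

theorem tangentialPart_image_graph (A : Set (Submodule.span ℝ {e})ᗮ) :
    tangentialPart x₀ e '' (b.graph '' A) = A := by
  rw [image_image]
  simp [graph, tangentialPart_chartPoint]

/-- The tangential projection is a contraction that undoes the graph map. With the opposite bound
from the Lipschitz constant of the graph map, this replaces the area formula. -/
theorem volume_le_measure_image_graph (hN : 1 ≤ N) (A : Set (Submodule.span ℝ {e})ᗮ) :
    volume A ≤ μHE[N - 1] (b.graph '' A) := by
  have := (lipschitzWith_tangentialPart (x₀ := x₀) (e := e)).lipschitzOnWith (s := b.graph '' A)
    |>.euclideanHausdorffMeasure_image_le (N - 1)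
  rw [b.tangentialPart_image_graph, ← volume_orthogonal_span_unit hN b.norm_e] at this
  simpa using this

theorem measure_image_graph_le (hN : 1 ≤ N) (A : Set (Submodule.span ℝ {e})ᗮ) :
    μHE[N - 1] (b.graph '' A) ≤ ((1 + ε) ^ (N - 1) : NNReal) * volume A := by
  have := b.lipschitzWith_graph.lipschitzOnWith (s := A)
    |>.euclideanHausdorffMeasure_image_le (N - 1)
  rw [← volume_orthogonal_span_unit hN b.norm_e] at this
  simpa using this

/-- The measure on the boundary induced by Lebesgue measure in the tangent plane. -/
noncomputable def graphMeasure : Measure (Space N) :=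
  (volume.restrict (Metric.ball 0 b.δ)).map b.graph

theorem isFiniteMeasure_restrict_ball :
    IsFiniteMeasure ((volume : Measure (Submodule.span ℝ {e})ᗮ).restrict (Metric.ball 0 b.δ)) :=
  ⟨by rw [Measure.restrict_apply_univ]; exact Metric.isBounded_ball.measure_lt_top⟩

instance isFiniteMeasure_graphMeasure : IsFiniteMeasure b.graphMeasure := by
  have := b.isFiniteMeasure_restrict_ball
  unfold graphMeasure
  infer_instance

theorem graphMeasure_apply {S : Set (Space N)} (hS : MeasurableSet S) :
    b.graphMeasure S = volume (b.graph ⁻¹' S ∩ Metric.ball 0 b.δ) := by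
  rw [graphMeasure, Measure.map_apply b.continuous_graph.measurable hS,
    Measure.restrict_apply (b.continuous_graph.measurable hS)]

theorem surfaceMeasure_restrict_apply {S : Set (Space N)} (hS : MeasurableSet S) :
    (surfaceMeasure Ω).restrict b.box S
      = μHE[N - 1] (b.graph '' (b.graph ⁻¹' S ∩ Metric.ball 0 b.δ)) := by
  rw [Measure.restrict_apply hS, surfaceMeasure,
    Measure.restrict_apply (hS.inter b.isOpen_box.measurableSet), b.inter_box_inter_frontier]

theorem graphMeasure_le (hN : 1 ≤ N) : b.graphMeasure ≤ (surfaceMeasure Ω).restrict b.box :=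
  Measure.le_iff.2 fun S hS => by
    rw [b.graphMeasure_apply hS, b.surfaceMeasure_restrict_apply hS]
    exact b.volume_le_measure_image_graph hN _

theorem surfaceMeasure_restrict_le (hN : 1 ≤ N) :
    (surfaceMeasure Ω).restrict b.box ≤ ((1 + ε) ^ (N - 1) : NNReal) • b.graphMeasure :=
  Measure.le_iff.2 fun S hS => by
    rw [b.surfaceMeasure_restrict_apply hS, Measure.smul_apply, b.graphMeasure_apply hS]
    exact b.measure_image_graph_le hN _

theorem graphMeasure_prod_eq (μ : Measure ℝ) [SFinite μ] : b.graphMeasure.prod μ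
    = ((volume.restrict (Metric.ball 0 b.δ)).prod μ).map (Prod.map b.graph id) := by
  have := b.isFiniteMeasure_restrict_ball
  rw [← Measure.map_prod_map _ _ b.continuous_graph.measurable measurable_id, Measure.map_id]
  rfl

/-- The Lipschitz projection to tangent plane times time keeps `Z` null for the `N`-dimensional
Hausdorff measure. That product has dimension `N`, so Lebesgue null sets there are the same. -/
theorem graphMeasure_prod_eq_zero (hN : 1 ≤ N) {Z : Set (SpaceTime N)} (hZc : IsClosed Z)
    (hZ : μH[(N : ℝ)] Z = 0) : b.graphMeasure.prod volume Z = 0 := by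
  have hcont : Continuous (Prod.map b.graph (id : ℝ → ℝ)) := b.continuous_graph.prodMap continuous_id
  rw [b.graphMeasure_prod_eq, Measure.map_apply hcont.measurable hZc.measurableSet]
  set A := (Prod.map b.graph (id : ℝ → ℝ)) ⁻¹' Z
  have hAZ : A ⊆ Prod.map (tangentialPart x₀ e) id '' Z := fun q hq =>
    ⟨_, hq, Prod.ext (tangentialPart_chartPoint _) rfl⟩
  have h1 : μH[(N : ℝ)] A = 0 := by
    refine measure_mono_null hAZ ?_
    have hl : LipschitzWith (max (1 * 1) 1) (Prod.map (tangentialPart x₀ e) (id : ℝ → ℝ)) :=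
      (lipschitzWith_tangentialPart.comp LipschitzWith.prod_fst).prodMk LipschitzWith.prod_snd
    have := hl.hausdorffMeasure_image_le (d := N) (by positivity) Z
    rw [hZ, mul_zero] at this
    exact le_antisymm this zero_le
  have hfin : Module.finrank ℝ ((Submodule.span ℝ {e})ᗮ × ℝ) = N := by
    rw [Module.finrank_prod, finrank_orthogonal_span_unit hN b.norm_e, Module.finrank_self]
    omega
  have hH : (μH[(Module.finrank ℝ ((Submodule.span ℝ {e})ᗮ × ℝ) : ℝ)] :
      Measure ((Submodule.span ℝ {e})ᗮ × ℝ)).IsAddHaarMeasure := isAddHaarMeasure_hausdorffMeasure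
  rw [hfin] at hH
  have h2 : (volume : Measure (Submodule.span ℝ {e})ᗮ).prod (volume : Measure ℝ) A = 0 :=
    Measure.absolutelyContinuous_isAddHaarMeasure _ (μH[(N : ℝ)]) h1
  exact Measure.absolutelyContinuous_of_le
    (Measure.prod_mono Measure.restrict_le_self le_rfl) h2

end BoundaryChart

namespace IsLyapunovDomain

variable {N : ℕ} {Ω : Set (Space N)} {n : Space N → Space N}

/-- The boundary is compact, and in each chart it is a Lipschitz image of a bounded set. -/
theorem isFiniteMeasure_surfaceMeasure (hΩ : IsLyapunovDomain Ω n) (hN : 1 ≤ N) :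
    IsFiniteMeasure (surfaceMeasure Ω) := by
  refine ⟨?_⟩
  rw [surfaceMeasure, Measure.restrict_apply_univ]
  refine (Metric.isCompact_of_isClosed_isBounded isClosed_frontier
    (hΩ.isBounded.closure.subset frontier_subset_closure)).measure_lt_top_of_nhdsWithin
    fun x hx => ?_
  obtain ⟨b⟩ := hΩ.nonempty_boundaryChart hx one_pos
  -- Any slope would do; it is recast as a coerced nonnegative real, the form used by the measure
  -- bounds.
  have b : BoundaryChart Ω n x (n x) (1 : NNReal) := b
  refine ⟨b.box ∩ frontier Ω, inter_mem (mem_nhdsWithin_of_mem_nhds b.box_mem_nhds)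
    self_mem_nhdsWithin, ?_⟩
  rw [← univ_inter b.box, b.inter_box_inter_frontier]
  refine (b.measure_image_graph_le hN _).trans_lt (ENNReal.mul_lt_top ENNReal.coe_lt_top ?_)
  exact (Metric.isBounded_ball.subset inter_subset_right).measure_lt_top

theorem prod_surfaceMeasure_eq_zero (hΩ : IsLyapunovDomain Ω n) (hN : 1 ≤ N)
    {Z : Set (SpaceTime N)} (hZc : IsClosed Z) (hZ : μH[(N : ℝ)] Z = 0) :
    (surfaceMeasure Ω).prod volume Z = 0 := by
  have := hΩ.isFiniteMeasure_surfaceMeasure hN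
  refine measure_null_of_locally_null Z fun z hz => ?_
  by_cases hf : z.1 ∈ frontier Ω
  · obtain ⟨b⟩ := hΩ.nonempty_boundaryChart hf one_pos
    have b : BoundaryChart Ω n z.1 (n z.1) (1 : NNReal) := b
    refine ⟨Z ∩ b.box ×ˢ univ, inter_mem_nhdsWithin _ ((b.isOpen_box.prod isOpen_univ).mem_nhds
      ⟨b.self_mem_box, mem_univ _⟩), ?_⟩
    rw [← Measure.restrict_apply hZc.measurableSet, ← Measure.prod_restrict, Measure.restrict_univ]
    refine Measure.absolutelyContinuous_of_le
      (Measure.prod_mono (b.surfaceMeasure_restrict_le hN) le_rfl) ?_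
    rw [Measure.prod_smul_left, Measure.smul_apply, b.graphMeasure_prod_eq_zero hN hZc hZ, smul_zero]
  · refine ⟨(frontier Ω)ᶜ ×ˢ univ, mem_nhdsWithin_of_mem_nhds
      ((isClosed_frontier.isOpen_compl.prod isOpen_univ).mem_nhds ⟨hf, mem_univ _⟩), ?_⟩
    rw [Measure.prod_prod, surfaceMeasure,
      Measure.restrict_apply isClosed_frontier.measurableSet.compl]
    simp

end IsLyapunovDomain

/-! ### The boundary data -/

theorem IsLyapunovDomain.continuousOn_normal {N : ℕ} {Ω : Set (Space N)} {n : Space N → Space N}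
    (hΩ : IsLyapunovDomain Ω n) : ContinuousOn n (frontier Ω) := by
  obtain ⟨A, α, hα, -, h⟩ := hΩ.holder
  intro x hx
  rw [ContinuousWithinAt, tendsto_iff_norm_sub_tendsto_zero]
  have hc : Continuous fun y : Space N => A * ‖y - x‖ ^ α :=
    continuous_const.mul ((continuous_id.sub continuous_const).norm.rpow_const fun _ => Or.inr hα.le)
  refine squeeze_zero' (Eventually.of_forall fun _ => norm_nonneg _)
    (eventually_nhdsWithin_of_forall fun y hy => h y hy x hx)
    (tendsto_nhdsWithin_of_tendsto_nhds ?_)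
  have := hc.tendsto x
  simpa [Real.zero_rpow hα.ne'] using this

namespace IsClassicalSolution

variable {ι : Type*} {N : ℕ} {c : ℝ} {Ω : Set (Space N)} {n : Space N → Space N}
  {F : ι → WaveFront N c} {Z : Set (SpaceTime N)} {G : SpaceTime N → ℝ} {u₀ v₀ : Space N → ℝ}
  {uS p : SpaceTime N → ℝ} {u : SpaceTime N → ℝ}

theorem ae_boundary (hu : IsClassicalSolution c Ω n F Z G u₀ v₀ uS p u)
    (hΩ : IsLyapunovDomain Ω n) (hN : 1 ≤ N) (T : ℝ) :
    ∀ᵐ z ∂((surfaceMeasure Ω).prod (volume.restrict (Ioo 0 T))),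
      z ∈ (frontier Ω ×ˢ Ioo 0 T) \ Z := by
  have := hΩ.isFiniteMeasure_surfaceMeasure hN
  have h1 : ∀ᵐ z ∂((surfaceMeasure Ω).prod (volume.restrict (Ioo 0 T))), z ∉ Z :=
    Measure.absolutelyContinuous_of_le (Measure.prod_mono le_rfl Measure.restrict_le_self)
      (measure_eq_zero_iff_ae_notMem.1
        (hΩ.prod_surfaceMeasure_eq_zero hN hu.isClosed_exceptional hu.exceptional_null))
  have h2 : ∀ᵐ z ∂((surfaceMeasure Ω).prod (volume.restrict (Ioo 0 T))),
      z ∈ frontier Ω ×ˢ Ioo 0 T := by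
    rw [surfaceMeasure] at this ⊢
    have h3 : ∀ᵐ x ∂(μHE[N - 1] : Measure (Space N)).restrict (frontier Ω), x ∈ frontier Ω :=
      ae_restrict_mem isClosed_frontier.measurableSet
    have h4 : ∀ᵐ t ∂(volume : Measure ℝ).restrict (Ioo 0 T), t ∈ Ioo 0 T :=
      ae_restrict_mem measurableSet_Ioo
    filter_upwards [Measure.quasiMeasurePreserving_fst.ae h3,
      Measure.quasiMeasurePreserving_snd.ae h4] with z hz1 hz2
    exact ⟨hz1, hz2⟩
  filter_upwards [h1, h2] with z hz1 hz2
  exact ⟨hz2, hz1⟩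

variable [Countable ι]

/-- Regular points have full measure in the open half-cylinder and so are dense. This keeps the
limit defining `p` from being vacuous, so that `p` inherits estimates from the gradient. -/
theorem neBot_nhdsWithin_regularPoints (hu : IsClassicalSolution c Ω n F Z G u₀ v₀ uS p u)
    (hΩ : IsOpen Ω) {z : SpaceTime N} (hx : z.1 ∈ closure Ω) (ht : 0 < z.2) :
    (𝓝[regularPoints Ω F Z] z).NeBot := by
  rw [← mem_closure_iff_nhdsWithin_neBot, mem_closure_iff_nhds]
  intro W hW
  have hz : z ∈ closure (Ω ×ˢ Ioi (0 : ℝ)) := by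
    rw [closure_prod_eq]
    exact ⟨hx, subset_closure ht⟩
  have hne : (interior W ∩ Ω ×ˢ Ioi (0 : ℝ)).Nonempty :=
    mem_closure_iff.1 hz _ isOpen_interior (mem_interior_iff_mem_nhds.2 hW)
  have hpos : 0 < volume (interior W ∩ Ω ×ˢ Ioi (0 : ℝ)) :=
    (isOpen_interior.inter (hΩ.prod isOpen_Ioi)).measure_pos _ hne
  have hfreq : ∃ᵐ w, w ∈ interior W ∩ Ω ×ˢ Ioi (0 : ℝ) :=
    frequently_ae_mem_iff.2 hpos.ne'
  obtain ⟨w, hw, hwR⟩ := (hfreq.and_eventually (ae_mem_regularPoints (Ω := Ω) (F := F)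
    hu.isClosed_exceptional hu.exceptional_null)).exists
  exact ⟨w, interior_subset hw.1, hwR hw.2.1 hw.2.2⟩

theorem exists_bound_normalDeriv (hu : IsClassicalSolution c Ω n F Z G u₀ v₀ uS p u)
    (hΩ : IsLyapunovDomain Ω n) (T : ℝ) : ∃ M, 0 ≤ M ∧ ∀ x ∈ frontier Ω, ∀ t ∈ Ioo 0 T,
      (x, t) ∉ Z → |p (x, t)| ≤ M := by
  obtain ⟨M, hM⟩ := hu.bounded_deriv T
  refine ⟨max M 0, le_max_right _ _, fun x hx t ht hZ => ?_⟩
  have := hu.neBot_nhdsWithin_regularPoints hΩ.isOpen (z := (x, t)) (frontier_subset_closure hx) ht.1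
  refine le_of_tendsto (hu.boundary_normal x hx t ht.1 hZ).abs ?_
  have h1 : ∀ᶠ w : SpaceTime N in 𝓝[regularPoints Ω F Z] (x, t), w.2 < T :=
    (continuous_snd.tendsto (x, t)).mono_left nhdsWithin_le_nhds |>.eventually (Iio_mem_nhds ht.2)
  filter_upwards [h1, self_mem_nhdsWithin] with w hw hwR
  have h2 := abs_real_inner_le_norm (gradX u w) (n x)
  rw [hΩ.norm_normal hx, mul_one] at h2
  exact (h2.trans (hM w hwR hw.le).2).trans (le_max_left _ _)

/-- The limit at `(x, t)` controls `⟪∇u, n x⟫` at all nearby regular points. Passing to the limit at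
another boundary point replaces `n x` by the normal there, at a cost bounded by `M` times the
oscillation of `n`. Measurability of `p` follows. -/
theorem continuousOn_normalDeriv (hu : IsClassicalSolution c Ω n F Z G u₀ v₀ uS p u)
    (hΩ : IsLyapunovDomain Ω n) : ContinuousOn p ((frontier Ω ×ˢ Ioi 0) \ Z) := by
  rintro ⟨x, t⟩ ⟨⟨hx, ht⟩, hZ⟩
  have ht' : 0 < t := ht
  obtain ⟨M, hM⟩ := hu.bounded_deriv (t + 1)
  rw [ContinuousWithinAt, Metric.tendsto_nhds]
  intro ε hε
  have hn : Tendsto (fun w : SpaceTime N => M * ‖n x - n w.1‖) (𝓝[(frontier Ω ×ˢ Ioi 0) \ Z] (x, t))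
      (𝓝 0) := by
    have h1 : Tendsto (fun w : SpaceTime N => w.1) (𝓝[(frontier Ω ×ˢ Ioi 0) \ Z] (x, t))
        (𝓝[frontier Ω] x) :=
      tendsto_nhdsWithin_of_tendsto_nhds_of_eventually_within _
        ((continuous_fst.tendsto (x, t)).mono_left nhdsWithin_le_nhds)
        (eventually_nhdsWithin_of_forall fun w hw => hw.1.1)
    have h2 := ((hΩ.continuousOn_normal x hx).tendsto.comp h1)
    have h3 := ((tendsto_const_nhds (x := n x)).sub h2).norm.const_mul M
    simpa using h3
  have h1 := (Metric.tendsto_nhds.1 (hu.boundary_normal x hx t ht hZ) (ε / 2) (half_pos hε))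
  rw [eventually_nhdsWithin_iff] at h1
  have h2 : ∀ᶠ w : SpaceTime N in 𝓝 (x, t), w.2 < t + 1 :=
    (continuous_snd.tendsto (x, t)).eventually (Iio_mem_nhds (lt_add_one t))
  filter_upwards [mem_nhdsWithin_of_mem_nhds (h1.and h2).eventually_nhds,
    hn.eventually (Iio_mem_nhds (half_pos hε)), self_mem_nhdsWithin] with z hz hzn hzA
  have hne := hu.neBot_nhdsWithin_regularPoints hΩ.isOpen (z := z)
    (frontier_subset_closure hzA.1.1) hzA.1.2
  have hlim := hu.boundary_normal z.1 hzA.1.1 z.2 hzA.1.2 hzA.2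
  have hle : |p z - p (x, t)| ≤ ε / 2 + M * ‖n x - n z.1‖ := by
    refine le_of_tendsto (hlim.sub_const (p (x, t))).abs ?_
    filter_upwards [mem_nhdsWithin_of_mem_nhds hz, self_mem_nhdsWithin] with w hw hwR
    have h3 := (hw.1 hwR).le
    rw [Real.dist_eq] at h3
    have h4 : |⟪gradX u w, n x - n z.1⟫| ≤ M * ‖n x - n z.1‖ :=
      (abs_real_inner_le_norm _ _).trans (by gcongr; exact (hM w hwR hw.2.le).2)
    rw [inner_sub_right] at h4
    rw [abs_le] at h3 h4 ⊢
    constructor <;> linarith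
  rw [Real.dist_eq]
  have : M * ‖n x - n z.1‖ < ε / 2 := hzn
  linarith

/-- The power transmitted through the boundary is bounded and measurable. -/
theorem exists_bound_boundary (hu : IsClassicalSolution c Ω n F Z G u₀ v₀ uS p u)
    (hΩ : IsLyapunovDomain Ω n) (T : ℝ) :
    (∃ M, 0 ≤ M ∧ ∀ z ∈ (frontier Ω ×ˢ Ioo 0 T) \ Z, |uS z * p z| ≤ M) ∧
      ContinuousOn (fun z => uS z * p z) ((frontier Ω ×ˢ Ioo 0 T) \ Z) := by
  obtain ⟨M, hM0, hM⟩ := hu.exists_bound_normalDeriv hΩ T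
  obtain ⟨M', hM'0, hM'⟩ := hu.exists_bound_u hΩ.isBounded T
  have heq : ∀ z ∈ (frontier Ω ×ˢ Ioo 0 T) \ Z, u z = uS z := fun z hz =>
    hu.boundary_value z.1 hz.1.1 z.2 hz.1.2.1.le
  refine ⟨⟨M' * M, by positivity, fun z hz => ?_⟩, ?_⟩
  · rw [abs_mul, ← heq z hz]
    gcongr
    · exact hM' _ (frontier_subset_closure hz.1.1) _ ⟨hz.1.2.1.le, hz.1.2.2.le⟩
    · exact hM z.1 hz.1.1 z.2 hz.1.2 hz.2
  · refine ContinuousOn.mul (ContinuousOn.congr ?_ fun z hz => (heq z hz).symm) ?_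
    · exact hu.continuousOn.mono fun z hz => ⟨frontier_subset_closure hz.1.1, hz.1.2.1.le⟩
    · exact (hu.continuousOn_normalDeriv hΩ).mono fun z hz => ⟨⟨hz.1.1, hz.1.2.1⟩, hz.2⟩

theorem integrable_boundary (hu : IsClassicalSolution c Ω n F Z G u₀ v₀ uS p u)
    (hΩ : IsLyapunovDomain Ω n) (hN : 1 ≤ N) (T : ℝ) :
    Integrable (fun z => uS z * p z) ((surfaceMeasure Ω).prod (volume.restrict (Ioo 0 T))) := by
  have := hΩ.isFiniteMeasure_surfaceMeasure hN
  obtain ⟨⟨M, -, hM⟩, hc⟩ := hu.exists_bound_boundary hΩ T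
  have hae := hu.ae_boundary hΩ hN T
  refine Integrable.of_bound (C := M) ?_ (hae.mono hM)
  rw [← Measure.restrict_eq_self_of_ae_mem hae]
  exact hc.aestronglyMeasurable ((isClosed_frontier.measurableSet.prod measurableSet_Ioo).diff
    hu.isClosed_exceptional.measurableSet)

end IsClassicalSolution

/-! ### The boundary identity -/

/-- Cutting off a test function along an open set near whose frontier it vanishes. -/
theorem IsTest.indicator {E : Type*} [NormedAddCommGroup E] [NormedSpace ℝ E] {U A : Set E}
    {φ : E → ℝ} (h : IsTest U φ) (hA : IsOpen A) (hfr : ∀ w ∈ frontier A, φ =ᶠ[𝓝 w] 0) :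
    IsTest (U ∩ A) (A.indicator φ) := by
  have hfr' : ∀ w ∈ frontier A, A.indicator φ =ᶠ[𝓝 w] 0 := fun w hw => by
    filter_upwards [hfr w hw] with y hy
    by_cases hyA : y ∈ A
    · rw [indicator_of_mem hyA, hy]
    · rw [indicator_of_notMem hyA, Pi.zero_apply]
  have hcase : ∀ w, w ∈ A ∨ A.indicator φ =ᶠ[𝓝 w] 0 := fun w => by
    by_cases hwA : w ∈ A
    · exact Or.inl hwA
    · refine Or.inr ?_
      by_cases hwc : w ∈ closure A
      · exact hfr' w (by rw [hA.frontier_eq]; exact ⟨hwc, hwA⟩)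
      · filter_upwards [isClosed_closure.isOpen_compl.mem_nhds hwc] with y hy
        exact indicator_of_notMem (fun h => hy (subset_closure h)) _
  have hsupp : Function.support (A.indicator φ) ⊆ Function.support φ := by
    rw [support_indicator]
    exact inter_subset_right
  refine ⟨contDiff_iff_contDiffAt.2 fun w => ?_, h.2.mono hsupp, fun w hw => ⟨?_, ?_⟩⟩
  · rcases hcase w with hw | hw
    · refine h.1.contDiffAt.congr_of_eventuallyEq ?_
      filter_upwards [hA.mem_nhds hw] with y hy
      exact indicator_of_mem hy _
    · exact contDiffAt_const.congr_of_eventuallyEq hw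
  · exact h.3 (closure_mono hsupp hw)
  · exact (hcase w).resolve_right fun h => notMem_tsupport_iff_eventuallyEq.2 h hw

theorem BoundaryChart.ae_graph_notMem {N : ℕ} {Ω : Set (Space N)} {n : Space N → Space N}
    {x₀ e : Space N} {ε : NNReal} (b : BoundaryChart Ω n x₀ e ε) (hN : 1 ≤ N)
    {Z : Set (SpaceTime N)} (hZc : IsClosed Z) (hZ : μH[(N : ℝ)] Z = 0) :
    ∀ᵐ q ∂((volume.restrict (Metric.ball 0 b.δ)).prod (volume : Measure ℝ)),
      (b.graph q.1, q.2) ∉ Z := by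
  have h := measure_eq_zero_iff_ae_notMem.1 (b.graphMeasure_prod_eq_zero hN hZc hZ)
  rw [b.graphMeasure_prod_eq] at h
  exact ae_of_ae_map
    (b.continuous_graph.prodMap continuous_id).measurable.aemeasurable h

theorem BoundaryChart.mem_iff_lt {N : ℕ} {Ω : Set (Space N)} {n : Space N → Space N}
    {x₀ e : Space N} {ε : ℝ} (b : BoundaryChart Ω n x₀ e ε) {y : (Submodule.span ℝ {e})ᗮ}
    (hy : y ∈ Metric.ball 0 b.δ) {τ : ℝ} (hτ : τ ∈ Icc (-b.κ) b.κ) :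
    (chartPoint x₀ e (y, τ) ∈ Ω ↔ τ < b.g y) ∧ (b.ρ (chartPoint x₀ e (y, τ)) = 0 ↔ τ = b.g y) := by
  have hmono := strictMonoOn_chart_line (convex_Icc _ _)
    (fun τ hτ => (b.contDiffAt y hy τ hτ).differentiableAt (by norm_num))
    (fun τ hτ => b.fderiv_pos y hy τ hτ)
  have hg := Ioo_subset_Icc_self (b.g_mem y hy)
  rw [b.mem_iff y hy τ hτ, ← b.eqn_g y hy]
  exact ⟨hmono.lt_iff_lt hτ hg, hmono.injOn.eq_iff hτ hg⟩

namespace IsClassicalSolution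

variable {ι : Type*} {N : ℕ} {c : ℝ} {Ω : Set (Space N)} {n : Space N → Space N}
  {F : ι → WaveFront N c} {Z : Set (SpaceTime N)} {G : SpaceTime N → ℝ} {u₀ v₀ : Space N → ℝ}
  {uS p : SpaceTime N → ℝ} {u : SpaceTime N → ℝ}

/-- The derivative of `ρ` may be frozen at `x` because the gradient of `u` is bounded; there it is a
multiple of the inner product with the normal. -/
theorem tendsto_fderiv_flux_boundary (hu : IsClassicalSolution c Ω n F Z G u₀ v₀ uS p u)
    {x : Space N} (hx : x ∈ frontier Ω) {t : ℝ} (ht : 0 < t) (hZ : (x, t) ∉ Z) {ρ : Space N → ℝ} (hρ : ContDiffAt ℝ 1 ρ x)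
    (hn : ∀ v, fderiv ℝ ρ x v = ‖fderiv ℝ ρ x‖ * ⟪n x, v⟫) :
    Tendsto (fun w => fderiv ℝ ρ w.1 (u w • gradX u w)) (𝓝[regularPoints Ω F Z] (x, t))
      (𝓝 (uS (x, t) * p (x, t) * ‖fderiv ℝ ρ x‖)) := by
  obtain ⟨M, hM0, hM⟩ := hu.exists_bound_deriv (t + 1)
  have hle : 𝓝[regularPoints Ω F Z] (x, t) ≤ 𝓝 (x, t) := nhdsWithin_le_nhds
  have hu' : Tendsto u (𝓝[regularPoints Ω F Z] (x, t)) (𝓝 (uS (x, t))) := by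
    rw [← hu.boundary_value x hx t ht.le]
    exact (hu.continuousOn (x, t) ⟨frontier_subset_closure hx, ht.le⟩).mono_left
      (nhdsWithin_mono _ fun w hw => ⟨subset_closure hw.1, hw.2.1.le⟩)
  have h1 : Tendsto (fun w => fderiv ℝ ρ x (gradX u w)) (𝓝[regularPoints Ω F Z] (x, t))
      (𝓝 (‖fderiv ℝ ρ x‖ * p (x, t))) := by
    refine ((hu.boundary_normal x hx t ht hZ).const_mul _).congr fun w => ?_
    rw [hn, real_inner_comm]
  have h2 : Tendsto (fun w : SpaceTime N => (fderiv ℝ ρ w.1 - fderiv ℝ ρ x) (gradX u w))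
      (𝓝[regularPoints Ω F Z] (x, t)) (𝓝 0) := by
    have h3 : Tendsto (fun w : SpaceTime N => ‖fderiv ℝ ρ w.1 - fderiv ℝ ρ x‖ * M)
        (𝓝[regularPoints Ω F Z] (x, t)) (𝓝 0) := by
      have h4 : Tendsto (fun w : SpaceTime N => fderiv ℝ ρ w.1) (𝓝 (x, t)) (𝓝 (fderiv ℝ ρ x)) :=
        (continuousAt_fderiv_of_contDiffAt hρ).tendsto.comp (continuous_fst.tendsto (x, t))
      have := ((h4.sub_const (fderiv ℝ ρ x)).norm.mul_const M).mono_left hle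
      simpa using this
    refine squeeze_zero_norm' ?_ h3
    have h5 : ∀ᶠ w : SpaceTime N in 𝓝[regularPoints Ω F Z] (x, t), w.2 < t + 1 :=
      ((continuous_snd.tendsto (x, t)).mono_left hle).eventually (Iio_mem_nhds (lt_add_one t))
    filter_upwards [h5, self_mem_nhdsWithin] with w hw hwR
    refine (ContinuousLinearMap.le_opNorm _ _).trans ?_
    gcongr
    exact (hM w hwR hw.le).2
  have h3 := hu'.mul (h2.add h1)
  rw [zero_add] at h3
  refine (h3.congr fun w => ?_).trans (le_of_eq (by ring_nf))
  rw [map_smul, smul_eq_mul, sub_apply]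
  ring

variable [Countable ι]

/-- The flux functional on test functions supported in a chart of the boundary. -/
theorem weakFlux_eq_integral_graph (hu : IsClassicalSolution c Ω n F Z G u₀ v₀ uS p u)
    (hc : 0 < c) (hΩ : IsLyapunovDomain Ω n) (hN : 1 ≤ N) {T : ℝ}
    (hG : IntegrableOn G (Ω ×ˢ Ioo 0 T) volume) {x₀ e : Space N} {ε : NNReal}
    (b : BoundaryChart Ω n x₀ e ε) {φ : SpaceTime N → ℝ} (hφ : IsTest (b.box ×ˢ Ioo 0 T) φ) :
    weakFlux (volume.restrict (Ω ×ˢ Ioo 0 T)) (fluxField c u) (fluxDiv c u G) φ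
      = ∫ q, φ (b.graph q.1, q.2) * (uS (b.graph q.1, q.2) * p (b.graph q.1, q.2)
          * ‖fderiv ℝ b.ρ (b.graph q.1)‖) / fderiv ℝ b.ρ (b.graph q.1) e
        ∂((volume.restrict (Metric.ball 0 b.δ)).prod (volume.restrict (Ioo 0 T))) := by
  obtain ⟨M, hfield⟩ := hu.exists_isBoundedField hΩ.isOpen.measurableSet hΩ.isBounded hG
  obtain ⟨M', hM'0, hM'⟩ := hu.exists_bound_fluxField hΩ.isBounded T
  obtain ⟨A, hA0, hA⟩ := hφ.exists_bound
  have hQo : IsOpen (Ω ×ˢ Ioo (0 : ℝ) T) := hΩ.isOpen.prod isOpen_Ioo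
  set Q := Ω ×ˢ Ioo (0 : ℝ) T with hQ
  set V := fluxField c u with hV
  have hρd : ∀ w ∈ b.box ×ˢ Ioo 0 T, ContDiffAt ℝ 1 (fun w : SpaceTime N => b.ρ w.1) w := by
    rintro w ⟨⟨⟨y, τ⟩, ⟨hy, hτ⟩, hq⟩, -⟩
    have := b.contDiffAt y hy τ (Ioo_subset_Icc_self hτ)
    rw [hq] at this
    exact this.comp w contDiffAt_fst
  have hfd : ∀ w ∈ b.box ×ˢ Ioo 0 T, ∀ v,
      fderiv ℝ (fun w : SpaceTime N => b.ρ w.1) w v = fderiv ℝ b.ρ w.1 v.1 := by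
    rintro w ⟨⟨⟨y, τ⟩, ⟨hy, hτ⟩, hq⟩, -⟩ v
    have := (b.contDiffAt y hy τ (Ioo_subset_Icc_self hτ)).differentiableAt (by norm_num)
    rw [hq] at this
    have h2 := (this.hasFDerivAt.comp w hasFDerivAt_fst).fderiv
    rw [show (fun w : SpaceTime N => b.ρ w.1) = b.ρ ∘ Prod.fst from rfl, h2]
    rfl
  let χ : ℕ → SpaceTime N → ℝ := fun m w => cutoff (m * b.ρ w.1)
  have hχ : ∀ (m : ℕ), ∀ w ∈ tsupport φ, ContDiffAt ℝ 1 (χ m) w :=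
    fun m w hw => (cutoff_contDiff.of_le (by norm_num)).contDiffAt.comp w
      (contDiffAt_const.mul (hρd w (hφ.3 hw)))
  have hlim := tendsto_integral_mul_fderiv_cutoff hfield hφ (χ := χ) hχ
    (fun m w => by rw [abs_of_nonneg (cutoff_nonneg _)]; exact cutoff_le_one _)
    (by
      filter_upwards [ae_restrict_mem hQo.measurableSet] with w hw hws
      refine tendsto_cutoff_nat_mul fun h => ?_
      obtain ⟨⟨y, τ⟩, ⟨hy, hτ⟩, hq⟩ := (hφ.3 hws).1
      rw [← hq] at h
      have h1 := b.mem_iff_lt hy (Ioo_subset_Icc_self hτ)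
      exact (h1.1.1 (hq ▸ hw.1)).ne (h1.2.1 h))
    (by
      intro m
      have ht := hφ.mul_of_contDiffAt (hχ m)
      have hAo : IsOpen (Ω ×ˢ (univ : Set ℝ)) := hΩ.isOpen.prod isOpen_univ
      -- The cutoff vanishes near the lateral boundary, so truncating the product to `Ω` keeps it a
      -- test function, now supported in the interior, and leaves the integral over `Q` unchanged.
      have hind := ht.indicator hAo fun w hw => by
        have hwf : w.1 ∈ frontier Ω := by
          rw [frontier_prod_univ_eq] at hw
          exact hw.1
        by_cases hws : w ∈ tsupport φ
        · obtain ⟨⟨y, τ⟩, ⟨hy, hτ⟩, hq⟩ := (hφ.3 hws).1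
          have h0 : b.ρ w.1 = 0 := by
            rw [← hq] at hwf ⊢
            rw [(b.frontier_iff y hy τ (Ioo_subset_Icc_self hτ)).1 hwf]
            exact b.eqn_g y hy
          have hcont : ContinuousAt (fun y : SpaceTime N => |(m : ℝ) * b.ρ y.1|) w :=
            (continuousAt_const.mul (hρd w (hφ.3 hws)).continuousAt).abs
          have h1 : ∀ᶠ y : SpaceTime N in 𝓝 w, |(m : ℝ) * b.ρ y.1| < 1 :=
            hcont.eventually_lt continuousAt_const (by simp [h0])
          filter_upwards [h1] with y hy
          simp [χ, cutoff_eq_zero hy.le]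
        · filter_upwards [(isClosed_tsupport φ).isOpen_compl.mem_nhds hws] with y hy
          simp [image_eq_zero_of_notMem_tsupport hy]
      rw [← hu.weakFlux_eq_zero_interior hc hΩ.isOpen hΩ.isBounded hG
        (hind.mono fun w hw => ⟨hw.2.1, hw.1.2⟩)]
      refine setIntegral_congr_fun hQo.measurableSet fun w hw => ?_
      have heq : (Ω ×ˢ (univ : Set ℝ)).indicator (χ m * φ) =ᶠ[𝓝 w] χ m * φ := by
        filter_upwards [hAo.mem_nhds ⟨hw.1, mem_univ _⟩] with y hy
        exact indicator_of_mem hy _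
      simp only [heq.fderiv_eq, heq.self_of_nhds]
      rfl)
  -- passing to the chart
  have hΘ := measurePreserving_spaceTimeChart x₀ b.norm_e
  have hΘe := measurableEmbedding_spaceTimeChart x₀ b.norm_e
  set Θ := spaceTimeChart x₀ e with hΘdef
  set B := Metric.ball (0 : (Submodule.span ℝ {e})ᗮ) b.δ with hB
  set D : Set (((Submodule.span ℝ {e})ᗮ × ℝ) × ℝ) := (B ×ˢ Ioo 0 T) ×ˢ Ioo (-b.κ) b.κ with hD
  have hDm : MeasurableSet D :=
    ((Metric.isOpen_ball.prod isOpen_Ioo).prod isOpen_Ioo).measurableSet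
  let S : Set (((Submodule.span ℝ {e})ᗮ × ℝ) × ℝ) := {q | q.2 < b.g q.1.1}
  have hgc : Continuous b.g :=
    (LipschitzWith.of_dist_le_mul (K := ε) fun y y' => by
      rw [Real.dist_eq, dist_eq_norm]; exact b.lipschitz y y').continuous
  have hSm : MeasurableSet S :=
    (isOpen_lt continuous_snd (hgc.comp (continuous_fst.comp continuous_fst))).measurableSet
  have hDbox : ∀ q ∈ D, Θ q ∈ b.box ×ˢ Ioo 0 T := fun q hq =>
    ⟨b.chartPoint_mem_box.2 ⟨hq.1.1, hq.2⟩, hq.1.2⟩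
  have hDS : ∀ q ∈ D, (Θ q ∈ Q ↔ q ∈ S) := fun q hq => by
    have := (b.mem_iff_lt hq.1.1 (Ioo_subset_Icc_self hq.2)).1
    exact ⟨fun h => this.1 h.1, fun h => ⟨this.2 h, hq.1.2⟩⟩
  have hDinv : ∀ q, Θ q ∈ b.box ×ˢ Ioo 0 T → q ∈ D := fun q hq => by
    have := b.chartPoint_mem_box.1 hq.1
    exact ⟨⟨this.1, hq.2⟩, this.2⟩
  -- Within the chart `Ω` is the region `S` below the graph; the indicator lets the integration run
  -- over a product.
  let h : ℕ → ((Submodule.span ℝ {e})ᗮ × ℝ) × ℝ → ℝ := fun m =>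
    S.indicator fun q => φ (Θ q) * fderiv ℝ (χ m) (Θ q) (V (Θ q))
  have hmeas : volume.restrict D = ((volume.restrict B).prod (volume.restrict (Ioo 0 T))).prod
      (volume.restrict (Ioo (-b.κ) b.κ)) := by
    rw [Measure.prod_restrict, Measure.prod_restrict]
    rfl
  have hint : ∀ m, ∫ w in Q, φ w * fderiv ℝ (χ m) w (V w) = ∫ q, h m q
      ∂(((volume.restrict B).prod (volume.restrict (Ioo 0 T))).prod
        (volume.restrict (Ioo (-b.κ) b.κ))) := by
    intro m
    rw [← hmeas, setIntegral_indicator hSm, ← hΘ.setIntegral_preimage_emb hΘe]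
    refine setIntegral_eq_of_subset_of_forall_sdiff_eq_zero
      (hΘ.measurable hQo.measurableSet) (fun q hq => (hDS q hq.1).2 hq.2) fun q hq => ?_
    have : Θ q ∉ tsupport φ := fun hs => hq.2 (by
      have := hDinv q (hφ.3 hs)
      exact ⟨this, (hDS q this).1 hq.1⟩)
    rw [image_eq_zero_of_notMem_tsupport this, zero_mul]
  have hhi : ∀ m, Integrable (h m) (((volume.restrict B).prod (volume.restrict (Ioo 0 T))).prod
        (volume.restrict (Ioo (-b.κ) b.κ))) := by
    intro m
    rw [← hmeas]
    have h1 := (weakFlux_mul hfield hφ (hχ m)).1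
    have h2 : IntegrableOn (fun q => φ (Θ q) * fderiv ℝ (χ m) (Θ q) (V (Θ q))) (Θ ⁻¹' Q) volume :=
      (hΘ.integrableOn_comp_preimage hΘe).2 h1
    rw [integrable_indicator_iff hSm]
    unfold IntegrableOn
    rw [Measure.restrict_restrict hSm]
    exact h2.mono_set fun q hq => (hDS q hq.2).2 hq.1
  simp_rw [hint] at hlim
  -- the integrand along the lines normal to the tangent plane
  let H : ((Submodule.span ℝ {e})ᗮ × ℝ) × ℝ → ℝ := fun q =>
    φ (Θ q) * fderiv ℝ b.ρ (Θ q).1 (V (Θ q)).1 / fderiv ℝ b.ρ (Θ q).1 e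
  have hpos : ∀ q ∈ D, 0 < fderiv ℝ b.ρ (Θ q).1 e := fun q hq =>
    b.fderiv_pos q.1.1 hq.1.1 q.2 (Ioo_subset_Icc_self hq.2)
  -- As at a front, but the derivative along `e` now plays the part of the time derivative.
  have hHk : ∀ m : ℕ, ∀ q ∈ D, φ (Θ q) * fderiv ℝ (χ m) (Θ q) (V (Θ q))
      = H q * (deriv cutoff (m * b.ρ (Θ q).1) * (m * fderiv ℝ b.ρ (Θ q).1 e)) := by
    intro m q hq
    have h1 := (hpos q hq).ne'
    rw [hasFDerivAt_cutoff_comp _ ((hρd _ (hDbox q hq)).differentiableAt (by norm_num)),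
      hfd _ (hDbox q hq)]
    simp only [H]
    field_simp
  have hHb : ∀ q ∈ D, Θ q ∈ regularPoints Ω F Z → |H q| ≤ A * ((1 + ε) * M') := by
    intro q hq hqR
    have h1 : |fderiv ℝ b.ρ (Θ q).1 (V (Θ q)).1|
        ≤ (1 + ε) * fderiv ℝ b.ρ (Θ q).1 e * M' := by
      refine ((fderiv ℝ b.ρ (Θ q).1).le_opNorm _).trans ?_
      gcongr
      · exact mul_nonneg (by positivity) (hpos q hq).le
      · exact b.norm_fderiv_le q.1.1 hq.1.1 q.2 (Ioo_subset_Icc_self hq.2)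
      · exact (norm_fst_le _).trans (hM' _ hqR hq.1.2.2.le)
    simp only [H]
    rw [abs_div, abs_mul, abs_of_pos (hpos q hq), div_le_iff₀ (hpos q hq)]
    calc _ ≤ A * ((1 + ε) * fderiv ℝ b.ρ (Θ q).1 e * M') := by
          gcongr
          exact (hA _).1
      _ = _ := by ring
  have hHm : AEStronglyMeasurable (S.indicator H)
      (((volume.restrict B).prod (volume.restrict (Ioo 0 T))).prod
        (volume.restrict (Ioo (-b.κ) b.κ))) := by
    rw [← hmeas, aestronglyMeasurable_indicator_iff hSm, Measure.restrict_restrict hSm]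
    have hSD : MeasurableSet (S ∩ D) := hSm.inter hDm
    have hΘc : Continuous Θ := continuous_spaceTimeChart x₀ e
    have h1 : AEStronglyMeasurable (fun q => V (Θ q)) (volume.restrict (S ∩ D)) := by
      have h2 : AEStronglyMeasurable (fun q => V (Θ q)) (volume.restrict (Θ ⁻¹' Q)) :=
        hfield.measurable.comp_measurePreserving (hΘ.restrict_preimage hQo.measurableSet)
      exact h2.mono_set fun q hq => (hDS q hq.2).2 hq.1
    have h2 : AEStronglyMeasurable (fun q => fderiv ℝ b.ρ (Θ q).1) (volume.restrict (S ∩ D)) :=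
      ContinuousOn.aestronglyMeasurable (fun q hq => ContinuousAt.continuousWithinAt <|
        ContinuousAt.comp (f := fun q => (Θ q).1)
          (continuousAt_fderiv_of_contDiffAt (b.contDiffAt q.1.1 hq.2.1.1 q.2
            (Ioo_subset_Icc_self hq.2.2))) (continuous_fst.comp hΘc).continuousAt) hSD
    have h3 : AEStronglyMeasurable (fun q => fderiv ℝ b.ρ (Θ q).1 (V (Θ q)).1)
        (volume.restrict (S ∩ D)) :=
      (continuous_fst.clm_apply (continuous_fst.comp continuous_snd)).comp_aestronglyMeasurable
        (h2.prodMk h1)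
    have h4 : AEStronglyMeasurable (fun q => fderiv ℝ b.ρ (Θ q).1 e) (volume.restrict (S ∩ D)) :=
      (ContinuousLinearMap.apply ℝ ℝ e).continuous.comp_aestronglyMeasurable h2
    exact (((hφ.1.continuous.comp hΘc).aestronglyMeasurable.mul h3).aemeasurable.div
      h4.aemeasurable).aestronglyMeasurable
  have hreg : ∀ᵐ q ∂((volume.restrict B).prod (volume.restrict (Ioo 0 T))), ∀ᵐ τ : ℝ,
      (Θ (q, τ)).1 ∈ Ω → 0 < (Θ (q, τ)).2 → Θ (q, τ) ∈ regularPoints Ω F Z := by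
    have h1 := hΘ.quasiMeasurePreserving.ae (ae_mem_regularPoints (Ω := Ω) (F := F)
      hu.isClosed_exceptional hu.exceptional_null)
    have h2 := Measure.ae_ae_of_ae_prod h1
    rw [Measure.prod_restrict]
    exact ae_restrict_of_ae h2
  have hZae : ∀ᵐ q ∂((volume.restrict B).prod (volume.restrict (Ioo 0 T))),
      (b.graph q.1, q.2) ∉ Z :=
    Measure.absolutelyContinuous_of_le (Measure.prod_mono le_rfl Measure.restrict_le_self)
      (b.ae_graph_notMem hN hu.isClosed_exceptional hu.exceptional_null)
  have hmem : ∀ᵐ q ∂((volume.restrict B).prod (volume.restrict (Ioo 0 T))), q ∈ B ×ˢ Ioo 0 T := by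
    rw [Measure.prod_restrict]
    exact ae_restrict_mem (Metric.isOpen_ball.measurableSet.prod measurableSet_Ioo)
  have hfib : ∀ᵐ q ∂((volume.restrict B).prod (volume.restrict (Ioo 0 T))),
      (∀ m, |∫ τ in Ioo (-b.κ) b.κ, h m (q, τ)| ≤ A * ((1 + ε) * M')) ∧
      Tendsto (fun m => ∫ τ in Ioo (-b.κ) b.κ, h m (q, τ)) atTop
        (𝓝 (φ (b.graph q.1, q.2) * (uS (b.graph q.1, q.2) * p (b.graph q.1, q.2)
          * ‖fderiv ℝ b.ρ (b.graph q.1)‖) / fderiv ℝ b.ρ (b.graph q.1) e * -1)) := by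
    filter_upwards [hHm.prodMk_left, hreg, hZae, hmem] with q hqm hqR hqZ hqB
    obtain ⟨y, s⟩ := q
    have hy : y ∈ B := hqB.1
    have hgm := b.g_mem y hy
    have hgI := Ioo_subset_Icc_self hgm
    have hsubI : Icc (-b.κ) (b.g y) ⊆ Icc (-b.κ) b.κ := Icc_subset_Icc_right hgm.2.le
    have hsub : Ioo (-b.κ) (b.g y) ⊆ Ioo (-b.κ) b.κ := Ioo_subset_Ioo_right hgm.2.le
    have hinD : ∀ τ ∈ Ioo (-b.κ) (b.g y), ((y, s), τ) ∈ D := fun τ hτ => ⟨hqB, hsub hτ⟩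
    have hinS : ∀ τ ∈ Ioo (-b.κ) (b.g y), ((y, s), τ) ∈ S := fun τ hτ => hτ.2
    have heq : ∀ m : ℕ, ∫ τ in Ioo (-b.κ) b.κ, h m ((y, s), τ)
        = ∫ τ in Ioo (-b.κ) (b.g y), H ((y, s), τ) *
          (deriv cutoff (m * b.ρ (chartPoint x₀ e (y, τ)))
            * (m * fderiv ℝ b.ρ (chartPoint x₀ e (y, τ)) e)) := by
      intro m
      rw [setIntegral_eq_of_subset_of_forall_sdiff_eq_zero measurableSet_Ioo hsub
        (f := fun τ => h m ((y, s), τ))]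
      · refine setIntegral_congr_fun measurableSet_Ioo fun τ hτ => ?_
        simp only [h]
        rw [indicator_of_mem (hinS τ hτ), hHk m _ (hinD τ hτ)]
        rfl
      · intro τ hτ
        simp only [h]
        exact indicator_of_notMem (fun hS : ((y, s), τ) ∈ S => hτ.2 ⟨hτ.1.1, hS⟩) _
    simp_rw [heq]
    have hRτ : ∀ᵐ τ : ℝ, τ ∈ Ioo (-b.κ) (b.g y) → Θ ((y, s), τ) ∈ regularPoints Ω F Z := by
      filter_upwards [hqR] with τ hτ hτI
      have := (hDS _ (hinD τ hτI)).2 (hinS τ hτI)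
      exact hτ this.1 this.2.1
    have hd : ∀ τ ∈ Icc (-b.κ) b.κ, HasDerivAt (fun τ => b.ρ (chartPoint x₀ e (y, τ)))
        (fderiv ℝ b.ρ (chartPoint x₀ e (y, τ)) e) τ := fun τ hτ =>
      hasDerivAt_comp_add_smul (g := b.ρ)
        ((b.contDiffAt y hy τ hτ).differentiableAt (by norm_num)).hasFDerivAt
    have hdc : ContinuousOn (fun τ => fderiv ℝ b.ρ (chartPoint x₀ e (y, τ))) (Icc (-b.κ) b.κ) :=
      fun τ hτ => ContinuousAt.continuousWithinAt <|
        ContinuousAt.comp (f := fun τ => chartPoint x₀ e (y, τ))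
          (continuousAt_fderiv_of_contDiffAt (b.contDiffAt y hy τ hτ))
          ((continuous_chartPoint x₀ e).comp (Continuous.prodMk_right y)).continuousAt
    have hle0 : ∀ τ ∈ Icc (-b.κ) (b.g y), b.ρ (chartPoint x₀ e (y, τ)) ≤ 0 := fun τ hτ => by
      have h1 := b.mem_iff_lt hy (hsubI hτ)
      rcases hτ.2.lt_or_eq with hlt | heq
      · exact ((b.mem_iff y hy τ (hsubI hτ)).1 (h1.1.2 hlt)).le
      · exact (h1.2.2 heq).le
    have hlimτ : Tendsto (fun τ => Θ ((y, s), τ)) (𝓝[Ioo (-b.κ) (b.g y)] (b.g y) ⊓ ae volume)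
        (𝓝[regularPoints Ω F Z] (b.graph y, s)) := by
      rw [tendsto_nhdsWithin_iff]
      refine ⟨(((continuous_spaceTimeChart x₀ e).comp
        (Continuous.prodMk_right (y, s))).tendsto (b.g y)).mono_left
          (inf_le_left.trans nhdsWithin_le_nhds), ?_⟩
      filter_upwards [mem_inf_of_left self_mem_nhdsWithin,
        mem_inf_of_right (f := 𝓝[Ioo (-b.κ) (b.g y)] (b.g y)) hRτ] with τ h1 h2
      exact h2 h1
    have hnn := hlimτ.mono_right nhdsWithin_le_nhds
    -- The boundary is reached from inside at the upper end point, so the mass is `-1` and nothing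
    -- compensates it: this is the boundary flux.
    have hres := integral_mul_deriv_cutoff (α := -b.κ) (β := b.g y) (θ := b.g y) (L := -1) hgm.1
      (fun τ hτ => hd τ (hsubI hτ))
      ((hdc.mono hsubI).clm_apply continuousOn_const) (Or.inr ⟨rfl, rfl⟩) (b.eqn_g y hy)
      (fun τ hτ hne h0 => hne ((b.mem_iff_lt hy (hsubI hτ)).2.1 h0))
      (Or.inr fun τ hτ => mul_nonpos_of_nonpos_of_nonneg (hle0 τ hτ)
        (b.fderiv_pos y hy τ (hsubI hτ)).le)
      (F := fun τ => H ((y, s), τ)) (M := A * ((1 + ε) * M')) (by positivity)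
      ((hqm.mono_set hsub).congr (by
        filter_upwards [ae_restrict_mem measurableSet_Ioo] with τ hτ
        exact indicator_of_mem (hinS τ hτ) _))
      (by
        filter_upwards [ae_restrict_mem measurableSet_Ioo, ae_restrict_of_ae hRτ] with τ hτ hτR
        exact hHb _ (hinD τ hτ) (hτR hτ))
      (Tendsto.div ((hφ.1.continuous.continuousAt.tendsto.comp hnn).mul
          ((hu.tendsto_fderiv_flux_boundary (b.graph_mem_frontier hy) hqB.2.1 hqZ
            (b.contDiffAt y hy _ hgI) (b.normal y hy)).comp hlimτ))
        ((ContinuousAt.clm_apply (continuousAt_fderiv_of_contDiffAt (b.contDiffAt y hy _ hgI))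
          continuousAt_const).tendsto.comp ((continuous_fst.tendsto _).comp hnn))
        (b.fderiv_pos y hy _ hgI).ne')
    exact hres.2
  have hfin := b.isFiniteMeasure_restrict_ball
  have hlim0 := tendsto_integral_prod_of_fiberwise hhi
    (integrable_const (A * ((1 + ε) * M'))) (fun m => hfib.mono fun q hq => hq.1 m)
    (hfib.mono fun q hq => hq.2)
  have hfinal := tendsto_nhds_unique hlim hlim0
  rw [integral_mul_const] at hfinal
  linarith

end IsClassicalSolution

/-! ### From the tangent plane to the surface integral -/

namespace IsClassicalSolution

variable {ι : Type*} [Countable ι] {N : ℕ} {c : ℝ} {Ω : Set (Space N)} {n : Space N → Space N}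
  {F : ι → WaveFront N c} {Z : Set (SpaceTime N)} {G : SpaceTime N → ℝ} {u₀ v₀ : Space N → ℝ}
  {uS p : SpaceTime N → ℝ} {u : SpaceTime N → ℝ}

theorem integrable_mul_boundary (hu : IsClassicalSolution c Ω n F Z G u₀ v₀ uS p u)
    (hΩ : IsLyapunovDomain Ω n) (hN : 1 ≤ N) (T : ℝ) {U : Set (SpaceTime N)}
    {φ : SpaceTime N → ℝ} (hφ : IsTest U φ) : Integrable (fun z => φ z * (uS z * p z))
      ((surfaceMeasure Ω).prod (volume.restrict (Ioo 0 T))) := by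
  obtain ⟨A, -, hA⟩ := hφ.exists_bound
  exact (hu.integrable_boundary hΩ hN T).bdd_mul hφ.1.continuous.aestronglyMeasurable
    (ae_of_all _ fun z => (hA z).1)

/-- Two errors are added: the obliqueness factor `‖Dρ‖ / Dρ(e)` is within `ε` of one, and the
surface measure is within the factor `(1 + ε) ^ (N - 1)` of the tangent-plane measure. -/
theorem abs_weakFlux_sub_le (hu : IsClassicalSolution c Ω n F Z G u₀ v₀ uS p u)
    (hc : 0 < c) (hΩ : IsLyapunovDomain Ω n) (hN : 1 ≤ N) {T : ℝ}
    (hG : IntegrableOn G (Ω ×ˢ Ioo 0 T) volume) {x₀ e : Space N} {ε : NNReal}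
    (b : BoundaryChart Ω n x₀ e ε) {φ : SpaceTime N → ℝ} (hφ : IsTest (b.box ×ˢ Ioo 0 T) φ)
    {M : ℝ} (hM : ∀ z ∈ (frontier Ω ×ˢ Ioo 0 T) \ Z, |uS z * p z| ≤ M) (hM0 : 0 ≤ M) :
    |weakFlux (volume.restrict (Ω ×ˢ Ioo 0 T)) (fluxField c u) (fluxDiv c u G) φ
      - ∫ z, φ z * (uS z * p z) ∂((surfaceMeasure Ω).prod (volume.restrict (Ioo 0 T)))|
    ≤ (ε + ((1 + ε) ^ (N - 1) - 1)) * M *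
      ∫ z, |φ z| ∂((surfaceMeasure Ω).prod (volume.restrict (Ioo 0 T))) := by
  have hσ := hΩ.isFiniteMeasure_surfaceMeasure hN
  have hfin := b.isFiniteMeasure_restrict_ball
  obtain ⟨A, hA0, hA⟩ := hφ.exists_bound
  set lam := (volume : Measure ℝ).restrict (Ioo 0 T) with hlam
  set σ := surfaceMeasure Ω
  set w : SpaceTime N → ℝ := fun z => uS z * p z
  set K : NNReal := (1 + ε) ^ (N - 1)
  have hK1 : (1 : ℝ) ≤ K := by
    simp only [K, NNReal.coe_pow, NNReal.coe_add, NNReal.coe_one]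
    exact one_le_pow₀ (by simp)
  have h1 : b.graphMeasure.prod lam ≤ (σ.restrict b.box).prod lam :=
    Measure.prod_mono (b.graphMeasure_le hN) le_rfl
  have h2 : (σ.restrict b.box).prod lam ≤ K • b.graphMeasure.prod lam := by
    refine (Measure.prod_mono (b.surfaceMeasure_restrict_le hN) le_rfl).trans (le_of_eq ?_)
    rw [Measure.prod_smul_left]
  have h3 : (σ.restrict b.box).prod lam ≤ σ.prod lam :=
    Measure.prod_mono Measure.restrict_le_self le_rfl
  have hprod : (σ.restrict b.box).prod lam = (σ.prod lam).restrict (b.box ×ˢ univ) := by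
    rw [← Measure.prod_restrict, Measure.restrict_univ]
  have hbox : ∀ f : SpaceTime N → ℝ, (∀ z, φ z = 0 → f z = 0) →
      ∫ z, f z ∂((σ.restrict b.box).prod lam) = ∫ z, f z ∂(σ.prod lam) := by
    intro f hf
    rw [hprod]
    refine setIntegral_eq_integral_of_forall_compl_eq_zero fun z hz => hf z ?_
    exact image_eq_zero_of_notMem_tsupport fun h => hz ⟨(hφ.3 h).1, mem_univ _⟩
  have hiσ : Integrable (fun z => φ z * w z) ((σ.restrict b.box).prod lam) :=
    (hu.integrable_mul_boundary hΩ hN T hφ).mono_measure h3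
  have hiν := hiσ.mono_measure h1
  have hφσ : Integrable (fun z => |φ z|) ((σ.restrict b.box).prod lam) :=
    (Integrable.of_bound hφ.1.continuous.aestronglyMeasurable A (ae_of_all _ fun z => (hA z).1)).abs
  have hwν : ∀ᵐ z ∂(b.graphMeasure.prod lam), |w z| ≤ M :=
    Measure.absolutelyContinuous_of_le (h1.trans h3) ((hu.ae_boundary hΩ hN T).mono hM)
  -- replacing the surface measure by the measure of the tangent plane
  have hd1 := abs_integral_sub_integral_le h1 h2 hiσ
  have hle1 : ∫ z, |φ z * w z| ∂(b.graphMeasure.prod lam)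
      ≤ M * ∫ z, |φ z| ∂(b.graphMeasure.prod lam) := by
    rw [← integral_const_mul]
    refine integral_mono_ae hiν.abs ((hφσ.mono_measure h1).const_mul M) ?_
    filter_upwards [hwν] with z hz
    rw [abs_mul, mul_comm]
    gcongr
  have hle2 : ∫ z, |φ z| ∂(b.graphMeasure.prod lam) ≤ ∫ z, |φ z| ∂(σ.prod lam) := by
    rw [← hbox _ fun z hz => by simp [hz]]
    exact integral_mono_measure h1 (ae_of_all _ fun z => abs_nonneg _) hφσ
  -- replacing the factor of obliqueness by one
  have hmap := b.graphMeasure_prod_eq lam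
  have hγ : Measurable (Prod.map b.graph (id : ℝ → ℝ)) :=
    (b.continuous_graph.prodMap continuous_id).measurable
  have htr : ∀ f : SpaceTime N → ℝ, Integrable f (b.graphMeasure.prod lam) →
      ∫ z, f z ∂(b.graphMeasure.prod lam)
        = ∫ q, f (b.graph q.1, q.2) ∂((volume.restrict (Metric.ball 0 b.δ)).prod lam) := by
    intro f hf
    rw [hmap] at hf ⊢
    exact integral_map hγ.aemeasurable hf.aestronglyMeasurable
  have hJ : ∀ y ∈ Metric.ball 0 b.δ, |‖fderiv ℝ b.ρ (b.graph y)‖ / fderiv ℝ b.ρ (b.graph y) e - 1|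
      ≤ ε := by
    intro y hy
    have hg := Ioo_subset_Icc_self (b.g_mem y hy)
    have hp : 0 < fderiv ℝ b.ρ (b.graph y) e := b.fderiv_pos y hy _ hg
    have hle : ‖fderiv ℝ b.ρ (b.graph y)‖ ≤ (1 + ε) * fderiv ℝ b.ρ (b.graph y) e :=
      b.norm_fderiv_le y hy _ hg
    -- As `e` is a unit vector, the obliqueness factor is at least one; the chart bounds it by `1 +
    -- ε`.
    have hge := (fderiv ℝ b.ρ (b.graph y)).le_opNorm e
    rw [b.norm_e, mul_one, Real.norm_eq_abs, abs_of_pos hp] at hge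
    rw [abs_of_nonneg (by rw [sub_nonneg, one_le_div hp]; exact hge), sub_le_iff_le_add',
      div_le_iff₀ hp]
    exact hle
  have hae : ∀ᵐ q ∂((volume.restrict (Metric.ball 0 b.δ)).prod lam),
      q ∈ Metric.ball 0 b.δ ×ˢ Ioo 0 T ∧ |w (b.graph q.1, q.2)| ≤ M := by
    rw [hmap] at hwν
    have hmem : ∀ᵐ q ∂((volume.restrict (Metric.ball (0 : (Submodule.span ℝ {e})ᗮ) b.δ)).prod lam),
        q ∈ Metric.ball 0 b.δ ×ˢ Ioo 0 T := by
      rw [hlam, Measure.prod_restrict]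
      exact ae_restrict_mem (Metric.isOpen_ball.measurableSet.prod measurableSet_Ioo)
    filter_upwards [ae_of_ae_map hγ.aemeasurable hwν, hmem] with q h1 h2
    exact ⟨h2, h1⟩
  have hib : Integrable (fun q : (Submodule.span ℝ {e})ᗮ × ℝ =>
      φ (b.graph q.1, q.2) * w (b.graph q.1, q.2)) ((volume.restrict (Metric.ball 0 b.δ)).prod lam) := by
    rw [hmap] at hiν
    exact hiν.comp_measurable hγ
  have hJm : AEStronglyMeasurable (fun q : (Submodule.span ℝ {e})ᗮ × ℝ =>
      ‖fderiv ℝ b.ρ (b.graph q.1)‖ / fderiv ℝ b.ρ (b.graph q.1) e - 1)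
      ((volume.restrict (Metric.ball 0 b.δ)).prod lam) := by
    rw [hlam, Measure.prod_restrict]
    refine ContinuousOn.aestronglyMeasurable (fun q hq => ContinuousAt.continuousWithinAt ?_)
      (Metric.isOpen_ball.measurableSet.prod measurableSet_Ioo)
    have hg := Ioo_subset_Icc_self (b.g_mem q.1 hq.1)
    have hc : ContinuousAt (fun q : (Submodule.span ℝ {e})ᗮ × ℝ => fderiv ℝ b.ρ (b.graph q.1)) q :=
      ContinuousAt.comp (f := fun q : (Submodule.span ℝ {e})ᗮ × ℝ => b.graph q.1)
        (continuousAt_fderiv_of_contDiffAt (b.contDiffAt q.1 hq.1 _ hg))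
        (b.continuous_graph.comp continuous_fst).continuousAt
    exact (hc.norm.div (hc.clm_apply continuousAt_const) (b.fderiv_pos q.1 hq.1 _ hg).ne').sub
      continuousAt_const
  have hid : Integrable (fun q : (Submodule.span ℝ {e})ᗮ × ℝ =>
      φ (b.graph q.1, q.2) * w (b.graph q.1, q.2) *
        (‖fderiv ℝ b.ρ (b.graph q.1)‖ / fderiv ℝ b.ρ (b.graph q.1) e - 1))
      ((volume.restrict (Metric.ball 0 b.δ)).prod lam) :=
    hib.mul_bdd hJm (hae.mono fun q hq => hJ q.1 hq.1.1)
  have hφb : Integrable (fun q : (Submodule.span ℝ {e})ᗮ × ℝ => |φ (b.graph q.1, q.2)|)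
      ((volume.restrict (Metric.ball 0 b.δ)).prod lam) := by
    have := hφσ.mono_measure h1
    rw [hmap] at this
    exact this.comp_measurable hγ
  have hd2 : |weakFlux (volume.restrict (Ω ×ˢ Ioo 0 T)) (fluxField c u) (fluxDiv c u G) φ
      - ∫ z, φ z * w z ∂(b.graphMeasure.prod lam)| ≤ ε * M *
        ∫ z, |φ z| ∂(b.graphMeasure.prod lam) := by
    rw [hu.weakFlux_eq_integral_graph hc hΩ hN hG b hφ, htr _ hiν, htr _ (hφσ.mono_measure h1)]
    have heq : (∫ q, φ (b.graph q.1, q.2) * (uS (b.graph q.1, q.2) * p (b.graph q.1, q.2)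
          * ‖fderiv ℝ b.ρ (b.graph q.1)‖) / fderiv ℝ b.ρ (b.graph q.1) e
        ∂((volume.restrict (Metric.ball 0 b.δ)).prod lam))
        - ∫ q, φ (b.graph q.1, q.2) * w (b.graph q.1, q.2)
          ∂((volume.restrict (Metric.ball 0 b.δ)).prod lam)
        = ∫ q, φ (b.graph q.1, q.2) * w (b.graph q.1, q.2) *
        (‖fderiv ℝ b.ρ (b.graph q.1)‖ / fderiv ℝ b.ρ (b.graph q.1) e - 1)
          ∂((volume.restrict (Metric.ball 0 b.δ)).prod lam) := by
      rw [sub_eq_iff_eq_add, ← integral_add hid hib]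
      congr 1
      ext q
      simp only [w]
      ring
    rw [heq, ← integral_const_mul, ← Real.norm_eq_abs]
    refine norm_integral_le_of_norm_le (hφb.const_mul _) ?_
    filter_upwards [hae] with q hq
    rw [norm_mul, norm_mul, Real.norm_eq_abs, Real.norm_eq_abs, Real.norm_eq_abs]
    calc _ ≤ |φ (b.graph q.1, q.2)| * M * ε := by
          gcongr
          · exact hq.2
          · exact hJ q.1 hq.1.1
      _ = _ := by ring
  rw [hbox _ fun z hz => by simp [hz]] at hd1
  have hI0 : 0 ≤ ∫ z, |φ z| ∂(b.graphMeasure.prod lam) := integral_nonneg fun z => abs_nonneg _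
  have hKc : (K : ℝ) = (1 + (ε : ℝ)) ^ (N - 1) := by simp [K]
  calc |weakFlux (volume.restrict (Ω ×ˢ Ioo 0 T)) (fluxField c u) (fluxDiv c u G) φ
        - ∫ z, φ z * w z ∂(σ.prod lam)|
      ≤ ε * M * ∫ z, |φ z| ∂(b.graphMeasure.prod lam)
        + (K - 1) * (M * ∫ z, |φ z| ∂(b.graphMeasure.prod lam)) := by
        refine (abs_sub_le _ (∫ z, φ z * w z ∂(b.graphMeasure.prod lam)) _).trans ?_
        rw [abs_sub_comm (∫ z, φ z * w z ∂(b.graphMeasure.prod lam))]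
        exact add_le_add hd2 (hd1.trans (mul_le_mul_of_nonneg_left hle1 (by linarith)))
    _ = (ε + ((1 + ε) ^ (N - 1) - 1)) * M * ∫ z, |φ z| ∂(b.graphMeasure.prod lam) := by
        rw [← hKc]
        ring
    _ ≤ _ := by
        refine mul_le_mul_of_nonneg_left hle2 (mul_nonneg ?_ hM0)
        rw [← hKc]
        have h0 : (0 : ℝ) ≤ ε := ε.2
        linarith

theorem weakFlux_eq_zero_of_tsupport {c : ℝ} {Ω : Set (Space N)} {G u : SpaceTime N → ℝ} {T : ℝ}
    {φ : SpaceTime N → ℝ} (h : ∀ z ∈ tsupport φ, z.1 ∉ Ω) :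
    weakFlux (volume.restrict (Ω ×ˢ Ioo 0 T)) (fluxField c u) (fluxDiv c u G) φ = 0 := by
  refine setIntegral_eq_zero_of_forall_eq_zero fun z hz => ?_
  have h1 : z ∉ tsupport φ := fun hs => h z hs hz.1
  have h2 : fderiv ℝ φ z = 0 :=
    image_eq_zero_of_notMem_tsupport fun h => h1 (tsupport_fderiv_subset ℝ h)
  simp [h2, image_eq_zero_of_notMem_tsupport h1]

/-- The balance of the flux for test functions of space and time. -/
theorem weakFlux_eq_boundary (hu : IsClassicalSolution c Ω n F Z G u₀ v₀ uS p u)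
    (hc : 0 < c) (hΩ : IsLyapunovDomain Ω n) (hN : 1 ≤ N) {T : ℝ}
    (hG : IntegrableOn G (Ω ×ˢ Ioo 0 T) volume) {φ : SpaceTime N → ℝ}
    (hφ : IsTest (univ ×ˢ Ioo 0 T) φ) :
    weakFlux (volume.restrict (Ω ×ˢ Ioo 0 T)) (fluxField c u) (fluxDiv c u G) φ
      = ∫ z, φ z * (uS z * p z) ∂((surfaceMeasure Ω).prod (volume.restrict (Ioo 0 T))) := by
  have hσ := hΩ.isFiniteMeasure_surfaceMeasure hN
  obtain ⟨M', hfield⟩ := hu.exists_isBoundedField hΩ.isOpen.measurableSet hΩ.isBounded hG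
  obtain ⟨⟨M, hM0, hM⟩, -⟩ := hu.exists_bound_boundary hΩ T
  have hint0 : ∀ ψ : SpaceTime N → ℝ, (∀ z ∈ tsupport ψ, z.1 ∉ frontier Ω) →
      ∫ z, ψ z * (uS z * p z) ∂((surfaceMeasure Ω).prod (volume.restrict (Ioo 0 T))) = 0 := by
    intro ψ hψ
    refine integral_eq_zero_of_ae ?_
    filter_upwards [hu.ae_boundary hΩ hN T] with z hz
    rw [image_eq_zero_of_notMem_tsupport fun h => hψ z h hz.1.1, zero_mul, Pi.zero_apply]
  -- For `0 ≤ ψ ≤ 1`, `|φ| = |ψ φ| + |(1 - ψ) φ|`, so the bound splits exactly along cutoffs. Local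
  -- errors then sum without a factor counting the charts.
  have key : ∀ η : ℝ, 0 < η →
      |weakFlux (volume.restrict (Ω ×ˢ Ioo 0 T)) (fluxField c u) (fluxDiv c u G) φ
        - ∫ z, φ z * (uS z * p z) ∂((surfaceMeasure Ω).prod (volume.restrict (Ioo 0 T)))|
      ≤ η * ∫ z, |φ z| ∂((surfaceMeasure Ω).prod (volume.restrict (Ioo 0 T))) := by
    intro η hη
    refine abs_le_of_locally (U := univ ×ˢ Ioo 0 T)
      (Λ := fun φ => weakFlux (volume.restrict (Ω ×ˢ Ioo 0 T)) (fluxField c u) (fluxDiv c u G) φ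
        - ∫ z, φ z * (uS z * p z) ∂((surfaceMeasure Ω).prod (volume.restrict (Ioo 0 T))))
      (B := fun φ => η * ∫ z, |φ z| ∂((surfaceMeasure Ω).prod (volume.restrict (Ioo 0 T))))
      (fun φ ψ hφ hψ => ?_) (fun φ ψ hφ hψ h01 => ?_) (fun z hz => ?_) hφ
    · have := integral_add (hu.integrable_mul_boundary hΩ hN T hφ)
        (hu.integrable_mul_boundary hΩ hN T hψ)
      simp only [weakFlux_add hfield hφ hψ, Pi.add_apply, add_mul, this]
      ring
    · have hi : ∀ {φ : SpaceTime N → ℝ}, IsTest (univ ×ˢ Ioo 0 T) φ → Integrable (fun z => |φ z|)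
          ((surfaceMeasure Ω).prod (volume.restrict (Ioo 0 T))) := fun h => by
        obtain ⟨A, -, hA⟩ := h.exists_bound
        exact (Integrable.of_bound h.1.continuous.aestronglyMeasurable A
          (ae_of_all _ fun z => (hA z).1)).abs
      have hψ' : ContDiff ℝ 1 (1 - ψ) := by
        change ContDiff ℝ 1 fun z => 1 - ψ z
        exact contDiff_const.sub hψ
      rw [← mul_add, ← integral_add (hi (hφ.mul_left hψ)) (hi (hφ.mul_left hψ'))]
      congr 2
      ext z
      simp only [Pi.mul_apply, Pi.sub_apply, Pi.one_apply, abs_mul]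
      rw [abs_of_nonneg (h01 z).1, abs_of_nonneg (sub_nonneg.2 (h01 z).2)]
      ring
    · have hB0 : ∀ φ : SpaceTime N → ℝ,
          0 ≤ η * ∫ z, |φ z| ∂((surfaceMeasure Ω).prod (volume.restrict (Ioo 0 T))) := fun φ =>
        mul_nonneg hη.le (integral_nonneg fun z => abs_nonneg _)
      by_cases hzΩ : z.1 ∈ Ω
      · refine ⟨Ω ×ˢ Ioo 0 T, (hΩ.isOpen.prod isOpen_Ioo).mem_nhds ⟨hzΩ, hz.2⟩, fun φ hφ hφW => ?_⟩
        rw [hu.weakFlux_eq_zero_interior hc hΩ.isOpen hΩ.isBounded hG ⟨hφ.1, hφ.2, hφW⟩, hint0 φ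
          fun w hw hwf => (hΩ.isOpen.frontier_eq ▸ hwf).2 (hφW hw).1, sub_zero, abs_zero]
        exact hB0 φ
      by_cases hzc : z.1 ∈ closure Ω
      · have hf : z.1 ∈ frontier Ω := by
          rw [hΩ.isOpen.frontier_eq]
          exact ⟨hzc, hzΩ⟩
        -- The slope of the chart is chosen so small that its error is below `η`.
        obtain ⟨ε, hε0, hε⟩ : ∃ ε : NNReal, 0 < ε ∧
            ((ε : ℝ) + ((1 + (ε : ℝ)) ^ (N - 1) - 1)) * M < η := by
          have hc : Continuous fun r : ℝ => (r + ((1 + r) ^ (N - 1) - 1)) * M := by fun_prop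
          have h1 : ∀ᶠ r in 𝓝[>] (0 : ℝ), (r + ((1 + r) ^ (N - 1) - 1)) * M < η :=
            ((hc.tendsto 0).mono_left nhdsWithin_le_nhds).eventually
              (Iio_mem_nhds (by simpa using hη))
          obtain ⟨r, hr, hr0⟩ := (h1.and self_mem_nhdsWithin).exists
          have hr0' : 0 < r := hr0
          exact ⟨⟨r, hr0'.le⟩, hr0', hr⟩
        obtain ⟨b⟩ := hΩ.nonempty_boundaryChart hf (show (0 : ℝ) < ε from hε0)
        refine ⟨b.box ×ˢ Ioo 0 T, (b.isOpen_box.prod isOpen_Ioo).mem_nhds ⟨b.self_mem_box, hz.2⟩,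
          fun φ hφ hφW => ?_⟩
        refine (hu.abs_weakFlux_sub_le hc hΩ hN hG b ⟨hφ.1, hφ.2, hφW⟩ hM hM0).trans ?_
        exact mul_le_mul_of_nonneg_right hε.le (integral_nonneg fun z => abs_nonneg _)
      · refine ⟨(closure Ω)ᶜ ×ˢ univ, (isClosed_closure.isOpen_compl.prod isOpen_univ).mem_nhds
          ⟨hzc, mem_univ _⟩, fun φ hφ hφW => ?_⟩
        rw [weakFlux_eq_zero_of_tsupport fun w hw hwΩ => (hφW hw).1 (subset_closure hwΩ), hint0 φ
          fun w hw hwf => (hφW hw).1 (frontier_subset_closure hwf), sub_zero, abs_zero]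
        exact hB0 φ
  rw [← sub_eq_zero, ← abs_nonpos_iff]
  have hI0 : 0 ≤ ∫ z, |φ z| ∂((surfaceMeasure Ω).prod (volume.restrict (Ioo 0 T))) :=
    integral_nonneg fun z => abs_nonneg _
  refine le_of_forall_pos_le_add fun r hr => ?_
  rw [zero_add]
  refine (key (r / (1 + ∫ z, |φ z| ∂((surfaceMeasure Ω).prod (volume.restrict (Ioo 0 T)))))
    (by positivity)).trans ?_
  rw [div_mul_eq_mul_div, div_le_iff₀ (by positivity)]
  nlinarith

end IsClassicalSolution

/-! ### The balance between two instants -/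

/-- A `C¹` approximation of the indicator of `(a, ∞)`. -/
noncomputable def timeCutoff (a : ℝ) (m : ℕ) (s : ℝ) : ℝ := if s ≤ a then 0 else cutoff (m * (s - a))

section TimeCutoff

variable {a s : ℝ} {m : ℕ}

theorem timeCutoff_of_le (h : s ≤ a) : timeCutoff a m s = 0 := if_pos h

theorem timeCutoff_of_lt (h : a < s) : timeCutoff a m s = cutoff (m * (s - a)) := if_neg (not_le.2 h)

theorem abs_timeCutoff_le : |timeCutoff a m s| ≤ 1 := by
  unfold timeCutoff
  split_ifs
  · simp
  · rw [abs_of_nonneg (cutoff_nonneg _)]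
    exact cutoff_le_one _

theorem timeCutoff_eventuallyEq_of_lt (h : a < s) :
    timeCutoff a m =ᶠ[𝓝 s] fun s => cutoff (m * (s - a)) := by
  filter_upwards [Ioi_mem_nhds h] with r hr
  exact timeCutoff_of_lt hr

/-- This includes `s = a`, because the cutoff is identically zero near the origin; hence the two
branches glue smoothly. -/
theorem timeCutoff_eventuallyEq_of_le (h : s ≤ a) : timeCutoff a m =ᶠ[𝓝 s] fun _ => 0 := by
  rcases h.lt_or_eq with h | rfl
  · filter_upwards [Iio_mem_nhds h] with r hr
    exact timeCutoff_of_le (le_of_lt hr)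
  · have hc : Continuous fun r : ℝ => |(m : ℝ) * (r - s)| := by fun_prop
    have : ∀ᶠ r in 𝓝 s, |(m : ℝ) * (r - s)| < 1 :=
      hc.continuousAt.eventually_lt continuousAt_const (by simp)
    filter_upwards [this] with r hr
    unfold timeCutoff
    rw [cutoff_eq_zero hr.le, ite_self]

theorem contDiff_timeCutoff (a : ℝ) (m : ℕ) : ContDiff ℝ 1 (timeCutoff a m) :=
  contDiff_iff_contDiffAt.2 fun s => by
    rcases le_or_gt s a with h | h
    · exact contDiffAt_const.congr_of_eventuallyEq (timeCutoff_eventuallyEq_of_le h)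
    · refine ContDiffAt.congr_of_eventuallyEq ?_ (timeCutoff_eventuallyEq_of_lt h)
      exact ((cutoff_contDiff.of_le (by norm_num)).comp (by fun_prop)).contDiffAt

theorem deriv_timeCutoff_of_le (h : s ≤ a) : deriv (timeCutoff a m) s = 0 := by
  rw [(timeCutoff_eventuallyEq_of_le h).deriv_eq, deriv_const]

theorem deriv_timeCutoff_of_lt (h : a < s) :
    deriv (timeCutoff a m) s = deriv cutoff (m * (s - a)) * (m * 1) := by
  rw [(timeCutoff_eventuallyEq_of_lt h).deriv_eq]
  have h1 : HasDerivAt (fun s : ℝ => (m : ℝ) * (s - a)) (m * 1) s :=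
    ((hasDerivAt_id s).sub_const a).const_mul _
  exact ((cutoff_differentiable _).hasDerivAt.comp s h1).deriv

theorem tendsto_timeCutoff (a s : ℝ) :
    Tendsto (fun m => timeCutoff a m s) atTop (𝓝 ((Ioi a).indicator (fun _ => 1) s)) := by
  rcases le_or_gt s a with h | h
  · rw [indicator_of_notMem (by simpa using h)]
    simp_rw [timeCutoff_of_le h]
    exact tendsto_const_nhds
  · rw [indicator_of_mem (by exact h)]
    simp_rw [timeCutoff_of_lt h]
    exact tendsto_cutoff_nat_mul (sub_pos.2 h).ne'

theorem timeCutoff_eq_one (h : a < s) (hm : 2 ≤ m * (s - a)) : timeCutoff a m s = 1 := by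
  rw [timeCutoff_of_lt h, cutoff_eq_one (hm.trans (le_abs_self _))]

theorem tendsto_integral_mul_timeCutoff {Y : Type*} [MeasurableSpace Y] {μ : Measure (Y × ℝ)}
    {g : Y × ℝ → ℝ} (hg : Integrable g μ) (a : ℝ) :
    Tendsto (fun m => ∫ z, g z * timeCutoff a m z.2 ∂μ) atTop
      (𝓝 (∫ z in {z | a < z.2}, g z ∂μ)) := by
  have hm : MeasurableSet {z : Y × ℝ | a < z.2} := measurableSet_lt measurable_const measurable_snd
  rw [← integral_indicator hm]
  refine tendsto_integral_of_dominated_convergence (fun z => |g z|) (fun m => ?_) hg.abs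
    (fun m => ae_of_all _ fun z => ?_) (ae_of_all _ fun z => ?_)
  · exact hg.aestronglyMeasurable.mul
      ((contDiff_timeCutoff a m).continuous.measurable.comp measurable_snd).aestronglyMeasurable
  · rw [norm_mul, Real.norm_eq_abs, Real.norm_eq_abs]
    exact mul_le_of_le_one_right (abs_nonneg _) abs_timeCutoff_le
  · have := (tendsto_timeCutoff a z.2).const_mul (g z)
    convert this using 2
    by_cases h : a < z.2
    · rw [indicator_of_mem (by exact h), indicator_of_mem (by exact h), mul_one]
    · rw [indicator_of_notMem (by exact h), indicator_of_notMem (by exact h), mul_zero]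

end TimeCutoff

namespace IsClassicalSolution

variable {ι : Type*} {N : ℕ} {c : ℝ} {Ω : Set (Space N)} {n : Space N → Space N}
  {F : ι → WaveFront N c} {Z : Set (SpaceTime N)} {G : SpaceTime N → ℝ} {u₀ v₀ : Space N → ℝ}
  {uS p : SpaceTime N → ℝ} {u : SpaceTime N → ℝ}

theorem exists_bound_mul_timeDeriv (hu : IsClassicalSolution c Ω n F Z G u₀ v₀ uS p u)
    (hΩ : IsLyapunovDomain Ω n) (T : ℝ) :
    ∃ M, 0 ≤ M ∧ ∀ z ∈ regularPoints Ω F Z, z.2 ≤ T → |u z * timeDeriv u z| ≤ M := by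
  obtain ⟨A, hA0, hA⟩ := hu.exists_bound_u hΩ.isBounded T
  obtain ⟨B, hB0, hB⟩ := hu.exists_bound_deriv T
  refine ⟨A * B, by positivity, fun z hz ht => ?_⟩
  rw [abs_mul]
  gcongr
  · exact hA z.1 (subset_closure hz.1) z.2 ⟨hz.2.1.le, ht⟩
  · exact (hB z hz ht).1

theorem continuousAt_mul_timeDeriv {z : SpaceTime N} (h : ContDiffAt ℝ 2 u z) :
    ContinuousAt (fun z => u z * timeDeriv u z) z :=
  h.continuousAt.mul (contDiffAt_timeDeriv h).continuousAt

variable [Countable ι]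

theorem integrableOn_mul_timeDeriv (hu : IsClassicalSolution c Ω n F Z G u₀ v₀ uS p u)
    (hΩ : IsLyapunovDomain Ω n) (T : ℝ) :
    IntegrableOn (fun z => u z * timeDeriv u z) (Ω ×ˢ Ioo 0 T) volume := by
  have := isFiniteMeasure (N := N) hΩ.isBounded T
  obtain ⟨M, hM0, hM⟩ := hu.exists_bound_mul_timeDeriv hΩ T
  refine Integrable.of_bound (C := M)
    (hu.aestronglyMeasurable T hΩ.isOpen.measurableSet fun z hz => continuousAt_mul_timeDeriv hz) ?_
  filter_upwards [hu.ae_regular T hΩ.isOpen.measurableSet,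
    ae_restrict_mem (hΩ.isOpen.measurableSet.prod measurableSet_Ioo)] with z h1 h2
  exact hM z h1 h2.2.2.le

/-- On almost every vertical line the derivatives of the time cutoffs concentrate at `a` from the
right with mass one, and `(x, a)` is a regular point, where `u ∂u/∂t` is continuous. -/
theorem tendsto_integral_mul_deriv_timeCutoff (hu : IsClassicalSolution c Ω n F Z G u₀ v₀ uS p u)
    (hΩ : IsLyapunovDomain Ω n) {T a : ℝ} (ha : a ∈ Ioo 0 T) :
    (∀ m, IntegrableOn (fun z => u z * timeDeriv u z * deriv (timeCutoff a m) z.2)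
      (Ω ×ˢ Ioo 0 T) volume) ∧
    Tendsto (fun m => ∫ z in Ω ×ˢ Ioo 0 T, u z * timeDeriv u z * deriv (timeCutoff a m) z.2) atTop
      (𝓝 (∫ x in Ω, u (x, a) * timeDeriv u (x, a))) := by
  have hΩm := hΩ.isOpen.measurableSet
  obtain ⟨M, hM0, hM⟩ := hu.exists_bound_mul_timeDeriv hΩ T
  have hi := hu.integrableOn_mul_timeDeriv hΩ T
  have hfin : IsFiniteMeasure ((volume : Measure (Space N)).restrict Ω) :=
    ⟨by rw [Measure.restrict_apply_univ]; exact hΩ.isBounded.measure_lt_top⟩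
  have hint : ∀ m, IntegrableOn (fun z => u z * timeDeriv u z * deriv (timeCutoff a m) z.2)
      (Ω ×ˢ Ioo 0 T) volume := by
    intro m
    have hc := (contDiff_timeCutoff a m).continuous_deriv (by norm_num)
    obtain ⟨C, hC⟩ := (isCompact_Icc (a := (0 : ℝ)) (b := T)).exists_bound_of_continuousOn
      hc.continuousOn
    refine hi.mul_bdd (c := C) (hc.comp continuous_snd).aestronglyMeasurable ?_
    filter_upwards [ae_restrict_mem (hΩm.prod measurableSet_Ioo)] with z hz
    exact hC z.2 (Ioo_subset_Icc_self hz.2)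
  refine ⟨hint, ?_⟩
  have hmeas : (volume : Measure (SpaceTime N)).restrict (Ω ×ˢ Ioo 0 T)
      = (volume.restrict Ω).prod (volume.restrict (Ioo 0 T)) := by
    rw [Measure.prod_restrict]
    rfl
  have hwm : AEStronglyMeasurable (fun z => u z * timeDeriv u z)
      ((volume.restrict Ω).prod (volume.restrict (Ioo 0 T))) := by
    rw [← hmeas]
    exact hi.aestronglyMeasurable
  have hreg := ae_restrict_of_ae (s := Ω) (Measure.ae_ae_of_ae_prod (ae_mem_regularPoints (Ω := Ω)
    (F := F) hu.isClosed_exceptional hu.exceptional_null))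
  have hrega := ae_restrict_of_ae (s := Ω) (ae_slice_mem_regularPoints (Ω := Ω) (F := F)
    hu.exceptional_null ha.1)
  have hfib : ∀ᵐ x ∂volume.restrict Ω,
      (∀ m, |∫ s in Ioo 0 T, u (x, s) * timeDeriv u (x, s) * deriv (timeCutoff a m) s| ≤ M) ∧
      Tendsto (fun m => ∫ s in Ioo 0 T, u (x, s) * timeDeriv u (x, s) * deriv (timeCutoff a m) s)
        atTop (𝓝 (u (x, a) * timeDeriv u (x, a) * 1)) := by
    filter_upwards [hwm.prodMk_left, hreg, hrega, ae_restrict_mem hΩm] with x hxm hxR hxa hxΩ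
    have hsub : Ioo a T ⊆ Ioo 0 T := Ioo_subset_Ioo_left ha.1.le
    have heq : ∀ m : ℕ, ∫ s in Ioo 0 T, u (x, s) * timeDeriv u (x, s) * deriv (timeCutoff a m) s
        = ∫ s in Ioo a T, u (x, s) * timeDeriv u (x, s)
          * (deriv cutoff (m * (s - a)) * (m * 1)) := by
      intro m
      rw [setIntegral_eq_of_subset_of_forall_sdiff_eq_zero measurableSet_Ioo hsub]
      · refine setIntegral_congr_fun measurableSet_Ioo fun s hs => ?_
        simp only [deriv_timeCutoff_of_lt hs.1]
      · intro s hs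
        rw [deriv_timeCutoff_of_le (not_lt.1 fun h => hs.2 ⟨h, hs.1.2⟩), mul_zero]
    simp_rw [heq]
    have hres := integral_mul_deriv_cutoff (α := a) (β := T) (θ := a) (L := 1) ha.2
      (r := fun s => s - a) (r' := fun _ => 1) (fun s _ => (hasDerivAt_id s).sub_const a)
      continuousOn_const (Or.inl ⟨rfl, rfl⟩) (sub_self a)
      (fun s _ hne h0 => hne (sub_eq_zero.1 h0))
      (Or.inl fun s hs => by simpa using hs.1)
      (F := fun s => u (x, s) * timeDeriv u (x, s)) hM0 (hxm.mono_set hsub)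
      (by
        filter_upwards [ae_restrict_mem measurableSet_Ioo, ae_restrict_of_ae hxR] with s hs hsR
        exact hM _ (hsR hxΩ (ha.1.trans hs.1)) hs.2.le)
      ((ContinuousAt.comp (f := fun s : ℝ => (x, s))
        (continuousAt_mul_timeDeriv (hu.contDiffAt _ (hxa hxΩ)))
        (Continuous.prodMk_right x).continuousAt).tendsto.mono_left
          (inf_le_left.trans nhdsWithin_le_nhds))
    exact hres.2
  have := tendsto_integral_prod_of_fiberwise
    (h := fun m z => u z * timeDeriv u z * deriv (timeCutoff a m) z.2)
    (ν := volume.restrict Ω) (μ := volume.restrict (Ioo 0 T))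
    (fun m => by rw [← hmeas]; exact hint m) (integrable_const M)
    (fun m => hfib.mono fun x hx => hx.1 m) (hfib.mono fun x hx => hx.2)
  rw [← hmeas] at this
  simpa using this

/-- The balance between two positive instants. -/
theorem balance (hu : IsClassicalSolution c Ω n F Z G u₀ v₀ uS p u) (hc : 0 < c)
    (hΩ : IsLyapunovDomain Ω n) (hN : 1 ≤ N) {T : ℝ}
    (hG : IntegrableOn G (Ω ×ˢ Ioo 0 T) volume) {a b : ℝ} (ha : 0 < a) (hab : a ≤ b) (hb : b < T) :
    (∫ z in {z | a < z.2}, fluxDiv c u G z ∂volume.restrict (Ω ×ˢ Ioo 0 T))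
      - (∫ z in {z | a < z.2}, uS z * p z
        ∂((surfaceMeasure Ω).prod (volume.restrict (Ioo 0 T))))
      - (c ^ 2)⁻¹ * ∫ x in Ω, u (x, a) * timeDeriv u (x, a)
    = (∫ z in {z | b < z.2}, fluxDiv c u G z ∂volume.restrict (Ω ×ˢ Ioo 0 T))
      - (∫ z in {z | b < z.2}, uS z * p z
        ∂((surfaceMeasure Ω).prod (volume.restrict (Ioo 0 T))))
      - (c ^ 2)⁻¹ * ∫ x in Ω, u (x, b) * timeDeriv u (x, b) := by
  have hΩm := hΩ.isOpen.measurableSet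
  obtain ⟨M, hfield⟩ := hu.exists_isBoundedField hΩm hΩ.isBounded hG
  have hS := hu.integrable_boundary hΩ hN T
  set μ := (volume : Measure (SpaceTime N)).restrict (Ω ×ˢ Ioo 0 T) with hμ
  set μS := (surfaceMeasure Ω).prod ((volume : Measure ℝ).restrict (Ioo 0 T))
  -- A spatial factor supplies compact support; being one near the closure of `Ω`, it is invisible
  -- in all the integrals.
  obtain ⟨ζ, hζc, hζs, hζ1⟩ : ∃ ζ : Space N → ℝ, ContDiff ℝ 1 ζ ∧ HasCompactSupport ζ ∧
      ∀ x ∈ closure Ω, ∀ᶠ y in 𝓝 x, ζ y = 1 := by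
    obtain ⟨r, hr⟩ := hΩ.isBounded.closure.subset_ball 0
    let B : ContDiffBump (0 : Space N) := ⟨max r 1, max r 1 + 1, by positivity, by simp⟩
    refine ⟨B, B.contDiff, B.hasCompactSupport, fun x hx => ?_⟩
    have hxr : x ∈ Metric.ball (0 : Space N) (max r 1) :=
      Metric.ball_subset_ball (le_max_left _ _) (hr hx)
    filter_upwards [Metric.isOpen_ball.mem_nhds hxr] with y hy
    exact B.one_of_mem_closedBall (Metric.ball_subset_closedBall hy)
  let φ : ℕ → SpaceTime N → ℝ := fun m z => ζ z.1 * (timeCutoff a m z.2 - timeCutoff b m z.2)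
  -- From this index on both time cutoffs equal one after `(b + T) / 2` and cancel, so the support
  -- stays below `T`.
  obtain ⟨m₀, hm₀⟩ := exists_nat_gt (2 / ((T - b) / 2))
  have hTb : 0 < (T - b) / 2 := by linarith
  have htest : ∀ m ≥ m₀, IsTest (univ ×ˢ Ioo 0 T) (φ m) := by
    intro m hm
    have hsupp : Function.support (φ m) ⊆ tsupport ζ ×ˢ Icc a ((b + T) / 2) := by
      intro z hz
      refine ⟨subset_tsupport _ fun h => hz (by simp [φ, h]), ?_⟩
      by_contra hcon
      apply hz
      rw [mem_Icc, not_and_or, not_le, not_le] at hcon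
      rcases hcon with h | h
      · simp [φ, timeCutoff_of_le h.le, timeCutoff_of_le (h.le.trans hab)]
      · have h2 : ∀ a' ≤ b, timeCutoff a' m z.2 = 1 := fun a' ha' => by
          refine timeCutoff_eq_one (by linarith) ?_
          have h3 : (T - b) / 2 ≤ z.2 - a' := by linarith
          have h4 : 2 / ((T - b) / 2) < m := hm₀.trans_le (by exact_mod_cast hm)
          rw [div_lt_iff₀ hTb] at h4
          exact h4.le.trans (by gcongr)
        simp [φ, h2 a hab, h2 b le_rfl]
    have hK : IsCompact (tsupport ζ ×ˢ Icc a ((b + T) / 2)) := hζs.isCompact.prod isCompact_Icc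
    have hts : tsupport (φ m) ⊆ tsupport ζ ×ˢ Icc a ((b + T) / 2) :=
      closure_minimal hsupp hK.isClosed
    refine ⟨?_, hK.of_isClosed_subset (isClosed_tsupport _) hts, fun z hz =>
      ⟨mem_univ _, ha.trans_le (hts hz).2.1, (hts hz).2.2.trans_lt (by linarith)⟩⟩
    exact (hζc.comp contDiff_fst).mul (((contDiff_timeCutoff a m).comp contDiff_snd).sub
      ((contDiff_timeCutoff b m).comp contDiff_snd))
  obtain ⟨hia, hla⟩ := hu.tendsto_integral_mul_deriv_timeCutoff hΩ (T := T) ⟨ha, hab.trans_lt hb⟩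
  obtain ⟨hib, hlb⟩ := hu.tendsto_integral_mul_deriv_timeCutoff hΩ (T := T) ⟨ha.trans_le hab, hb⟩
  have hcut : ∀ (a' : ℝ) (m : ℕ) {ν : Measure (SpaceTime N)} {g : SpaceTime N → ℝ},
      Integrable g ν → Integrable (fun z => g z * timeCutoff a' m z.2) ν :=
    fun a' m ν g hg => hg.mul_bdd
      (((contDiff_timeCutoff a' m).continuous.comp continuous_snd).aestronglyMeasurable)
      (ae_of_all _ fun z => abs_timeCutoff_le)
  -- the interior terms
  have hW : ∀ m, weakFlux μ (fluxField c u) (fluxDiv c u G) (φ m)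
      = -(c ^ 2)⁻¹ * ((∫ z, u z * timeDeriv u z * deriv (timeCutoff a m) z.2 ∂μ)
          - ∫ z, u z * timeDeriv u z * deriv (timeCutoff b m) z.2 ∂μ)
        + ((∫ z, fluxDiv c u G z * timeCutoff a m z.2 ∂μ)
          - ∫ z, fluxDiv c u G z * timeCutoff b m z.2 ∂μ) := by
    intro m
    rw [← integral_sub (hia m) (hib m), ← integral_const_mul,
      ← integral_sub (hcut a m hfield.integrable) (hcut b m hfield.integrable)]
    refine Eq.trans ?_ (integral_add (((hia m).sub (hib m)).const_mul _)
      ((hcut a m hfield.integrable).sub (hcut b m hfield.integrable)))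
    refine setIntegral_congr_fun (hΩm.prod measurableSet_Ioo) fun z hz => ?_
    have hζz : ∀ᶠ y : SpaceTime N in 𝓝 z, ζ y.1 = 1 :=
      (continuous_fst.tendsto z).eventually (hζ1 z.1 (subset_closure hz.1))
    have heq : φ m =ᶠ[𝓝 z] fun y => timeCutoff a m y.2 - timeCutoff b m y.2 := by
      filter_upwards [hζz] with y hy
      simp [φ, hy]
    have hd : ∀ a' : ℝ, HasFDerivAt (fun y : SpaceTime N => timeCutoff a' m y.2)
        (deriv (timeCutoff a' m) z.2 • ContinuousLinearMap.snd ℝ (Space N) ℝ) z := fun a' =>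
      (((contDiff_timeCutoff a' m).differentiable (by norm_num) z.2).hasDerivAt).comp_hasFDerivAt z
        hasFDerivAt_snd
    rw [heq.self_of_nhds, heq.fderiv_eq, ((hd a).fun_sub (hd b)).fderiv]
    simp only [sub_apply, smul_apply, fluxField, ContinuousLinearMap.coe_snd', smul_eq_mul]
    ring
  -- the boundary terms
  have hB : ∀ m, ∫ z, φ m z * (uS z * p z) ∂μS
      = (∫ z, uS z * p z * timeCutoff a m z.2 ∂μS) - ∫ z, uS z * p z * timeCutoff b m z.2 ∂μS := by
    intro m
    rw [← integral_sub (hcut a m hS) (hcut b m hS)]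
    refine integral_congr_ae ?_
    filter_upwards [hu.ae_boundary hΩ hN T] with z hz
    have : ζ z.1 = 1 := (hζ1 z.1 (frontier_subset_closure hz.1.1)).self_of_nhds
    simp only [φ, this]
    ring
  have hlimW := ((hla.sub hlb).const_mul (-(c ^ 2)⁻¹)).add
    ((tendsto_integral_mul_timeCutoff hfield.integrable a).sub
      (tendsto_integral_mul_timeCutoff hfield.integrable b))
  have hlimB := (tendsto_integral_mul_timeCutoff hS a).sub (tendsto_integral_mul_timeCutoff hS b)
  have := tendsto_nhds_unique (hlimW.congr' (by
    filter_upwards [eventually_ge_atTop m₀] with m hm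
    rw [← hW m, ← hB m]
    exact hu.weakFlux_eq_boundary hc hΩ hN hG (htest m hm))) hlimB
  linarith

end IsClassicalSolution

/-! ### The initial instant and the conclusion -/

section TimeIntervals

variable {Y : Type*} [MeasurableSpace Y]

theorem tendsto_setIntegral_lt_snd {μ : Measure (Y × ℝ)} {g : Y × ℝ → ℝ} (hg : Integrable g μ)
    (h0 : ∀ᵐ z ∂μ, 0 < z.2) :
    Tendsto (fun a => ∫ z in {z | a < z.2}, g z ∂μ) (𝓝[>] 0) (𝓝 (∫ z, g z ∂μ)) := by
  have hm : ∀ a : ℝ, MeasurableSet {z : Y × ℝ | a < z.2} := fun a =>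
    measurableSet_lt measurable_const measurable_snd
  simp_rw [← integral_indicator (hm _)]
  refine tendsto_integral_filter_of_dominated_convergence (fun z => |g z|)
    (Eventually.of_forall fun a => hg.aestronglyMeasurable.indicator (hm a))
    (Eventually.of_forall fun a => ae_of_all _ fun z => norm_indicator_le_norm_self _ _) hg.abs ?_
  filter_upwards [h0] with z hz
  refine tendsto_const_nhds.congr' ?_
  filter_upwards [Ioo_mem_nhdsGT hz] with a ha
  exact (indicator_of_mem (by exact ha.2) _).symm

theorem integral_sub_setIntegral_lt_snd {ν : Measure Y} [SFinite ν] {t T : ℝ} (htT : t < T)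
    {g : Y × ℝ → ℝ} (hg : Integrable g (ν.prod (volume.restrict (Ioo 0 T)))) :
    ∫ z, g z ∂(ν.prod (volume.restrict (Ioo 0 T)))
      - ∫ z in {z | t < z.2}, g z ∂(ν.prod (volume.restrict (Ioo 0 T)))
      = ∫ z, g z ∂(ν.prod (volume.restrict (Ioo 0 t))) := by
  have hm : MeasurableSet {z : Y × ℝ | t < z.2} := measurableSet_lt measurable_const measurable_snd
  rw [← integral_add_compl hm hg, add_sub_cancel_left]
  have h1 : {z : Y × ℝ | t < z.2}ᶜ = univ ×ˢ Iic t := by ext z; simp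
  have h2 : Iic t ∩ Ioo 0 T = Ioc 0 t := by
    ext s
    exact ⟨fun h => ⟨h.2.1, h.1⟩, fun h => ⟨h.2, h.1, h.2.trans_lt htT⟩⟩
  rw [h1, ← Measure.prod_restrict, Measure.restrict_univ, Measure.restrict_restrict measurableSet_Iic,
    h2, ← Measure.restrict_congr_set Ioo_ae_eq_Ioc]

end TimeIntervals

namespace IsClassicalSolution

variable {ι : Type*} [Countable ι] {N : ℕ} {c : ℝ} {Ω : Set (Space N)} {n : Space N → Space N}
  {F : ι → WaveFront N c} {Z : Set (SpaceTime N)} {G : SpaceTime N → ℝ} {u₀ v₀ : Space N → ℝ}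
  {uS p : SpaceTime N → ℝ} {u : SpaceTime N → ℝ}

theorem integrableOn_slice (hu : IsClassicalSolution c Ω n F Z G u₀ v₀ uS p u)
    (hΩ : IsLyapunovDomain Ω n) {t : ℝ} (ht : 0 < t) :
    IntegrableOn (fun x => u (x, t) * timeDeriv u (x, t)) Ω volume := by
  have hΩm := hΩ.isOpen.measurableSet
  obtain ⟨M, hM0, hM⟩ := hu.exists_bound_mul_timeDeriv hΩ t
  have hfin : IsFiniteMeasure ((volume : Measure (Space N)).restrict Ω) :=
    ⟨by rw [Measure.restrict_apply_univ]; exact hΩ.isBounded.measure_lt_top⟩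
  have hreg := ae_slice_mem_regularPoints (Ω := Ω) (F := F) hu.exceptional_null ht
  have hW : IsOpen {x : Space N | ContDiffAt ℝ 2 u (x, t)} :=
    (isOpen_setOf_contDiffAt u).preimage (Continuous.prodMk_left t)
  refine Integrable.of_bound (C := M) ?_ ?_
  · have h1 : AEStronglyMeasurable (fun x => u (x, t) * timeDeriv u (x, t))
        (volume.restrict {x : Space N | ContDiffAt ℝ 2 u (x, t)}) :=
      ContinuousOn.aestronglyMeasurable (fun x hx => ContinuousAt.continuousWithinAt <|
        ContinuousAt.comp (f := fun x : Space N => (x, t)) (continuousAt_mul_timeDeriv hx)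
          (Continuous.prodMk_left t).continuousAt) hW.measurableSet
    have h2 : (volume : Measure (Space N)).restrict Ω
        = (volume.restrict {x : Space N | ContDiffAt ℝ 2 u (x, t)}).restrict Ω := by
      rw [Measure.restrict_restrict hΩm]
      refine Measure.restrict_congr_set ?_
      filter_upwards [hreg] with x hx
      exact propext ⟨fun h => ⟨h, hu.contDiffAt _ (hx h)⟩, fun h => h.1⟩
    rw [h2]
    exact h1.restrict
  · filter_upwards [ae_restrict_of_ae hreg, ae_restrict_mem hΩm] with x hx hxΩ
    exact hM _ (hx hxΩ) le_rfl

/-- The fundamental theorem of calculus along almost every line parallel to the time axis. -/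
theorem ae_integral_line (hu : IsClassicalSolution c Ω n F Z G u₀ v₀ uS p u)
    (hΩ : IsLyapunovDomain Ω n) (T : ℝ) :
    ∃ M, 0 ≤ M ∧ ∀ᵐ x ∂volume.restrict Ω, ∀ h ∈ Ioo 0 T,
      ∫ s in Ioo 0 h, u (x, s) * timeDeriv u (x, s) = (u (x, h) ^ 2 - u (x, 0) ^ 2) / 2 ∧
      |u (x, h) ^ 2 - u (x, 0) ^ 2| ≤ 2 * M * h := by
  have hΩm := hΩ.isOpen.measurableSet
  obtain ⟨M, hM0, hM⟩ := hu.exists_bound_mul_timeDeriv hΩ T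
  have hi := hu.integrableOn_mul_timeDeriv hΩ T
  unfold IntegrableOn at hi
  rw [Measure.volume_eq_prod, ← Measure.prod_restrict] at hi
  refine ⟨M, hM0, ?_⟩
  filter_upwards [hi.prod_right_ae, ae_restrict_mem hΩm,
    ae_restrict_of_ae (ae_forall_notMem_exceptional hu.exceptional_null)] with x hxi hxΩ hxZ h hh
  have hsub : Ioc 0 h ⊆ Ioo 0 T := fun s hs => ⟨hs.1, hs.2.trans_lt hh.2⟩
  have hcount := countable_line_fronts (F := F) x
  have hreg : ∀ s : ℝ, 0 < s → s ∉ {t : ℝ | ∃ k, (x, t) ∈ (F k).carrier} →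
      (x, s) ∈ regularPoints Ω F Z := fun s hs hsF =>
    ⟨hxΩ, hs, hxZ s, fun k hk => hsF ⟨k, hk⟩⟩
  have hxi' : IntervalIntegrable (fun s => u (x, s) * timeDeriv u (x, s)) volume 0 h := by
    rw [intervalIntegrable_iff_integrableOn_Ioc_of_le hh.1.le]
    exact IntegrableOn.mono_set hxi hsub
  have hcont : ContinuousOn (fun s => u (x, s)) (Icc 0 h) :=
    hu.continuousOn.comp (Continuous.prodMk_right x).continuousOn fun s hs =>
      ⟨subset_closure hxΩ, hs.1⟩
  -- Almost every line avoids `Z` and meets the fronts at countably many times, which the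
  -- fundamental theorem tolerates since `u` is continuous.
  have hftc := integral_eq_of_hasDerivAt_off_countable_of_le (fun s => u (x, s) ^ 2 / 2)
    (fun s => u (x, s) * timeDeriv u (x, s)) hh.1.le hcount ((hcont.pow 2).div_const 2)
    (fun s hs => by
      have h1 := hu.contDiffAt _ (hreg s hs.1.1 hs.2)
      have h2 : HasDerivAt (fun s => u (x, s)) (timeDeriv u (x, s)) s :=
        (hasDerivAt_time (h1.differentiableAt (by norm_num))).differentiableAt.hasDerivAt
      refine ((h2.fun_pow 2).div_const 2).congr_deriv ?_
      push_cast
      ring) hxi'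
  rw [intervalIntegral.integral_of_le hh.1.le] at hftc
  have hbound : |∫ s in Ioc 0 h, u (x, s) * timeDeriv u (x, s)| ≤ M * h := by
    have := norm_setIntegral_le_of_norm_le_const_ae' (μ := volume) (s := Ioc 0 h)
      (f := fun s => u (x, s) * timeDeriv u (x, s)) (C := M) (by simp) (by
        filter_upwards [hcount.ae_notMem volume] with s hsF hs
        exact hM _ (hreg s hs.1 hsF) (hsub hs).2.le)
    simpa [hh.1.le] using this
  rw [← integral_Ioc_eq_integral_Ioo, hftc]
  refine ⟨by ring, ?_⟩
  rw [hftc] at hbound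
  rw [show u (x, h) ^ 2 - u (x, 0) ^ 2 = 2 * (u (x, h) ^ 2 / 2 - u (x, 0) ^ 2 / 2) by ring, abs_mul,
    abs_two]
  linarith

/-- Integrability of the initial data, and the value at the initial instant. -/
theorem integrableOn_initial (hu : IsClassicalSolution c Ω n F Z G u₀ v₀ uS p u)
    (hΩ : IsLyapunovDomain Ω n) {A₀ : ℝ}
    (hA : Tendsto (fun s => ∫ x in Ω, u (x, s) * timeDeriv u (x, s)) (𝓝[>] 0) (𝓝 A₀)) :
    IntegrableOn (fun x => u₀ x * v₀ x) Ω volume ∧ A₀ = ∫ x in Ω, u₀ x * v₀ x := by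
  have hΩm := hΩ.isOpen.measurableSet
  have hfin : IsFiniteMeasure ((volume : Measure (Space N)).restrict Ω) :=
    ⟨by rw [Measure.restrict_apply_univ]; exact hΩ.isBounded.measure_lt_top⟩
  obtain ⟨M, hM0, hline⟩ := hu.ae_integral_line hΩ 1
  -- The shift by two keeps all these times strictly below one, the horizon used for the bounds.
  let r : ℕ → ℝ := fun k => 1 / ((k : ℝ) + 2)
  have hr : ∀ k, r k ∈ Ioo (0 : ℝ) 1 := fun k => by
    have : (0 : ℝ) ≤ k := k.cast_nonneg
    refine ⟨by positivity, ?_⟩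
    rw [div_lt_one (by positivity)]
    linarith
  have hrlim : Tendsto r atTop (𝓝[>] 0) := by
    refine tendsto_nhdsWithin_iff.2 ⟨?_, Eventually.of_forall fun k => (hr k).1⟩
    have := (tendsto_one_div_add_atTop_nhds_zero_nat (𝕜 := ℝ)).comp (tendsto_add_atTop_nat 1)
    refine this.congr fun k => ?_
    simp only [Function.comp_apply, r]
    push_cast
    ring_nf
  let q : ℕ → Space N → ℝ := fun k x => (u (x, r k) ^ 2 - u (x, 0) ^ 2) / 2 / r k
  have hqm : ∀ k, AEStronglyMeasurable (q k) (volume.restrict Ω) := fun k => by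
    have hc : ∀ s : ℝ, 0 ≤ s → ContinuousOn (fun x => u (x, s)) Ω := fun s hs =>
      hu.continuousOn.comp (Continuous.prodMk_left s).continuousOn fun x hx =>
        ⟨subset_closure hx, hs⟩
    exact (((((hc _ (hr k).1.le).pow 2).sub ((hc 0 le_rfl).pow 2)).div_const 2).div_const
      (r k)).aestronglyMeasurable hΩm
  have hqb : ∀ k, ∀ᵐ x ∂volume.restrict Ω, ‖q k x‖ ≤ M := fun k => by
    filter_upwards [hline] with x hx
    have h1 := (hx _ (hr k)).2
    have h2 := (hr k).1
    rw [Real.norm_eq_abs, abs_div, abs_div, abs_two, abs_of_pos h2, div_div, div_le_iff₀ (by positivity)]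
    linarith
  have hql : ∀ᵐ x ∂volume.restrict Ω, Tendsto (fun k => q k x) atTop (𝓝 (u₀ x * v₀ x)) := by
    filter_upwards [hu.initial_velocity, ae_restrict_mem hΩm] with x hx hxΩ
    have h1 : HasDerivWithinAt (fun s : ℝ => u (x, s) ^ 2 / 2) (u₀ x * v₀ x) (Ici 0) 0 := by
      refine ((hx.fun_pow 2).div_const 2).congr_deriv ?_
      rw [hu.initial_value x (subset_closure hxΩ)]
      push_cast
      ring
    have h2 := (hasDerivWithinAt_iff_tendsto_slope' (by simp : (0 : ℝ) ∉ Ioi (0 : ℝ))).1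
      (h1.mono Ioi_subset_Ici_self)
    refine (h2.comp hrlim).congr fun k => ?_
    simp only [Function.comp_apply, slope_def_field, q, sub_zero]
    ring
  have hv : IntegrableOn (fun x => u₀ x * v₀ x) Ω volume := by
    refine Integrable.of_bound (C := M) (aestronglyMeasurable_of_tendsto_ae atTop hqm hql) ?_
    filter_upwards [hql, ae_all_iff.2 hqb] with x h1 h2
    exact le_of_tendsto h1.norm (Eventually.of_forall h2)
  refine ⟨hv, ?_⟩
  have hlim1 : Tendsto (fun k => ∫ x in Ω, q k x) atTop (𝓝 (∫ x in Ω, u₀ x * v₀ x)) :=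
    tendsto_integral_of_dominated_convergence (fun _ => M) hqm (integrable_const M) hqb hql
  have hi := hu.integrableOn_mul_timeDeriv hΩ 1
  unfold IntegrableOn at hi
  rw [Measure.volume_eq_prod, ← Measure.prod_restrict] at hi
  -- The time averages of a function with right limit `A₀` tend to `A₀`; by Fubini they are the
  -- integrals of the quotients `q`.
  have hder : HasDerivWithinAt (fun h => ∫ s in (0 : ℝ)..h, ∫ x in Ω, u (x, s) * timeDeriv u (x, s))
      A₀ (Ici 0) 0 :=
    intervalIntegral.integral_hasDerivWithinAt_of_tendsto_ae_right (t := Ioi 0)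
      (by simp) ⟨Ioo 0 1, Ioo_mem_nhdsGT one_pos, hi.integral_prod_right.aestronglyMeasurable⟩
      (hA.mono_left inf_le_left)
  have h2 := (hasDerivWithinAt_iff_tendsto_slope' (by simp : (0 : ℝ) ∉ Ioi (0 : ℝ))).1
    (hder.mono Ioi_subset_Ici_self)
  refine tendsto_nhds_unique ((h2.comp hrlim).congr fun k => ?_) hlim1
  have hk := hr k
  simp only [Function.comp_apply, slope_def_field, q, sub_zero, intervalIntegral.integral_same]
  rw [integral_div, intervalIntegral.integral_of_le hk.1.le, integral_Ioc_eq_integral_Ioo]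
  congr 1
  have hi' : Integrable (fun z : SpaceTime N => u z * timeDeriv u z)
      ((volume.restrict Ω).prod (volume.restrict (Ioo 0 (r k)))) :=
    hi.mono_measure (Measure.prod_mono le_rfl
      (Measure.restrict_mono (Ioo_subset_Ioo_right hk.2.le) le_rfl))
  rw [← integral_integral_swap (f := fun x s => u (x, s) * timeDeriv u (x, s)) hi']
  refine integral_congr_ae ?_
  filter_upwards [hline] with x hx
  exact (hx _ hk).1

end IsClassicalSolution

theorem theorem2p3 {ι : Type*} [Countable ι] (N : ℕ) (hN : 1 ≤ N) (c : ℝ) (hc : 0 < c)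
    (Ω : Set (Space N)) (n : Space N → Space N) (hΩ : IsLyapunovDomain Ω n)
    (F : ι → WaveFront N c) (Z : Set (SpaceTime N)) (G : SpaceTime N → ℝ)
    (hG : ∀ T : ℝ, IntegrableOn G (Ω ×ˢ Ioo 0 T) volume)
    (u₀ v₀ : Space N → ℝ) (uS p : SpaceTime N → ℝ) (u : SpaceTime N → ℝ)
    (hu : IsClassicalSolution c Ω n F Z G u₀ v₀ uS p u) :
    -- the jump of the flux `u u,_τ ν_τ - u u,_j ν_j` through every front vanishes
    (∀ k, ∀ z ∈ (F k).carrier, z.1 ∈ Ω → 0 < z.2 → z ∉ Z →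
      ∃ J : ℝ, ∀ side ∈ ({(F k).ahead, (F k).behind} : Set (Set (SpaceTime N))),
        Tendsto (fun w => u w * (c⁻¹ * timeDeriv u w) * (c⁻¹ * timeDeriv (F k).eqn z)
            - u w * ⟪gradX u w, gradX (F k).eqn z⟫)
          (𝓝[side ∩ regularPoints Ω F Z] z) (𝓝 J)) ∧
    ∀ t : ℝ, 0 < t →
      IntegrableOn (lagrangian c u) (Ω ×ˢ Ioo 0 t) volume ∧
      IntegrableOn (fun z => u z * G z) (Ω ×ˢ Ioo 0 t) volume ∧
      Integrable (fun z => uS z * p z)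
        ((surfaceMeasure Ω).prod (volume.restrict (Ioo 0 t))) ∧
      IntegrableOn (fun x => u (x, t) * timeDeriv u (x, t) - u₀ x * v₀ x) Ω volume ∧
      2 * ∫ z in Ω ×ˢ Ioo 0 t, lagrangian c u z =
        (∫ z in Ω ×ˢ Ioo 0 t, u z * G z)
          - (∫ s in Ioo 0 t, ∫ x, uS (x, s) * p (x, s) ∂(surfaceMeasure Ω))
          + (c ^ 2)⁻¹ * ∫ x in Ω, (u (x, t) * timeDeriv u (x, t) - u₀ x * v₀ x) := by
  have hΩm := hΩ.isOpen.measurableSet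
  have hσ := hΩ.isFiniteMeasure_surfaceMeasure hN
  refine ⟨fun k z hz hzΩ hz0 hzZ => hu.exists_tendsto_flux hc hΩ.isOpen hz hzΩ hz0 hzZ,
    fun t ht => ?_⟩
  have hL := hu.integrableOn_lagrangian hΩm hΩ.isBounded t
  have hUG := hu.integrableOn_mul_source hΩm hΩ.isBounded (hG t)
  have hS := hu.integrable_boundary hΩ hN t
  have hslice := hu.integrableOn_slice hΩ ht
  -- The horizon `t + 1` leaves room after `t`, since `balance` needs its later instant strictly
  -- inside the time interval.
  have hS' := hu.integrable_boundary hΩ hN (t + 1)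
  have hmeas : ∀ T : ℝ, (volume : Measure (SpaceTime N)).restrict (Ω ×ˢ Ioo 0 T)
      = (volume.restrict Ω).prod (volume.restrict (Ioo 0 T)) := fun T => by
    rw [Measure.prod_restrict]
    rfl
  obtain ⟨M, hfield⟩ := hu.exists_isBoundedField hΩm hΩ.isBounded (hG (t + 1))
  have hf := hfield.integrable
  have hbal := fun (a : ℝ) (ha : 0 < a) (hat : a ≤ t) =>
    hu.balance hc hΩ hN (hG (t + 1)) ha hat (lt_add_one t)
  rw [hmeas] at hf
  simp only [hmeas] at hbal
  have hposf : ∀ {ν : Measure (Space N)} [SFinite ν],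
      ∀ᵐ z ∂(ν.prod ((volume : Measure ℝ).restrict (Ioo 0 (t + 1)))), 0 < z.2 := by
    intro ν _
    have : ∀ᵐ s ∂(volume : Measure ℝ).restrict (Ioo 0 (t + 1)), 0 < s :=
      (ae_restrict_mem measurableSet_Ioo).mono fun s hs => hs.1
    exact Measure.quasiMeasurePreserving_snd.ae this
  have hc2 : (c ^ 2)⁻¹ ≠ 0 := by positivity
  -- The balance solved for `∫ u ∂u/∂t` at the earlier instant: the remaining terms converge as that
  -- instant tends to zero, so this one does too.
  have hlim := (((tendsto_setIntegral_lt_snd hf hposf).sub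
    (tendsto_setIntegral_lt_snd hS' hposf)).sub_const
      ((∫ z in {z | t < z.2}, fluxDiv c u G z ∂((volume.restrict Ω).prod
          (volume.restrict (Ioo 0 (t + 1)))))
        - (∫ z in {z | t < z.2}, uS z * p z
          ∂((surfaceMeasure Ω).prod (volume.restrict (Ioo 0 (t + 1)))))
        - (c ^ 2)⁻¹ * ∫ x in Ω, u (x, t) * timeDeriv u (x, t))).const_mul ((c ^ 2)⁻¹)⁻¹
  obtain ⟨hv, hA₀⟩ := hu.integrableOn_initial hΩ (hlim.congr' (by
    filter_upwards [Ioc_mem_nhdsGT ht] with a ha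
    rw [← hbal a ha.1 ha.2, inv_mul_eq_iff_eq_mul₀ hc2]
    ring))
  rw [inv_mul_eq_iff_eq_mul₀ hc2] at hA₀
  -- Subtracting the integrals over times after `t` removes the auxiliary horizon.
  have h1 := integral_sub_setIntegral_lt_snd (lt_add_one t) hf
  have h2 := integral_sub_setIntegral_lt_snd (lt_add_one t) hS'
  have h3 : ∫ z, fluxDiv c u G z ∂((volume.restrict Ω).prod (volume.restrict (Ioo 0 t)))
      = (∫ z in Ω ×ˢ Ioo 0 t, u z * G z) - 2 * ∫ z in Ω ×ˢ Ioo 0 t, lagrangian c u z := by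
    rw [← hmeas, ← integral_const_mul, ← integral_sub hUG (hL.const_mul 2)]
    rfl
  refine ⟨hL, hUG, hS, hslice.sub hv, ?_⟩
  rw [integral_sub hslice hv, ← integral_prod_symm _ hS, mul_sub]
  linarith
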